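/- Let $G=(V,E,w)$ be a connected graph with $n$ vertices, $m$ edges and positive edge weights, and let $T=(V,F,w)$ be a spanning tree of $G$ (edges of $T$ keep their weights). Let $L_G=\sum_{(u,v)\in E}w(u,v)(\psi_u-\psi_v)(\psi_u-\psi_v)^T$ be the Laplacian of $G$, where $\psi_u$ is the unit vector of $u$, let $L_T$ be the Laplacian of $T$, and let $\mathrm{st}_T(G)=\sum_{e\in E}w(e)\sum_{i}1/w(e_i)$, where $e_1,e_2,\dots$ are the edges of the path in $T$ between the endpoints of $e$. Write $A^+$ for the Moore–Penrose pseudo-inverse and $\|x\|_A=\sqrt{x^TAx}$. For $b$ in the range of $L_G$ let $x_0=0,x_1,x_2,\dots$ be the iterates of the preconditioned conjugate gradient method (PCG) in exact arithmetic for $L_Gx=b$ with preconditioner $L_T$ (applied as $L_T^+$). Say that $x$ has accuracy $\varepsilon$ if $\|x-L_G^+b\|_{L_G}\le\varepsilon\,\|L_G^+b\|_{L_G}$. Fix $\varepsilon_0\in(0,1)$; below $0<\varepsilon\le\varepsilon_0$. (1) Number of iterations. There is a constant $C$ depending only on $\varepsilon_0$ such that, for all such $G,T,b,\varepsilon$,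 the iterate $x_k$ has accuracy $\varepsilon$ for every integer $k\ge\lfloor C\,\mathrm{st}_T(G)^{1/3}\ln(1/\varepsilon)\rfloor$. That is, PCG reaches accuracy $\varepsilon$ within $O(\mathrm{st}_T(G)^{1/3}\ln(1/\varepsilon))$ iterations. (2) Running time. There is a single program $P$ for a real random access machine (exact real arithmetic, unit cost per operation, constant and memory access) that, given $n$, the list of edges with their weights, marks on the edges of $T$, the vector $b$ and a number $k$, computes the $k$-th PCG iterate $x_k$, such that: (a) $P$ takes $O((n+m)(k+1))$ steps. (b) If $n\ge2$, then for some $C$ depending only on $\varepsilon_0$ and $k=\lfloor C\,\mathrm{st}_T(G)^{1/3}\ln(1/\varepsilon)\rfloor$, the iterate $x_k$ has accuracy $\varepsilon$ and $P$ computes it in $O(m\,\mathrm{st}_T(G)^{1/3}\ln(1/\varepsilon))$ steps, with an implied constant depending only on $\varepsilon_0$. (c) Let $K>0$. There is a constant $C$ depending only on $K$ and $\varepsilon_0$ such that, whenever $n\ge16$ and $T$ has stretch at most $K\,m\log n\,\log\log n\,(\log\log\log n)^3$ (the order of the stretch of the trees of Abraham, Bartal and Neiman), for $k=\lfloor C\,m^{1/3}(\log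 n)^{1/3}(\log\log n)^{2/3}\ln(1/\varepsilon)\rfloor$ the iterate $x_k$ has accuracy $\varepsilon$ and $P$ computes it in $O(m^{4/3}(\log n)^{1/3}(\log\log n)^{2/3}\ln(1/\varepsilon))=\tilde O(m^{4/3}\ln(1/\varepsilon))$ steps, with an implied constant depending only on $K$ and $\varepsilon_0$. -/

import Mathlib

open scoped Matrix

namespace TreePCG

noncomputable section

/-! ### The Moore-Penrose pseudo-inverse -/

/-- `X` satisfies the four Penrose conditions for the real matrix `A`. -/
structure IsPinv {V : Type*} [Fintype V] (A X : Matrix V V ℝ) : Prop where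
  mul_mul : A * X * A = A
  mul_mul' : X * A * X = X
  symm_left : (A * X)ᵀ = A * X
  symm_right : (X * A)ᵀ = X * A

theorem IsPinv.unique {V : Type*} [Fintype V] {A X Y : Matrix V V ℝ}
    (hX : IsPinv A X) (hY : IsPinv A Y) : X = Y := by
  have hA : A * X = A * Y := by
    calc A * X = (A * X)ᵀ := hX.symm_left.symm
      _ = ((A * Y) * (A * X))ᵀ := by
        rw [← Matrix.mul_assoc, hY.mul_mul]
      _ = (A * X) * (A * Y) := by rw [Matrix.transpose_mul, hX.symm_left, hY.symm_left]
      _ = A * Y := by rw [← Matrix.mul_assoc, hX.mul_mul]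
  have hB : X * A = Y * A := by
    calc X * A = (X * A)ᵀ := hX.symm_right.symm
      _ = ((X * A) * (Y * A))ᵀ := by
        rw [Matrix.mul_assoc X, ← Matrix.mul_assoc A Y A, hY.mul_mul]
      _ = (Y * A) * (X * A) := by rw [Matrix.transpose_mul, hX.symm_right, hY.symm_right]
      _ = Y * A := by rw [Matrix.mul_assoc Y, ← Matrix.mul_assoc A X A, hX.mul_mul]
  calc X = X * A * X := hX.mul_mul'.symm
    _ = Y * A * X := by rw [hB]
    _ = Y * (A * Y) := by rw [Matrix.mul_assoc, hA]
    _ = Y := by rw [← Matrix.mul_assoc, hY.mul_mul']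

/-- Every real symmetric matrix has a pseudo-inverse. -/
theorem exists_isPinv {V : Type*} [Fintype V] {A : Matrix V V ℝ} (hA : Aᵀ = A) :
    ∃ X, IsPinv A X := by
  classical
  have hH : A.IsHermitian := by
    rw [Matrix.IsHermitian, Matrix.conjTranspose_eq_transpose_of_trivial, hA]
  obtain ⟨U, d, hU, hAU⟩ : ∃ (U : Matrix V V ℝ) (d : V → ℝ), Uᵀ * U = 1 ∧
      A = U * Matrix.diagonal d * Uᵀ := by
    refine ⟨hH.eigenvectorUnitary, hH.eigenvalues, ?_, ?_⟩
    · have := Unitary.coe_star_mul_self hH.eigenvectorUnitary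
      simpa [Matrix.star_eq_conjTranspose, Matrix.conjTranspose_eq_transpose_of_trivial] using this
    · have := hH.spectral_theorem
      simpa [Unitary.conjStarAlgAut_apply, Matrix.star_eq_conjTranspose,
        Matrix.conjTranspose_eq_transpose_of_trivial, Function.comp_def] using this
  have key : ∀ a b : V → ℝ, (U * Matrix.diagonal a * Uᵀ) * (U * Matrix.diagonal b * Uᵀ)
      = U * Matrix.diagonal (a * b) * Uᵀ := by
    intro a b
    calc _ = U * Matrix.diagonal a * (Uᵀ * U) * Matrix.diagonal b * Uᵀ := by
          simp only [Matrix.mul_assoc]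
      _ = _ := by
          rw [hU, Matrix.mul_one, Matrix.mul_assoc U, Matrix.diagonal_mul_diagonal]; rfl
  have tr : ∀ a : V → ℝ, (U * Matrix.diagonal a * Uᵀ)ᵀ = U * Matrix.diagonal a * Uᵀ := by
    intro a
    simp [Matrix.transpose_mul, Matrix.mul_assoc]
  refine ⟨U * Matrix.diagonal d⁻¹ * Uᵀ, ?_, ?_, ?_, ?_⟩
  · rw [hAU, key, key]
    congr 3
    ext i
    simp
  · rw [hAU, key, key]
    congr 3
    ext i
    by_cases h : d i = 0 <;> simp [h]
  · rw [hAU, key, tr]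
  · rw [hAU, key, tr]

open Classical in
/-- The pseudo-inverse `A⁺` (`0` if there is none, which never happens for symmetric `A`). -/
def pinv {V : Type*} [Fintype V] (A : Matrix V V ℝ) : Matrix V V ℝ :=
  if h : ∃ X, IsPinv A X then h.choose else 0

theorem pinv_spec {V : Type*} [Fintype V] {A : Matrix V V ℝ} (hA : Aᵀ = A) :
    IsPinv A (pinv A) := by
  have h := exists_isPinv hA
  rw [pinv, dif_pos h]
  exact h.choose_spec

/-- The seminorm `‖x‖_A = √(xᵀ A x)`. -/
def normA {V : Type*} [Fintype V] (A : Matrix V V ℝ) (x : V → ℝ) : ℝ :=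
  Real.sqrt (x ⬝ᵥ (A *ᵥ x))

/-! ### Weighted graphs: Laplacian and stretch -/

/-- The Laplacian of the weight-1 edge `{u, v}`: the outer product of `ψ_u - ψ_v` with itself. -/
def edgeLap {V : Type*} [DecidableEq V] (e : Sym2 V) : Matrix V V ℝ :=
  Sym2.lift ⟨fun u v => Matrix.vecMulVec
      ((Pi.single u 1 : V → ℝ) - Pi.single v 1) ((Pi.single u 1 : V → ℝ) - Pi.single v 1), by
    intro u v
    ext i j
    simp only [Matrix.vecMulVec_apply, Pi.sub_apply]
    ring⟩ e

open Classical in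
/-- The Laplacian `L_G = ∑_{(u,v) ∈ E} w(u,v) L_{(u,v)}`. -/
def lap {V : Type*} [Fintype V] [DecidableEq V] (G : SimpleGraph V) (w : Sym2 V → ℝ) :
    Matrix V V ℝ :=
  ∑ e : Sym2 V with e ∈ G.edgeSet, w e • edgeLap e

/-- `f` is an edge of a path in `T` that joins the endpoints of `e`. -/
def OnPath {V : Type*} (T : SimpleGraph V) (e f : Sym2 V) : Prop :=
  ∃ (u v : V) (p : T.Walk u v), e = s(u, v) ∧ p.IsPath ∧ f ∈ p.edges

/-- The Laplacian is symmetric, so that `pinv_spec` applies to it. -/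
theorem lap_transpose {V : Type*} [Fintype V] [DecidableEq V] (G : SimpleGraph V)
    (w : Sym2 V → ℝ) : (lap G w)ᵀ = lap G w := by
  rw [lap, Matrix.transpose_sum]
  refine Finset.sum_congr rfl fun e _ => ?_
  induction e with
  | _ u v =>
    rw [Matrix.transpose_smul]
    simp [edgeLap, Matrix.transpose_vecMulVec]

open Classical in
/-- The stretch of the edge `e` with respect to the tree `T`: the weight of `e` times
the sum of `1 / w f` over the edges `f` of the path in `T` that joins the endpoints of `e`. -/
def edgeStretch {V : Type*} [Fintype V] (T : SimpleGraph V) (w : Sym2 V → ℝ) (e : Sym2 V) : ℝ :=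
  w e * ∑ f : Sym2 V with OnPath T e f, 1 / w f

open Classical in
/-- The stretch of `G` with respect to `T`. -/
def stretch {V : Type*} [Fintype V] (G T : SimpleGraph V) (w : Sym2 V → ℝ) : ℝ :=
  ∑ e : Sym2 V with e ∈ G.edgeSet, edgeStretch T w e

/-! ### Preconditioned conjugate gradient -/

/-- The state of the method: the iterate, the residual and the search direction. -/
structure CGState (V : Type*) where
  x : V → ℝ
  r : V → ℝ
  p : V → ℝ

/-- The initial state, with `x₀ = 0`. -/
def pcgInit {V : Type*} [Fintype V] (C : Matrix V V ℝ) (b : V → ℝ) : CGState V where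
  x := 0
  r := b
  p := pinv C *ᵥ b

open Classical in
/-- One iteration for `A x = b` with preconditioner `C`; nothing changes once the residual is `0`.
The preconditioner is applied as `C⁺`. -/
def pcgStep {V : Type*} [Fintype V] (A C : Matrix V V ℝ) (s : CGState V) : CGState V :=
  if s.r = 0 then s else
    let z := pinv C *ᵥ s.r
    let α := (s.r ⬝ᵥ z) / (s.p ⬝ᵥ (A *ᵥ s.p))
    let r' := s.r - α • (A *ᵥ s.p)
    let z' := pinv C *ᵥ r'
    let β := (r' ⬝ᵥ z') / (s.r ⬝ᵥ z)
    { x := s.x + α • s.p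
      r := r'
      p := z' + β • s.p }

/-- The `k`-th iterate of the preconditioned conjugate gradient, started at `0`. -/
def pcg {V : Type*} [Fintype V] (A C : Matrix V V ℝ) (b : V → ℝ) (k : ℕ) : V → ℝ :=
  ((pcgStep A C)^[k] (pcgInit C b)).x

/-- `x` solves `A x = b` to accuracy `ε` in the `A`-norm. -/
def Accurate {V : Type*} [Fintype V] (A : Matrix V V ℝ) (b : V → ℝ) (ε : ℝ) (x : V → ℝ) : Prop :=
  normA A (x - pinv A *ᵥ b) ≤ ε * normA A (pinv A *ᵥ b)

/-- A connected weighted graph `G` on the vertices `0, …, n - 1`, a spanning tree `T` of `G`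
(with the same weights), and a right-hand side `b` in the range of `L_G`. -/
structure System (n : ℕ) where
  G : SimpleGraph (Fin n)
  w : Sym2 (Fin n) → ℝ
  T : SimpleGraph (Fin n)
  b : Fin n → ℝ
  connected : G.Connected
  w_pos : ∀ e ∈ G.edgeSet, 0 < w e
  le : T ≤ G
  isTree : T.IsTree
  b_mem : ∃ y, lap G w *ᵥ y = b

/-- The stretch of `G` with respect to `T`. -/
def System.st {n : ℕ} (Q : System n) : ℝ := stretch Q.G Q.T Q.w

/-- The `k`-th iterate of PCG for `L_G x = b` with preconditioner `L_T`. -/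
def System.iterate {n : ℕ} (Q : System n) (k : ℕ) : Fin n → ℝ :=
  pcg (lap Q.G Q.w) (lap Q.T Q.w) Q.b k

/-- `x` solves `L_G x = b` to accuracy `ε` in the `L_G`-norm. -/
def System.Accurate {n : ℕ} (Q : System n) (ε : ℝ) (x : Fin n → ℝ) : Prop :=
  TreePCG.Accurate (lap Q.G Q.w) Q.b ε x

/-! ### A real random access machine

Programs of a small structured language act on arrays of natural numbers (indices, counters) and
arrays of real numbers (exact arithmetic). There is no passage from reals to naturals
except through comparisons, and naturals can only be added and subtracted. Each operation, constant
and memory access costs one step. -/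

/-- Expressions with values in `ℕ`: constants, array cells, sum, truncated difference. -/
inductive NExp where
  | lit (c : ℕ)
  | get (a : ℕ) (i : NExp)
  | add (x y : NExp)
  | sub (x y : NExp)

/-- Expressions with values in `ℝ`: integer constants, array cells, field operations. -/
inductive RExp where
  | lit (c : ℤ)
  | get (a : ℕ) (i : NExp)
  | add (x y : RExp)
  | sub (x y : RExp)
  | mul (x y : RExp)
  | div (x y : RExp)

/-- Tests. -/
inductive Test where
  | natEq (x y : NExp)
  | natLt (x y : NExp)
  | realLt (x y : RExp)
  | not (c : Test)
  | and (c d : Test)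

/-- Programs. -/
inductive Prog where
  | skip
  | setNat (a : ℕ) (i : NExp) (e : NExp)
  | setReal (a : ℕ) (i : NExp) (e : RExp)
  | seq (p q : Prog)
  | ite (c : Test) (p q : Prog)
  | loop (c : Test) (p : Prog)

/-- The memory: cell `i` of the `a`-th array of naturals, and of the `a`-th array of reals. -/
structure Mem where
  nat : ℕ → ℕ → ℕ
  real : ℕ → ℕ → ℝ

/-- The value of an expression. -/
def NExp.eval (s : Mem) : NExp → ℕ
  | .lit c => c
  | .get a i => s.nat a (i.eval s)
  | .add x y => x.eval s + y.eval s
  | .sub x y => x.eval s - y.eval s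

/-- The number of steps that the evaluation takes. -/
def NExp.cost : NExp → ℕ
  | .lit _ => 1
  | .get _ i => i.cost + 1
  | .add x y => x.cost + y.cost + 1
  | .sub x y => x.cost + y.cost + 1

/-- The value of an expression; division by `0` returns `0`. -/
def RExp.eval (s : Mem) : RExp → ℝ
  | .lit c => c
  | .get a i => s.real a (i.eval s)
  | .add x y => x.eval s + y.eval s
  | .sub x y => x.eval s - y.eval s
  | .mul x y => x.eval s * y.eval s
  | .div x y => x.eval s / y.eval s

/-- The number of steps that the evaluation takes. -/
def RExp.cost : RExp → ℕ
  | .lit _ => 1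
  | .get _ i => i.cost + 1
  | .add x y => x.cost + y.cost + 1
  | .sub x y => x.cost + y.cost + 1
  | .mul x y => x.cost + y.cost + 1
  | .div x y => x.cost + y.cost + 1

/-- The outcome of a test. -/
def Test.eval (s : Mem) : Test → Prop
  | .natEq x y => x.eval s = y.eval s
  | .natLt x y => x.eval s < y.eval s
  | .realLt x y => x.eval s < y.eval s
  | .not c => ¬ c.eval s
  | .and c d => c.eval s ∧ d.eval s

/-- The number of steps that a test takes. -/
def Test.cost : Test → ℕ
  | .natEq x y => x.cost + y.cost + 1
  | .natLt x y => x.cost + y.cost + 1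
  | .realLt x y => x.cost + y.cost + 1
  | .not c => c.cost + 1
  | .and c d => c.cost + d.cost + 1

/-- Write `v` into cell `i` of the `a`-th array of naturals. -/
def Mem.setNat (s : Mem) (a i v : ℕ) : Mem where
  nat := Function.update s.nat a (Function.update (s.nat a) i v)
  real := s.real

/-- Write `v` into cell `i` of the `a`-th array of reals. -/
def Mem.setReal (s : Mem) (a i : ℕ) (v : ℝ) : Mem where
  nat := s.nat
  real := Function.update s.real a (Function.update (s.real a) i v)

/-- `Exec p s s' t`: started in memory `s`, the program `p` halts in memory `s'`
after exactly `t` steps. -/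
inductive Exec : Prog → Mem → Mem → ℕ → Prop where
  | skip (s : Mem) : Exec .skip s s 1
  | setNat (a : ℕ) (i e : NExp) (s : Mem) :
      Exec (.setNat a i e) s (s.setNat a (i.eval s) (e.eval s)) (i.cost + e.cost + 1)
  | setReal (a : ℕ) (i : NExp) (e : RExp) (s : Mem) :
      Exec (.setReal a i e) s (s.setReal a (i.eval s) (e.eval s)) (i.cost + e.cost + 1)
  | seq {p q : Prog} {s s₁ s₂ : Mem} {t₁ t₂ : ℕ} (h₁ : Exec p s s₁ t₁) (h₂ : Exec q s₁ s₂ t₂) :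
      Exec (.seq p q) s s₂ (t₁ + t₂)
  | iteTrue {c : Test} {p q : Prog} {s s₁ : Mem} {t : ℕ} (hc : c.eval s) (h : Exec p s s₁ t) :
      Exec (.ite c p q) s s₁ (c.cost + t + 1)
  | iteFalse {c : Test} {p q : Prog} {s s₁ : Mem} {t : ℕ} (hc : ¬ c.eval s) (h : Exec q s s₁ t) :
      Exec (.ite c p q) s s₁ (c.cost + t + 1)
  | loopTrue {c : Test} {p : Prog} {s s₁ s₂ : Mem} {t₁ t₂ : ℕ} (hc : c.eval s)
      (h₁ : Exec p s s₁ t₁) (h₂ : Exec (.loop c p) s₁ s₂ t₂) :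
      Exec (.loop c p) s s₂ (c.cost + t₁ + t₂ + 1)
  | loopFalse {c : Test} {p : Prog} {s : Mem} (hc : ¬ c.eval s) :
      Exec (.loop c p) s s (c.cost + 1)

/-- `es` lists every edge of `G` exactly once, each as a pair of endpoints in some order. -/
def ListsEdges {n : ℕ} (G : SimpleGraph (Fin n)) (es : List (Fin n × Fin n)) : Prop :=
  (es.map fun e => s(e.1, e.2)).Nodup ∧
    ∀ f : Sym2 (Fin n), f ∈ es.map (fun e => s(e.1, e.2)) ↔ f ∈ G.edgeSet

open Classical in
/-- The initial memory for `k` iterations on `Q`. Naturals: array `0` starts with `n`, the number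
of edges and `k`; arrays `1` and `2` hold the endpoints of the edges; array `3` marks the edges of
`T` by `1`. Reals: array `0` holds the weights of the edges, array `1` the vector `b`.
All other cells are `0`. -/
def System.input {n : ℕ} (Q : System n) (es : List (Fin n × Fin n)) (k : ℕ) : Mem where
  nat a i :=
    if a = 0 then (if i = 0 then n else if i = 1 then es.length else if i = 2 then k else 0)
    else if h : i < es.length then
      if a = 1 then ((es[i]'h).1 : ℕ)
      else if a = 2 then ((es[i]'h).2 : ℕ)
      else if a = 3 then (if s((es[i]'h).1, (es[i]'h).2) ∈ Q.T.edgeSet then 1 else 0)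
      else 0
    else 0
  real a i :=
    if a = 0 then (if h : i < es.length then Q.w s((es[i]'h).1, (es[i]'h).2) else 0)
    else if a = 1 then (if h : i < n then Q.b ⟨i, h⟩ else 0)
    else 0

/-- Within at most `τ` steps from memory `s` the program `P` halts with the vector `x` in the first
`n` cells of real array `2`. -/
def Outputs {n : ℕ} (P : Prog) (s : Mem) (x : Fin n → ℝ) (τ : ℝ) : Prop :=
  ∃ (s' : Mem) (t : ℕ), Exec P s s' t ∧ (t : ℝ) ≤ τ ∧ ∀ j : Fin n, s'.real 2 j = x j

end

end TreePCG

/-! Write `M = L_T⁺ L_G` and `ρ = st_T(G)^(1/3)`. The iteration bound rests on two facts about the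
spectrum of `M`. Since `L_T ≤ L_G` and both have the same kernel, every nonzero eigenvalue is at
least 1 (`Precond.exists_spectrum`). The trace is at most the stretch, because the effective
resistance of a pair in `T` is bounded by the sum of `1 / w` along the tree path
(`trace_le_stretch`). A sum of at most `ρ ^ 3` leaves at most `ρ` eigenvalues above `(ρ + 1) ^ 2`. A
polynomial that is 1 at 0 kills these few with one linear factor each and spends its remaining
degree on a Chebyshev polynomial for `[1, (ρ + 1) ^ 2]`, whose decay rate is `1 / (ρ + 1)`
(`exists_small_polynomial`). Conjugate gradient picks the point of the Krylov space that is nearest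
to the solution in the `A`-norm (`Precond.pcg_optimal`), so it does at least as well as this
polynomial (`Precond.normA_pcg_sub_le`). Hence about `ρ ln(1/ε)` iterations suffice
(`iteration_bound`). For the running time it remains to perform one iteration in `O(n + m)` steps.
The only part that is not a vector operation or a pass over the edges is the application of `L_T⁺`.
A tree is eliminated leaf by leaf (`ElimInv.step`); one sweep along this order computes the flow
through each tree edge, one sweep back computes potentials, and subtracting the mean gives the
pseudo-inverse (`System.pinv_lapT_mulVec`, `wp_solve`). The order itself is found once in linear
time (`wp_order`). A small program logic, `Wp`, carries correctness and step counts together;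
`wp_pcg` is the verified program. -/

namespace TreePCG

/-! ### Symmetric matrices and their pseudo-inverses -/

section LinearAlgebra

variable {V : Type*} [Fintype V]

theorem dotProduct_mulVec_comm {A : Matrix V V ℝ} (hA : Aᵀ = A) (x y : V → ℝ) :
    x ⬝ᵥ (A *ᵥ y) = y ⬝ᵥ (A *ᵥ x) := by
  rw [Matrix.dotProduct_mulVec, ← Matrix.mulVec_transpose, hA, dotProduct_comm]

theorem posSemidef_of_dotProduct {A : Matrix V V ℝ} (hA : Aᵀ = A)
    (h : ∀ x, 0 ≤ x ⬝ᵥ (A *ᵥ x)) : A.PosSemidef := by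
  refine Matrix.PosSemidef.of_dotProduct_mulVec_nonneg ?_ fun x => by simpa using h x
  rw [Matrix.IsHermitian, Matrix.conjTranspose_eq_transpose_of_trivial, hA]

theorem mulVec_eq_zero_of_dotProduct {A : Matrix V V ℝ} (hA : Aᵀ = A)
    (h : ∀ x, 0 ≤ x ⬝ᵥ (A *ᵥ x)) {x : V → ℝ} (hx : x ⬝ᵥ (A *ᵥ x) = 0) : A *ᵥ x = 0 := by
  classical
  exact ((posSemidef_of_dotProduct hA h).dotProduct_mulVec_zero_iff x).1 (by simpa using hx)

/-- Transposition permutes the Penrose conditions of a symmetric matrix, so uniqueness applies. -/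
theorem pinv_transpose {A : Matrix V V ℝ} (hA : Aᵀ = A) : (pinv A)ᵀ = pinv A := by
  have h := pinv_spec hA
  refine IsPinv.unique (A := A) ⟨?_, ?_, ?_, ?_⟩ h
  · have := congrArg Matrix.transpose h.mul_mul
    simpa [Matrix.transpose_mul, hA, Matrix.mul_assoc] using this
  · have := congrArg Matrix.transpose h.mul_mul'
    simpa [Matrix.transpose_mul, hA, Matrix.mul_assoc] using this
  · have := congrArg Matrix.transpose h.symm_right
    simpa [Matrix.transpose_mul, hA] using this
  · have := congrArg Matrix.transpose h.symm_left
    simpa [Matrix.transpose_mul, hA] using this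

theorem pinv_mul_comm {A : Matrix V V ℝ} (hA : Aᵀ = A) : pinv A * A = A * pinv A := by
  have := (pinv_spec hA).symm_left
  rwa [Matrix.transpose_mul, hA, pinv_transpose hA] at this

/-- `A⁺ = A⁺ A A⁺` is a congruence transform of `A`. -/
theorem pinv_nonneg {A : Matrix V V ℝ} (hA : Aᵀ = A) (h : ∀ x, 0 ≤ x ⬝ᵥ (A *ᵥ x)) (x : V → ℝ) :
    0 ≤ x ⬝ᵥ (pinv A *ᵥ x) := by
  have h1 : pinv A = (pinv A)ᵀ * A * pinv A := by
    rw [pinv_transpose hA, (pinv_spec hA).mul_mul']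
  have h2 : x ⬝ᵥ (pinv A *ᵥ x) = (pinv A *ᵥ x) ⬝ᵥ (A *ᵥ (pinv A *ᵥ x)) := by
    conv_lhs => rw [h1]
    rw [← Matrix.mulVec_mulVec, ← Matrix.mulVec_mulVec, Matrix.mulVec_transpose,
      dotProduct_comm, ← Matrix.dotProduct_mulVec, dotProduct_comm]
  rw [h2]
  exact h _

/-- `A *ᵥ (pinv A *ᵥ b) = b` for `b` in the range of `A`. -/
theorem mulVec_pinv_mulVec {A : Matrix V V ℝ} (hA : Aᵀ = A) {b : V → ℝ}
    (hb : ∃ y, A *ᵥ y = b) : A *ᵥ (pinv A *ᵥ b) = b := by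
  obtain ⟨y, rfl⟩ := hb
  rw [Matrix.mulVec_mulVec, Matrix.mulVec_mulVec, (pinv_spec hA).mul_mul]

/-- `C` is a symmetric preconditioner of the symmetric matrix `A` with `0 ≤ C ≤ A` and with the
same kernel. -/
structure Precond (A C : Matrix V V ℝ) : Prop where
  symA : Aᵀ = A
  symC : Cᵀ = C
  nonneg : ∀ x, 0 ≤ x ⬝ᵥ (C *ᵥ x)
  le : ∀ x, x ⬝ᵥ (C *ᵥ x) ≤ x ⬝ᵥ (A *ᵥ x)
  ker : ∀ x, C *ᵥ x = 0 → A *ᵥ x = 0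

namespace Precond

variable {A C : Matrix V V ℝ} (h : Precond A C)
include h

theorem nonnegA (x : V → ℝ) : 0 ≤ x ⬝ᵥ (A *ᵥ x) := (h.nonneg x).trans (h.le x)

theorem ker' {x : V → ℝ} (hx : A *ᵥ x = 0) : C *ᵥ x = 0 := by
  refine mulVec_eq_zero_of_dotProduct h.symC h.nonneg (le_antisymm ?_ (h.nonneg x))
  simpa [hx] using h.le x

/-- `1 - C⁺ C` maps into the kernel of `C`, which `A` annihilates. -/
theorem mul_pinv_mul : A * pinv C * C = A := by
  classical
  refine Matrix.ext_of_mulVec_single fun i => ?_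
  have h1 : C *ᵥ (Pi.single i 1 - (pinv C * C) *ᵥ Pi.single i 1) = 0 := by
    rw [Matrix.mulVec_sub, Matrix.mulVec_mulVec, ← Matrix.mul_assoc, (pinv_spec h.symC).mul_mul,
      sub_self]
  have h2 := h.ker _ h1
  rw [Matrix.mulVec_sub, sub_eq_zero, Matrix.mulVec_mulVec, ← Matrix.mul_assoc] at h2
  exact h2.symm

theorem mul_pinv_mul' : C * pinv C * A = A := by
  have := congrArg Matrix.transpose h.mul_pinv_mul
  simpa [Matrix.transpose_mul, h.symA, h.symC, pinv_transpose h.symC, Matrix.mul_assoc] using this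

/-- The preconditioner is positive definite on the range of `A`. -/
theorem eq_zero_of_dotProduct_pinv {r : V → ℝ} (hr : ∃ y, A *ᵥ y = r)
    (h0 : r ⬝ᵥ (pinv C *ᵥ r) = 0) : r = 0 := by
  have h1 := mulVec_eq_zero_of_dotProduct (pinv_transpose h.symC)
    (pinv_nonneg h.symC h.nonneg) h0
  obtain ⟨y, rfl⟩ := hr
  have h2 : C *ᵥ (pinv C *ᵥ (A *ᵥ y)) = A *ᵥ y := by
    rw [Matrix.mulVec_mulVec, Matrix.mulVec_mulVec, h.mul_pinv_mul']
  rw [← h2, h1, Matrix.mulVec_zero]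

/-- Search directions lie in the range of `C⁺`, where `A` is definite; this keeps the denominator of
the step length nonzero. -/
theorem eq_zero_of_dotProduct_mulVec {p : V → ℝ} (hp : ∃ y, pinv C *ᵥ y = p)
    (h0 : p ⬝ᵥ (A *ᵥ p) = 0) : p = 0 := by
  have h1 := h.ker' (mulVec_eq_zero_of_dotProduct h.symA h.nonnegA h0)
  obtain ⟨y, rfl⟩ := hp
  have h2 : pinv C *ᵥ (C *ᵥ (pinv C *ᵥ y)) = pinv C *ᵥ y := by
    rw [Matrix.mulVec_mulVec, Matrix.mulVec_mulVec, (pinv_spec h.symC).mul_mul']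
  rw [← h2, h1, Matrix.mulVec_zero]

end Precond

/-! ### Krylov spaces -/

/-- The Krylov space spanned by `z, M z, …, M ^ (k - 1) z`. -/
def krylov (M : Matrix V V ℝ) (z : V → ℝ) : ℕ → Submodule ℝ (V → ℝ)
  | 0 => ⊥
  | k + 1 => Submodule.span ℝ {z} ⊔ (krylov M z k).map M.mulVecLin

variable {M : Matrix V V ℝ} {z : V → ℝ}

theorem self_mem_krylov (k : ℕ) : z ∈ krylov M z (k + 1) :=
  Submodule.mem_sup_left (Submodule.mem_span_singleton_self z)

theorem mulVec_mem_krylov {k : ℕ} {y : V → ℝ} (hy : y ∈ krylov M z k) :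
    M *ᵥ y ∈ krylov M z (k + 1) :=
  Submodule.mem_sup_right (Submodule.mem_map_of_mem hy)

theorem krylov_succ_le {k : ℕ} {U : Submodule ℝ (V → ℝ)} (hz : z ∈ U)
    (hM : ∀ y ∈ krylov M z k, M *ᵥ y ∈ U) : krylov M z (k + 1) ≤ U := by
  refine sup_le ((Submodule.span_singleton_le_iff_mem _ _).2 hz) ?_
  rintro _ ⟨y, hy, rfl⟩
  exact hM y hy

theorem krylov_le_succ (k : ℕ) : krylov M z k ≤ krylov M z (k + 1) := by
  induction k with
  | zero => exact bot_le
  | succ k ih => exact krylov_succ_le (self_mem_krylov _) fun y hy => mulVec_mem_krylov (ih hy)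

/-- Horner's rule `q = X * divX q + q(0)` matches the recursive definition of `krylov`. -/
theorem aeval_mulVec_mem_krylov [DecidableEq V] (k : ℕ) (q : Polynomial ℝ)
    (hq : q.degree < k) : Polynomial.aeval M q *ᵥ z ∈ krylov M z k := by
  induction k generalizing q with
  | zero =>
    have : q = 0 := by simpa using hq
    simp [this]
  | succ k ih =>
    rw [← q.divX_mul_X_add]
    rw [map_add, Matrix.add_mulVec, mul_comm, map_mul, Polynomial.aeval_X, Polynomial.aeval_C,
      ← Matrix.mulVec_mulVec]
    refine add_mem (mulVec_mem_krylov (ih _ ?_)) ?_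
    · by_cases h0 : q.divX = 0
      · rw [h0, Polynomial.degree_zero]; exact WithBot.bot_lt_coe k
      · have h1 : q.natDegree < k + 1 := by
          refine (Polynomial.natDegree_lt_iff_degree_lt ?_).2 hq
          rintro rfl; simp at h0
        have h2 : q.divX.natDegree < k := by
          have h3 : q.natDegree ≠ 0 := fun h3 => h0 (Polynomial.divX_eq_zero_iff.2
            (Polynomial.eq_C_of_natDegree_eq_zero h3))
          rw [Polynomial.natDegree_divX_eq_natDegree_tsub_one]; omega
        exact (Polynomial.natDegree_lt_iff_degree_lt h0).1 h2
    · rw [Algebra.algebraMap_eq_smul_one, Matrix.smul_mulVec, Matrix.one_mulVec]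
      exact Submodule.smul_mem _ _ (self_mem_krylov _)

end LinearAlgebra

/-! ### Optimality of the iterates -/

section Optimality

variable {V : Type*} [Fintype V] {A C : Matrix V V ℝ} {b : V → ℝ}

/-- The state of the method after `k` iterations. -/
noncomputable def pcgState (A C : Matrix V V ℝ) (b : V → ℝ) (k : ℕ) : CGState V :=
  (pcgStep A C)^[k] (pcgInit C b)

theorem pcgState_succ (k : ℕ) : pcgState A C b (k + 1) = pcgStep A C (pcgState A C b k) :=
  Function.iterate_succ_apply' _ _ _

/-- The invariant of the method as long as the residual does not vanish. -/
structure CGInv (A C : Matrix V V ℝ) (b : V → ℝ) (k : ℕ) (s : CGState V) : Prop where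
  r_eq : s.r = b - A *ᵥ s.x
  x_mem : s.x ∈ krylov (pinv C * A) (pinv C *ᵥ b) k
  r_perp : ∀ y ∈ krylov (pinv C * A) (pinv C *ᵥ b) k, s.r ⬝ᵥ y = 0
  p_conj : ∀ y ∈ krylov (pinv C * A) (pinv C *ᵥ b) k, y ⬝ᵥ (A *ᵥ s.p) = 0
  p_sub_mem : s.p - pinv C *ᵥ s.r ∈ krylov (pinv C * A) (pinv C *ᵥ b) k
  p_mem : s.p ∈ krylov (pinv C * A) (pinv C *ᵥ b) (k + 1)
  krylov_le : krylov (pinv C * A) (pinv C *ᵥ b) (k + 1) ≤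
    krylov (pinv C * A) (pinv C *ᵥ b) k ⊔ Submodule.span ℝ {s.p}

theorem cgInv_init : CGInv A C b 0 (pcgInit C b) where
  r_eq := by simp [pcgInit]
  x_mem := by simp [pcgInit]
  r_perp := by simp [krylov]
  p_conj := by simp [krylov]
  p_sub_mem := by simp [pcgInit]
  p_mem := self_mem_krylov 0
  krylov_le := by simp [krylov, pcgInit]

theorem krylov_le_range_pinv (k : ℕ) {y : V → ℝ}
    (hy : y ∈ krylov (pinv C * A) (pinv C *ᵥ b) k) : ∃ x, pinv C *ᵥ x = y := by
  have : krylov (pinv C * A) (pinv C *ᵥ b) k ≤ LinearMap.range (pinv C).mulVecLin := by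
    refine (krylov_le_succ k).trans (krylov_succ_le ⟨b, rfl⟩ fun y _ => ⟨A *ᵥ y, ?_⟩)
    simp
  exact this hy

/-- The next Krylov space is the current one plus the line of `p`, so the new orthogonality
relations need checking only on the old space, where they are inherited, and on `p`, where the
choices of `α` and `β` enforce them. -/
theorem Precond.cgInv_step (h : Precond A C) (hb : ∃ y, A *ᵥ y = b) {k : ℕ} {s : CGState V}
    (hs : CGInv A C b k s) (hr : s.r ≠ 0) : CGInv A C b (k + 1) (pcgStep A C s) := by
  set K := krylov (pinv C * A) (pinv C *ᵥ b) with hK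
  have symP := pinv_transpose h.symC
  have hrange : ∃ y, A *ᵥ y = s.r := by
    obtain ⟨y, rfl⟩ := hb
    exact ⟨y - s.x, by rw [hs.r_eq, Matrix.mulVec_sub]⟩
  have hrz : s.r ⬝ᵥ (pinv C *ᵥ s.r) ≠ 0 := fun h0 => hr (h.eq_zero_of_dotProduct_pinv hrange h0)
  -- If `p` vanished, `p - z = -z` would lie in the Krylov space, to which `r` is orthogonal,
  -- contradicting `hrz`.
  have hpAp : s.p ⬝ᵥ (A *ᵥ s.p) ≠ 0 := by
    intro h0
    have hp := h.eq_zero_of_dotProduct_mulVec (krylov_le_range_pinv _ hs.p_mem) h0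
    have h1 := hs.r_perp _ hs.p_sub_mem
    rw [hp, zero_sub, dotProduct_neg, neg_eq_zero] at h1
    exact hrz h1
  obtain ⟨x, r, p⟩ := s
  simp only at hs hr hrange hrz hpAp
  obtain ⟨r_eq, x_mem, r_perp, p_conj, p_sub_mem, p_mem, krylov_le⟩ := hs
  simp only at r_eq x_mem r_perp p_conj p_sub_mem p_mem krylov_le
  simp only [pcgStep, if_neg hr]
  set z := pinv C *ᵥ r with hz
  set α := (r ⬝ᵥ z) / (p ⬝ᵥ (A *ᵥ p)) with hα
  have hα0 : α ≠ 0 := div_ne_zero hrz hpAp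
  have hαp : α * (p ⬝ᵥ (A *ᵥ p)) = r ⬝ᵥ z := div_mul_cancel₀ _ hpAp
  set r' := r - α • (A *ᵥ p) with hr'
  set z' := pinv C *ᵥ r' with hz'
  set β := (r' ⬝ᵥ z') / (r ⬝ᵥ z) with hβ
  have hβr : β * (r ⬝ᵥ z) = r' ⬝ᵥ z' := div_mul_cancel₀ _ hrz
  have hle := krylov_le_succ (M := pinv C * A) (z := pinv C *ᵥ b)
  have hr'perp : ∀ y ∈ K (k + 1), r' ⬝ᵥ y = 0 := by
    intro y hy
    obtain ⟨u, hu, v, hv, rfl⟩ := Submodule.mem_sup.1 (krylov_le hy)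
    obtain ⟨c, rfl⟩ := Submodule.mem_span_singleton.1 hv
    have h1 : r' ⬝ᵥ u = 0 := by
      rw [hr', sub_dotProduct, smul_dotProduct, dotProduct_comm (A *ᵥ p), r_perp u hu, p_conj u hu]
      simp
    -- As `r` is orthogonal to `p - z`, the numerator `r ⬝ᵥ z` of `α` equals `r ⬝ᵥ p`.
    have h2 : r' ⬝ᵥ p = 0 := by
      have h3 := r_perp _ p_sub_mem
      rw [dotProduct_sub] at h3
      rw [hr', sub_dotProduct, smul_dotProduct, dotProduct_comm (A *ᵥ p), smul_eq_mul, hαp]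
      exact h3
    rw [dotProduct_add, dotProduct_smul, h1, h2]
    simp
  have hz_mem : z ∈ K (k + 1) := by
    have : z = p - (p - z) := by simp
    rw [this]
    exact sub_mem p_mem (hle k p_sub_mem)
  have hzz : z' = z - α • ((pinv C * A) *ᵥ p) := by
    rw [hz', hr', Matrix.mulVec_sub, Matrix.mulVec_smul, Matrix.mulVec_mulVec]
  have hz'_mem : z' ∈ K (k + 2) := by
    rw [hzz]
    exact sub_mem (hle _ hz_mem) (Submodule.smul_mem _ _ (mulVec_mem_krylov p_mem))
  refine ⟨?_, ?_, hr'perp, ?_, ?_, ?_, ?_⟩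
  · simp only [hr', r_eq, Matrix.mulVec_add, Matrix.mulVec_smul]
    abel
  · exact add_mem (hle _ x_mem) (Submodule.smul_mem _ _ p_mem)
  · intro y hy
    obtain ⟨u, hu, v, hv, rfl⟩ := Submodule.mem_sup.1 (krylov_le hy)
    obtain ⟨c, rfl⟩ := Submodule.mem_span_singleton.1 hv
    have h1 : u ⬝ᵥ (A *ᵥ (z' + β • p)) = 0 := by
      rw [Matrix.mulVec_add, Matrix.mulVec_smul, dotProduct_add, dotProduct_smul, p_conj u hu,
        smul_zero, add_zero, dotProduct_mulVec_comm h.symA, hz',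
        dotProduct_comm, dotProduct_mulVec_comm symP, Matrix.mulVec_mulVec]
      exact hr'perp _ (mulVec_mem_krylov hu)
    -- From `α A p = r - r'` and the orthogonality of `r'` to `z`, `α (p ⬝ᵥ A z') = -(r' ⬝ᵥ z')`;
    -- the term with `β` contributes exactly the opposite.
    have h2 : p ⬝ᵥ (A *ᵥ (z' + β • p)) = 0 := by
      have h3 : α * (p ⬝ᵥ (A *ᵥ z')) = - (r' ⬝ᵥ z') := by
        have h4 : α • (A *ᵥ p) = r - r' := by rw [hr']; abel
        have h5 : r ⬝ᵥ z' = 0 := by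
          rw [hz', dotProduct_mulVec_comm symP]
          exact hr'perp _ hz_mem
        rw [dotProduct_mulVec_comm h.symA, ← smul_eq_mul, ← dotProduct_smul, h4, dotProduct_sub,
          dotProduct_comm z', dotProduct_comm z', h5, zero_sub]
      rw [Matrix.mulVec_add, Matrix.mulVec_smul, dotProduct_add, dotProduct_smul, smul_eq_mul]
      refine (mul_eq_zero.1 (?_ : α * _ = 0)).resolve_left hα0
      rw [mul_add, h3, mul_left_comm, hαp, hβr]
      ring
    rw [add_dotProduct, smul_dotProduct, h1, h2]
    simp
  · change z' + β • p - z' ∈ _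
    rw [add_sub_cancel_left]
    exact Submodule.smul_mem _ _ p_mem
  · exact add_mem hz'_mem (hle _ (Submodule.smul_mem _ _ p_mem))
  · have hl : K (k + 1) ≤ K (k + 1) ⊔ Submodule.span ℝ {z' + β • p} := le_sup_left
    refine krylov_succ_le (hl (self_mem_krylov k)) fun y hy => ?_
    obtain ⟨u, hu, v, hv, rfl⟩ := Submodule.mem_sup.1 (krylov_le hy)
    obtain ⟨c, rfl⟩ := Submodule.mem_span_singleton.1 hv
    rw [Matrix.mulVec_add, Matrix.mulVec_smul]
    refine add_mem (hl (mulVec_mem_krylov hu)) (Submodule.smul_mem _ _ ?_)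
    -- Since `α ≠ 0`, the only new Krylov vector `M p` is recovered from old vectors and the new
    -- direction.
    have h1 : (pinv C * A) *ᵥ p = α⁻¹ • (z + β • p - (z' + β • p)) := by
      rw [hzz, eq_inv_smul_iff₀ hα0]
      abel
    rw [h1]
    refine Submodule.smul_mem _ _ (sub_mem (hl (add_mem hz_mem (Submodule.smul_mem _ _ p_mem))) ?_)
    exact Submodule.mem_sup_right (Submodule.mem_span_singleton_self _)

/-- Once the residual is zero the state is frozen and already solves the system, so the invariant is
not needed any more; only the residual identity persists. -/
theorem Precond.cgInv_or (h : Precond A C) (hb : ∃ y, A *ᵥ y = b) (k : ℕ) :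
    (pcgState A C b k).r = b - A *ᵥ (pcgState A C b k).x ∧
      ((pcgState A C b k).r = 0 ∨ CGInv A C b k (pcgState A C b k)) := by
  induction k with
  | zero => exact ⟨cgInv_init.r_eq, Or.inr cgInv_init⟩
  | succ k ih =>
    by_cases h0 : (pcgState A C b k).r = 0
    · have : pcgState A C b (k + 1) = pcgState A C b k := by
        rw [pcgState_succ, pcgStep, if_pos h0]
      rw [this]
      exact ⟨ih.1, Or.inl h0⟩
    · have := h.cgInv_step hb (ih.2.resolve_left h0) h0
      rw [← pcgState_succ] at this
      exact ⟨this.r_eq, Or.inr this⟩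

/-- The `k`-th iterate is the best approximation from the Krylov space in the `A`-norm. -/
theorem Precond.pcg_optimal (h : Precond A C) (hb : ∃ y, A *ᵥ y = b) (k : ℕ) {y : V → ℝ}
    (hy : y ∈ krylov (pinv C * A) (pinv C *ᵥ b) k) :
    normA A (pcg A C b k - pinv A *ᵥ b) ≤ normA A (y - pinv A *ᵥ b) := by
  have hAb := mulVec_pinv_mulVec h.symA hb
  obtain ⟨hr, h0 | hI⟩ := h.cgInv_or hb k
  · have h1 : A *ᵥ (pcg A C b k - pinv A *ᵥ b) = 0 := by
      rw [Matrix.mulVec_sub, hAb]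
      rw [h0] at hr
      exact neg_eq_zero.1 (by rw [neg_sub]; exact hr.symm)
    rw [normA, h1]
    simp [normA]
  · refine Real.sqrt_le_sqrt ?_
    set x := pcg A C b k with hx
    set e := x - pinv A *ᵥ b with he
    have h1 : A *ᵥ e = - (pcgState A C b k).r := by
      rw [he, Matrix.mulVec_sub, hAb, hr, neg_sub]; rfl
    -- Pythagoras in the `A`-inner product: `y - x` lies in the Krylov space, to which `A e = -r` is
    -- orthogonal.
    have h2 : y - pinv A *ᵥ b = (y - x) + e := by rw [he]; abel
    have h3 : (y - x) ⬝ᵥ (A *ᵥ e) = 0 := by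
      have h4 : (pcgState A C b k).r ⬝ᵥ (y - x) = 0 := hI.r_perp _ (sub_mem hy hI.x_mem)
      rw [h1, dotProduct_neg, dotProduct_comm, h4, neg_zero]
    rw [h2, Matrix.mulVec_add, add_dotProduct, dotProduct_add, dotProduct_add, h3,
      dotProduct_mulVec_comm h.symA e (y - x), h3]
    have := h.nonnegA (y - x)
    linarith

end Optimality

/-! ### The spectrum of the preconditioned matrix -/

section Spectrum

variable {V : Type*} [Fintype V] [DecidableEq V]

theorem aeval_mul_of_intertwine {M B H : Matrix V V ℝ} (h : M * B = B * H) (p : Polynomial ℝ) :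
    Polynomial.aeval M p * B = B * Polynomial.aeval H p := by
  induction p using Polynomial.induction_on' with
  | add p q hp hq => rw [map_add, map_add, Matrix.add_mul, Matrix.mul_add, hp, hq]
  | monomial n a =>
    have hn : M ^ n * B = B * H ^ n := by
      induction n with
      | zero => simp
      | succ n ih => rw [pow_succ, Matrix.mul_assoc, h, ← Matrix.mul_assoc, ih, Matrix.mul_assoc,
          ← pow_succ]
    rw [Polynomial.aeval_monomial, Polynomial.aeval_monomial, Algebra.algebraMap_eq_smul_one,
      smul_mul_assoc, one_mul, smul_mul_assoc, hn, smul_mul_assoc, one_mul, Matrix.mul_smul]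

theorem aeval_diagonal (d : V → ℝ) (p : Polynomial ℝ) :
    Polynomial.aeval (Matrix.diagonal d) p = Matrix.diagonal fun i => p.eval (d i) := by
  induction p using Polynomial.induction_on' with
  | add p q hp hq => simp [hp, hq]
  | monomial n a =>
    rw [Polynomial.aeval_monomial, Algebra.algebraMap_eq_smul_one, smul_mul_assoc, one_mul,
      Matrix.diagonal_pow, ← Matrix.diagonal_smul]
    congr 1
    ext i
    simp

open scoped MatrixOrder Matrix.Norms.L2Operator in
/-- A positive semidefinite and a symmetric matrix are diagonalized by one congruence. -/
theorem exists_congruence {P A : Matrix V V ℝ} (hP : P.PosSemidef) (hA : Aᵀ = A) :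
    ∃ (W : Matrix V V ℝ) (d : V → ℝ), W * Wᵀ = P ∧ Wᵀ * A * W = Matrix.diagonal d := by
  obtain ⟨B, hB⟩ : ∃ B : Matrix V V ℝ, P = Bᵀ * B := by
    obtain ⟨B, hB⟩ := (Matrix.nonneg_iff_posSemidef (A := P)).2 hP |> CStarAlgebra.nonneg_iff_eq_star_mul_self.1
    exact ⟨B, by rw [hB, Matrix.star_eq_conjTranspose,
      Matrix.conjTranspose_eq_transpose_of_trivial]⟩
  -- With `P = Bᵀ B` and an orthonormal eigenbasis `U` of `B A Bᵀ`, the congruence is `W = Bᵀ U`.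
  have hH : (B * A * Bᵀ).IsHermitian := by
    rw [Matrix.IsHermitian, Matrix.conjTranspose_eq_transpose_of_trivial]
    simp [Matrix.transpose_mul, hA, Matrix.mul_assoc]
  obtain ⟨U, d, hU, hU', hAU⟩ : ∃ (U : Matrix V V ℝ) (d : V → ℝ), Uᵀ * U = 1 ∧ U * Uᵀ = 1 ∧
      B * A * Bᵀ = U * Matrix.diagonal d * Uᵀ := by
    refine ⟨hH.eigenvectorUnitary, hH.eigenvalues, ?_, ?_, ?_⟩
    · have := Unitary.coe_star_mul_self hH.eigenvectorUnitary
      simpa [Matrix.star_eq_conjTranspose, Matrix.conjTranspose_eq_transpose_of_trivial] using this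
    · have := Unitary.coe_mul_star_self hH.eigenvectorUnitary
      simpa [Matrix.star_eq_conjTranspose, Matrix.conjTranspose_eq_transpose_of_trivial] using this
    · have := hH.spectral_theorem
      simpa [Unitary.conjStarAlgAut_apply, Matrix.star_eq_conjTranspose,
        Matrix.conjTranspose_eq_transpose_of_trivial, Function.comp_def] using this
  refine ⟨Bᵀ * U, d, ?_, ?_⟩
  · rw [Matrix.transpose_mul, Matrix.transpose_transpose, Matrix.mul_assoc, ← Matrix.mul_assoc U,
      hU', Matrix.one_mul, hB]
  · calc (Bᵀ * U)ᵀ * A * (Bᵀ * U) = Uᵀ * (B * A * Bᵀ) * U := by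
          simp [Matrix.transpose_mul, Matrix.mul_assoc]
      _ = (Uᵀ * U) * Matrix.diagonal d * (Uᵀ * U) := by rw [hAU]; simp only [Matrix.mul_assoc]
      _ = Matrix.diagonal d := by rw [hU, Matrix.one_mul, Matrix.mul_one]

/-- The eigenvalues `d` of the preconditioned matrix: the nonzero ones are at least `1`, their sum
is the trace, and they control polynomials in the preconditioned matrix. -/
theorem Precond.exists_spectrum {A C : Matrix V V ℝ} (h : Precond A C) :
    ∃ d : V → ℝ, (∀ i, 0 ≤ d i) ∧ (∀ i, d i ≠ 0 → 1 ≤ d i) ∧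
      ∑ i, d i = (pinv C * A).trace ∧
      ∀ (p : Polynomial ℝ) (δ : ℝ), 0 ≤ δ → (∀ i, d i ≠ 0 → |p.eval (d i)| ≤ δ) →
        ∀ x, normA A (Polynomial.aeval (pinv C * A) p *ᵥ (pinv C *ᵥ x)) ≤
          δ * normA A (pinv C *ᵥ x) := by
  have symP := pinv_transpose h.symC
  obtain ⟨W, d, hW, hd⟩ := exists_congruence
    (posSemidef_of_dotProduct symP (pinv_nonneg h.symC h.nonneg)) h.symA
  -- `W Wᵀ = C⁺` turns the congruence into an eigenvector relation: each column of `W` satisfies `M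
  -- w = d w`. The matrix `M` is not symmetric, hence the detour through `W`.
  have hMW : pinv C * A * W = W * Matrix.diagonal d := by
    rw [← hd, ← hW]; simp only [Matrix.mul_assoc]
  have quad : ∀ x y : V → ℝ, (W *ᵥ x) ⬝ᵥ (A *ᵥ (W *ᵥ y)) = ∑ i, d i * (x i * y i) := by
    intro x y
    have : (W *ᵥ x) ⬝ᵥ (A *ᵥ (W *ᵥ y)) = x ⬝ᵥ (Matrix.diagonal d *ᵥ y) := by
      rw [← hd, ← Matrix.mulVec_mulVec, ← Matrix.mulVec_mulVec, dotProduct_comm (W *ᵥ x),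
        Matrix.dotProduct_mulVec, ← Matrix.mulVec_transpose, dotProduct_comm]
    rw [this, dotProduct]
    refine Finset.sum_congr rfl fun i _ => ?_
    rw [Matrix.mulVec_diagonal]; ring
  have hdi : ∀ i, (W *ᵥ Pi.single i 1) ⬝ᵥ (A *ᵥ (W *ᵥ Pi.single i 1)) = d i := by
    intro i
    rw [quad]
    simp [Pi.single_apply]
  refine ⟨d, fun i => by rw [← hdi]; exact h.nonnegA _, fun i hi => ?_, ?_, ?_⟩
  -- For column `w`, `A w = d C w` and `wᵀ A w = d`. When `d ≠ 0` this gives `wᵀ C w = 1`, and `C ≤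
  -- A` yields `1 ≤ d`.
  · set w := W *ᵥ Pi.single i (1 : ℝ) with hw
    have h1 : (pinv C * A) *ᵥ w = d i • w := by
      rw [hw, Matrix.mulVec_mulVec, hMW, ← Matrix.mulVec_mulVec, ← Matrix.mulVec_smul]
      congr 1
      ext j
      rw [Matrix.mulVec_diagonal]
      by_cases hj : j = i
      · subst hj; simp
      · simp [hj]
    have h2 : A *ᵥ w = d i • (C *ᵥ w) := by
      rw [← Matrix.mulVec_smul, ← h1, Matrix.mulVec_mulVec w, ← Matrix.mul_assoc, h.mul_pinv_mul']
    have h3 : d i * (w ⬝ᵥ (C *ᵥ w)) = d i := by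
      rw [← smul_eq_mul, ← dotProduct_smul, ← h2, hdi]
    have h4 : w ⬝ᵥ (C *ᵥ w) = 1 := mul_left_cancel₀ hi (by rw [h3, mul_one])
    rw [← h4, ← hdi]
    exact h.le w
  · have : (Matrix.diagonal d).trace = (pinv C * A).trace := by
      rw [← hd, Matrix.mul_assoc, Matrix.trace_mul_comm, Matrix.mul_assoc, hW,
        Matrix.trace_mul_comm]
    rw [← this, Matrix.trace_diagonal]
  · intro p δ hδ hp x
    set y := Wᵀ *ᵥ x with hy
    have h1 : pinv C *ᵥ x = W *ᵥ y := by rw [hy, Matrix.mulVec_mulVec, hW]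
    have h2 : Polynomial.aeval (pinv C * A) p *ᵥ (W *ᵥ y) = W *ᵥ fun i => p.eval (d i) * y i := by
      rw [Matrix.mulVec_mulVec, aeval_mul_of_intertwine hMW, aeval_diagonal,
        ← Matrix.mulVec_mulVec]
      congr 1
      ext i
      rw [Matrix.mulVec_diagonal]
    rw [h1, h2, normA, normA, quad, quad, Real.sqrt_le_left (by positivity), mul_pow,
      Real.sq_sqrt, Finset.mul_sum]
    · refine Finset.sum_le_sum fun i _ => ?_
      by_cases hi : d i = 0
      · simp [hi]
      · have h3 := sq_le_sq' (neg_le_of_abs_le (hp i hi)) (le_of_abs_le (hp i hi))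
        have h4 : 0 ≤ d i * (y i * y i) :=
          mul_nonneg (by rw [← hdi]; exact h.nonnegA _) (mul_self_nonneg _)
        calc d i * (Polynomial.eval (d i) p * y i * (Polynomial.eval (d i) p * y i))
            = Polynomial.eval (d i) p ^ 2 * (d i * (y i * y i)) := by ring
          _ ≤ _ := mul_le_mul_of_nonneg_right h3 h4
    · exact Finset.sum_nonneg fun i _ =>
        mul_nonneg (by rw [← hdi]; exact h.nonnegA _) (mul_self_nonneg _)

end Spectrum

/-! ### A small polynomial -/

/-- A polynomial that is `1` at `0` and small on `[1, σ²]`. -/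
theorem exists_chebyshev {σ : ℝ} (hσ : 1 < σ) (d : ℕ) :
    ∃ p : Polynomial ℝ, p.natDegree ≤ d ∧ p.eval 0 = 1 ∧
      ∀ x, 1 ≤ x → x ≤ σ ^ 2 → |p.eval x| ≤ 2 * Real.exp (-(d / σ)) := by
  have hσ0 : 0 < σ := by linarith
  have hσ1 : 0 < σ - 1 := by linarith
  have ht : 0 < σ ^ 2 - 1 := by nlinarith
  -- The affine map used below takes `[1, σ²]` onto `[-1, 1]` and 0 to `(σ² + 1) / (σ² - 1)`. This
  -- value is `cosh θ`, where the Chebyshev polynomial equals `cosh (d θ)`.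
  set θ := Real.log ((σ + 1) / (σ - 1)) with hθ
  have hq : 0 < (σ + 1) / (σ - 1) := by positivity
  have hcosh : Real.cosh θ = (σ ^ 2 + 1) / (σ ^ 2 - 1) := by
    have : σ ^ 2 - 1 = (σ - 1) * (σ + 1) := by ring
    rw [Real.cosh_eq, Real.exp_neg, hθ, Real.exp_log hq, inv_div, this]
    field_simp
    ring
  -- `exp (1/σ) ≤ (1 - 1/σ)⁻¹ = σ / (σ - 1)`, which is below `(σ + 1) / (σ - 1)`.
  have hθ1 : 1 / σ ≤ θ := by
    rw [hθ, Real.le_log_iff_exp_le hq]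
    have h1 : 1 - 1 / σ ≤ Real.exp (-(1 / σ)) := by
      have := Real.add_one_le_exp (-(1 / σ)); linarith
    have h2 : 0 < 1 - 1 / σ := by rw [sub_pos, div_lt_one hσ0]; exact hσ
    rw [Real.exp_neg] at h1
    have h3 : Real.exp (1 / σ) ≤ (1 - 1 / σ)⁻¹ := by
      rw [le_inv_comm₀ (Real.exp_pos _) h2]; exact h1
    refine h3.trans ?_
    rw [inv_le_iff_one_le_mul₀ h2]
    have : (σ + 1) / (σ - 1) * (1 - 1 / σ) = (σ + 1) / σ := by field_simp
    rw [this, one_le_div hσ0]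
    linarith
  have hT : Real.exp (d / σ) / 2 ≤
      (Polynomial.Chebyshev.T ℝ d).eval ((σ ^ 2 + 1) / (σ ^ 2 - 1)) := by
    rw [← hcosh, Polynomial.Chebyshev.T_real_cosh, Real.cosh_eq]
    have h1 : Real.exp (d / σ) ≤ Real.exp (((d : ℤ) : ℝ) * θ) := by
      rw [Real.exp_le_exp]
      push_cast
      calc (d : ℝ) / σ = d * (1 / σ) := by ring
        _ ≤ d * θ := by gcongr
    have h2 := Real.exp_pos (-(((d : ℤ) : ℝ) * θ))
    linarith
  set m := (Polynomial.Chebyshev.T ℝ d).eval ((σ ^ 2 + 1) / (σ ^ 2 - 1)) with hm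
  have hm0 : 0 < m := lt_of_lt_of_le (by positivity) hT
  refine ⟨Polynomial.C m⁻¹ * (Polynomial.Chebyshev.T ℝ d).comp
    (Polynomial.C ((σ ^ 2 + 1) / (σ ^ 2 - 1)) - Polynomial.C (2 / (σ ^ 2 - 1)) * Polynomial.X),
    ?_, ?_, ?_⟩
  · refine (Polynomial.natDegree_C_mul_le _ _).trans (Polynomial.natDegree_comp_le.trans ?_)
    rw [Polynomial.Chebyshev.natDegree_T, Int.natAbs_natCast]
    have : (Polynomial.C ((σ ^ 2 + 1) / (σ ^ 2 - 1)) -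
        Polynomial.C (2 / (σ ^ 2 - 1)) * Polynomial.X).natDegree ≤ 1 := by
      refine (Polynomial.natDegree_sub_le _ _).trans (max_le ?_ ?_)
      · simp
      · exact (Polynomial.natDegree_C_mul_le _ _).trans Polynomial.natDegree_X_le
    exact (Nat.mul_le_mul_left d this).trans (by simp)
  · simp only [Polynomial.eval_mul, Polynomial.eval_C, Polynomial.eval_comp, Polynomial.eval_sub,
      Polynomial.eval_X, mul_zero, sub_zero, ← hm]
    exact inv_mul_cancel₀ hm0.ne'
  · intro x h1 h2
    simp only [Polynomial.eval_mul, Polynomial.eval_C, Polynomial.eval_comp, Polynomial.eval_sub,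
      Polynomial.eval_X]
    rw [abs_mul, abs_inv, abs_of_pos hm0]
    have h3 : |(Polynomial.Chebyshev.T ℝ d).eval
        ((σ ^ 2 + 1) / (σ ^ 2 - 1) - 2 / (σ ^ 2 - 1) * x)| ≤ 1 := by
      refine Polynomial.Chebyshev.abs_eval_T_real_le_one d (abs_le.2 ⟨?_, ?_⟩)
      · rw [div_mul_eq_mul_div, ← sub_div, le_div_iff₀ ht]; nlinarith
      · rw [div_mul_eq_mul_div, ← sub_div, div_le_iff₀ ht]; nlinarith
    calc m⁻¹ * _ ≤ m⁻¹ * 1 := by gcongr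
      _ ≤ (Real.exp (d / σ) / 2)⁻¹ := by rw [mul_one]; gcongr
      _ = _ := by rw [inv_div, Real.exp_neg]; rfl

/-- If the sum of the numbers `dᵢ ≥ 0` is at most `ρ ^ 3`, then some polynomial of degree
`k` is `1` at `0` and small at all `dᵢ ≥ 1`. -/
theorem exists_small_polynomial {ι : Type*} [Fintype ι] {d : ι → ℝ} {ρ : ℝ} (hρ : 0 < ρ)
    (hd : ∀ i, 0 ≤ d i) (hsum : ∑ i, d i ≤ ρ ^ 3) {k : ℕ} (hk : ρ ≤ k) :
    ∃ p : Polynomial ℝ, p.natDegree ≤ k ∧ p.eval 0 = 1 ∧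
      ∀ i, 1 ≤ d i → |p.eval (d i)| ≤ 2 * Real.exp (-((k - ρ) / (ρ + 1))) := by
  classical
  -- More than `ρ` values above `(ρ + 1) ^ 2` would have a sum exceeding `ρ ^ 3`.
  set S := Finset.univ.filter fun i => (ρ + 1) ^ 2 < d i with hS
  have hcard : (S.card : ℝ) ≤ ρ := by
    have h1 : S.card • (ρ + 1) ^ 2 ≤ ∑ i ∈ S, d i :=
      Finset.card_nsmul_le_sum _ _ _ fun i hi => (Finset.mem_filter.1 hi).2.le
    have h2 : ∑ i ∈ S, d i ≤ ∑ i, d i :=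
      Finset.sum_le_univ_sum_of_nonneg hd
    rw [nsmul_eq_mul] at h1
    by_contra hlt
    have h3 : ρ * (ρ + 1) ^ 2 < S.card * (ρ + 1) ^ 2 :=
      mul_lt_mul_of_pos_right (not_le.1 hlt) (by positivity)
    nlinarith [sq_nonneg ρ]
  have hcard' : S.card ≤ k := by exact_mod_cast hcard.trans hk
  obtain ⟨T, hTdeg, hT0, hT⟩ := exists_chebyshev (σ := ρ + 1) (by linarith) (k - S.card)
  -- One factor vanishes at each large value. At the remaining values every factor lies in `[0, 1]`,
  -- so the product does not spoil the Chebyshev bound.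
  refine ⟨(∏ i ∈ S, (1 - Polynomial.C (d i)⁻¹ * Polynomial.X)) * T, ?_, ?_, ?_⟩
  · refine Polynomial.natDegree_mul_le.trans ?_
    have : (∏ i ∈ S, (1 - Polynomial.C (d i)⁻¹ * Polynomial.X)).natDegree ≤ S.card := by
      refine (Polynomial.natDegree_prod_le _ _).trans
        ((Finset.sum_le_card_nsmul _ _ 1 fun i _ => ?_).trans (by simp))
      refine (Polynomial.natDegree_sub_le _ _).trans (max_le ?_ ?_)
      · simp
      · exact (Polynomial.natDegree_C_mul_le _ _).trans Polynomial.natDegree_X_le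
    omega
  · simp [Polynomial.eval_prod, hT0]
  · intro i hi
    rw [Polynomial.eval_mul, Polynomial.eval_prod, abs_mul, Finset.abs_prod]
    by_cases hiS : i ∈ S
    · have h0 : d i ≠ 0 := by linarith
      rw [Finset.prod_eq_zero hiS (by simp [h0]), zero_mul]
      positivity
    · have h1 : d i ≤ (ρ + 1) ^ 2 := by simpa [hS] using hiS
      have h2 : ∏ j ∈ S, |(1 - Polynomial.C (d j)⁻¹ * Polynomial.X : Polynomial ℝ).eval (d i)| ≤ 1 := by
        refine Finset.prod_le_one (fun _ _ => abs_nonneg _) fun j hj => ?_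
        have h3 : (ρ + 1) ^ 2 < d j := (Finset.mem_filter.1 hj).2
        have h4 : 0 < d j := lt_of_le_of_lt (by positivity) h3
        have h5 : (d j)⁻¹ * d i ≤ 1 := by
          rw [inv_mul_le_iff₀ h4]; linarith
        have h6 : 0 ≤ (d j)⁻¹ * d i := mul_nonneg (inv_nonneg.2 h4.le) (hd i)
        simp only [Polynomial.eval_sub, Polynomial.eval_one, Polynomial.eval_mul,
          Polynomial.eval_C, Polynomial.eval_X]
        rw [abs_le]
        constructor <;> linarith
      refine (mul_le_mul h2 (hT _ hi h1) (abs_nonneg _) zero_le_one).trans ?_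
      rw [one_mul, Nat.cast_sub hcard']
      gcongr

/-- The convergence bound of the preconditioned conjugate gradient method. -/
theorem Precond.normA_pcg_sub_le {V : Type*} [Fintype V] {A C : Matrix V V ℝ}
    (h : Precond A C) {b : V → ℝ} (hb : ∃ y, A *ᵥ y = b) {ρ : ℝ} (hρ : 0 < ρ)
    (htr : (pinv C * A).trace ≤ ρ ^ 3) {k : ℕ} (hk : ρ ≤ k) :
    normA A (pcg A C b k - pinv A *ᵥ b) ≤
      2 * Real.exp (-((k - ρ) / (ρ + 1))) * normA A (pinv A *ᵥ b) := by
  classical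
  obtain ⟨d, hd, hd1, hsum, hpoly⟩ := h.exists_spectrum
  obtain ⟨p, hdeg, hp0, hp⟩ := exists_small_polynomial hρ hd (hsum.trans_le htr) hk
  -- The spectral estimate covers only vectors in the range of `C⁺`; the solution is one because `A`
  -- and `C` have the same kernel and hence the same range.
  obtain ⟨u, hu⟩ : ∃ u, pinv C *ᵥ u = pinv A *ᵥ b := by
    obtain ⟨y, rfl⟩ := hb
    refine ⟨C *ᵥ (pinv A *ᵥ (A *ᵥ y)), ?_⟩
    simp only [Matrix.mulVec_mulVec]
    rw [pinv_mul_comm h.symA, ← Matrix.mul_assoc, ← Matrix.mul_assoc, pinv_mul_comm h.symC,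
      h.mul_pinv_mul']
  have hfac : p = 1 - p.divX * (-Polynomial.X) := by
    conv_lhs => rw [← p.divX_mul_X_add, Polynomial.coeff_zero_eq_eval_zero, hp0]
    simp
    ring
  have hAb := mulVec_pinv_mulVec h.symA hb
  -- Since `p(0) = 1`, `p = 1 + X divX p`; with `C⁺ b = M A⁺ b`, the Krylov vector `-(divX p)(M) C⁺
  -- b` has error `-p(M) A⁺ b`.
  have key : Polynomial.aeval (pinv C * A) (-p.divX) *ᵥ (pinv C *ᵥ b) - pinv A *ᵥ b =
      - (Polynomial.aeval (pinv C * A) p *ᵥ (pinv A *ᵥ b)) := by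
    conv_rhs => rw [hfac]
    conv_lhs => rw [← hAb]
    have hXAX := (pinv_spec h.symA).mul_mul'
    simp only [map_sub, map_neg, map_mul, map_one, Polynomial.aeval_X, Matrix.mulVec_mulVec,
      ← Matrix.neg_mulVec, ← Matrix.sub_mulVec]
    congr 1
    rw [← Matrix.mul_assoc (pinv A), hXAX, mul_neg, sub_neg_eq_add, Matrix.add_mul, Matrix.one_mul,
      Matrix.neg_mul, Matrix.mul_assoc, Matrix.mul_assoc]
    abel
  have hmem : Polynomial.aeval (pinv C * A) (-p.divX) *ᵥ (pinv C *ᵥ b) ∈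
      krylov (pinv C * A) (pinv C *ᵥ b) k := by
    refine aeval_mulVec_mem_krylov k _ ?_
    rw [Polynomial.degree_neg]
    by_cases h0 : p.divX = 0
    · rw [h0, Polynomial.degree_zero]; exact WithBot.bot_lt_coe k
    · have h3 : p.natDegree ≠ 0 := fun h3 => h0 (Polynomial.divX_eq_zero_iff.2
        (Polynomial.eq_C_of_natDegree_eq_zero h3))
      rw [← Polynomial.natDegree_lt_iff_degree_lt h0,
        Polynomial.natDegree_divX_eq_natDegree_tsub_one]
      omega
  refine (h.pcg_optimal hb k hmem).trans ?_
  rw [key]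
  have hneg : ∀ x : V → ℝ, normA A (-x) = normA A x := by
    intro x; simp [normA, Matrix.mulVec_neg]
  rw [hneg, ← hu]
  exact hpoly p _ (by positivity) (fun i hi => hp i (hd1 i hi)) u

/-! ### Laplacians -/

section Laplacian

variable {V : Type*} [Fintype V] [DecidableEq V]

theorem edgeLap_mulVec (u v : V) (x : V → ℝ) :
    edgeLap s(u, v) *ᵥ x = (x u - x v) • ((Pi.single u 1 : V → ℝ) - Pi.single v 1) := by
  have : edgeLap s(u, v) = Matrix.vecMulVec
      ((Pi.single u 1 : V → ℝ) - Pi.single v 1) ((Pi.single u 1 : V → ℝ) - Pi.single v 1) := rfl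
  rw [this, Matrix.vecMulVec_mulVec, sub_dotProduct, single_one_dotProduct, single_one_dotProduct]
  ext i
  simp [mul_comm]

theorem dotProduct_edgeLap_mulVec (u v : V) (x y : V → ℝ) :
    x ⬝ᵥ (edgeLap s(u, v) *ᵥ y) = (y u - y v) * (x u - x v) := by
  rw [edgeLap_mulVec, dotProduct_smul, dotProduct_sub, dotProduct_single_one,
    dotProduct_single_one, smul_eq_mul]

theorem dotProduct_edgeLap_nonneg (e : Sym2 V) (x : V → ℝ) : 0 ≤ x ⬝ᵥ (edgeLap e *ᵥ x) := by
  induction e with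
  | _ u v => rw [dotProduct_edgeLap_mulVec]; exact mul_self_nonneg _

open Classical in
theorem lap_mulVec (G : SimpleGraph V) (w : Sym2 V → ℝ) (x : V → ℝ) :
    lap G w *ᵥ x = ∑ e : Sym2 V with e ∈ G.edgeSet, w e • (edgeLap e *ᵥ x) := by
  simp only [lap, Matrix.sum_mulVec, Matrix.smul_mulVec]

open Classical in
theorem dotProduct_lap_mulVec (G : SimpleGraph V) (w : Sym2 V → ℝ) (x y : V → ℝ) :
    x ⬝ᵥ (lap G w *ᵥ y) = ∑ e : Sym2 V with e ∈ G.edgeSet, w e * (x ⬝ᵥ (edgeLap e *ᵥ y)) := by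
  simp only [lap_mulVec, dotProduct_sum, dotProduct_smul, smul_eq_mul]

theorem lap_mulVec_eq_zero_of_const (G : SimpleGraph V) (w : Sym2 V → ℝ) {x : V → ℝ}
    (hx : ∀ i j, x i = x j) : lap G w *ᵥ x = 0 := by
  rw [lap_mulVec]
  refine Finset.sum_eq_zero fun e _ => ?_
  induction e with
  | _ u v => rw [edgeLap_mulVec, hx u v, sub_self, zero_smul, smul_zero]

variable {G T : SimpleGraph V} {w : Sym2 V → ℝ}

theorem dotProduct_lap_nonneg (hw : ∀ e ∈ G.edgeSet, 0 < w e) (x : V → ℝ) :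
    0 ≤ x ⬝ᵥ (lap G w *ᵥ x) := by
  rw [dotProduct_lap_mulVec]
  exact Finset.sum_nonneg fun e he => mul_nonneg (hw e (by simpa using he)).le
    (dotProduct_edgeLap_nonneg e x)

/-- The kernel of the Laplacian of a connected graph consists of the constant vectors. -/
theorem const_of_lap_mulVec_eq_zero (hT : T.Connected) (hw : ∀ e ∈ T.edgeSet, 0 < w e)
    {x : V → ℝ} (hx : lap T w *ᵥ x = 0) (i j : V) : x i = x j := by
  classical
  have h0 : x ⬝ᵥ (lap T w *ᵥ x) = 0 := by rw [hx, dotProduct_zero]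
  rw [dotProduct_lap_mulVec, Finset.sum_eq_zero_iff_of_nonneg fun e he => mul_nonneg
    (hw e (by simpa using he)).le (dotProduct_edgeLap_nonneg e x)] at h0
  have hadj : ∀ u v, T.Adj u v → x u = x v := by
    intro u v huv
    have h1 := h0 s(u, v) (by simpa using huv)
    rw [dotProduct_edgeLap_mulVec] at h1
    have h2 := (mul_eq_zero.1 h1).resolve_left (hw s(u, v) (by simpa using huv)).ne'
    linarith [mul_self_eq_zero.1 h2]
  obtain ⟨p⟩ := hT.preconnected i j
  induction p with
  | nil => rfl
  | cons h _ ih => exact (hadj _ _ h).trans ih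

/-- Passing to a subgraph drops nonnegative terms from the quadratic form, and connectedness of `T`
makes its kernel consist of constants. -/
theorem precond_lap (hle : T ≤ G) (hT : T.Connected) (hw : ∀ e ∈ G.edgeSet, 0 < w e) :
    Precond (lap G w) (lap T w) where
  symA := lap_transpose G w
  symC := lap_transpose T w
  nonneg := dotProduct_lap_nonneg fun e he => hw e (SimpleGraph.edgeSet_mono hle he)
  le x := by
    classical
    rw [dotProduct_lap_mulVec, dotProduct_lap_mulVec]
    refine Finset.sum_le_sum_of_subset_of_nonneg ?_ fun e he _ => ?_
    · intro e he
      simp only [Finset.mem_filter, Finset.mem_univ, true_and] at he ⊢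
      exact SimpleGraph.edgeSet_mono hle he
    · exact mul_nonneg (hw e (by simpa using he)).le (dotProduct_edgeLap_nonneg e x)
  ker x hx := lap_mulVec_eq_zero_of_const G w
    (const_of_lap_mulVec_eq_zero hT (fun e he => hw e (SimpleGraph.edgeSet_mono hle he)) hx)

theorem sum_lap_mulVec (x : V → ℝ) : ∑ i, (lap G w *ᵥ x) i = 0 := by
  have h1 : ∑ i, (lap G w *ᵥ x) i = (fun _ => 1) ⬝ᵥ (lap G w *ᵥ x) := by simp [dotProduct]
  rw [h1, dotProduct_mulVec_comm (lap_transpose G w),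
    lap_mulVec_eq_zero_of_const G w fun _ _ => rfl, dotProduct_zero]

/-- For a connected graph, `L⁺ L` subtracts the mean. -/
theorem pinv_lap_mulVec_lap_mulVec (hT : T.Connected) (hw : ∀ e ∈ T.edgeSet, 0 < w e)
    (x : V → ℝ) : pinv (lap T w) *ᵥ (lap T w *ᵥ x) =
      fun i => x i - (∑ j, x j) / Fintype.card V := by
  have sym := lap_transpose T w
  -- `u` is in the kernel, hence constant, and has the same sum as `x`, hence equals the mean.
  set u := x - pinv (lap T w) *ᵥ (lap T w *ᵥ x) with hu
  have h1 : lap T w *ᵥ u = 0 := by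
    rw [hu, Matrix.mulVec_sub, mulVec_pinv_mulVec sym ⟨x, rfl⟩, sub_self]
  have hc := const_of_lap_mulVec_eq_zero hT hw h1
  have hs : ∑ j, x j = ∑ j, u j := by
    rw [hu, Matrix.mulVec_mulVec, pinv_mul_comm sym, ← Matrix.mulVec_mulVec]
    simp only [Pi.sub_apply, Finset.sum_sub_distrib, sum_lap_mulVec, sub_zero]
  ext i
  have : Nonempty V := ⟨i⟩
  have h3 : ∑ j, u j = Fintype.card V * u i := by
    rw [Finset.sum_congr rfl fun j _ => hc j i]; simp
  have h4 : (pinv (lap T w) *ᵥ (lap T w *ᵥ x)) i = x i - u i := by rw [hu]; simp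
  rw [h4, hs, h3, mul_div_cancel_left₀]
  exact Nat.cast_ne_zero.2 Fintype.card_ne_zero

theorem lap_mulVec_pinv_mulVec (hT : T.Connected) (hw : ∀ e ∈ T.edgeSet, 0 < w e)
    {x : V → ℝ} (hx : ∑ i, x i = 0) : lap T w *ᵥ (pinv (lap T w) *ᵥ x) = x := by
  rw [Matrix.mulVec_mulVec, ← pinv_mul_comm (lap_transpose T w), ← Matrix.mulVec_mulVec,
    pinv_lap_mulVec_lap_mulVec hT hw]
  simp [hx]

/-! ### The stretch bounds the trace -/

/-- The root of the quadratic form of an edge is the absolute difference of `x` across it; these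
differences telescope along the walk. -/
theorem abs_sub_le_sum_edges {u v : V} (p : T.Walk u v) (x : V → ℝ) :
    |x u - x v| ≤ (p.edges.map fun e => Real.sqrt (x ⬝ᵥ (edgeLap e *ᵥ x))).sum := by
  induction p with
  | nil => simp
  | @cons a b c h p ih =>
    rw [SimpleGraph.Walk.edges_cons, List.map_cons, List.sum_cons, dotProduct_edgeLap_mulVec,
      Real.sqrt_mul_self_eq_abs]
    calc |x a - x c| = |(x a - x b) + (x b - x c)| := by ring_nf
      _ ≤ _ := (abs_add_le _ _).trans (by gcongr)

-- Cauchy–Schwarz along the tree path, splitting each difference as `(1 / √w) * (√w |x a - x b|)`.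
-- This bounds the effective resistance by the path sum of `1 / w`.
open Classical in
theorem sq_sub_le (hw : ∀ e ∈ T.edgeSet, 0 < w e) {u v : V} (p : T.Walk u v) (hp : p.IsPath)
    (x : V → ℝ) : (x u - x v) ^ 2 ≤
      (∑ f : Sym2 V with OnPath T s(u, v) f, 1 / w f) * (x ⬝ᵥ (lap T w *ᵥ x)) := by
  have hpw : ∀ e ∈ p.edges.toFinset, 0 < w e := fun e he =>
    hw e (p.edges_subset_edgeSet (List.mem_toFinset.1 he))
  have h1 : |x u - x v| ≤ ∑ e ∈ p.edges.toFinset, Real.sqrt (x ⬝ᵥ (edgeLap e *ᵥ x)) := by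
    rw [List.sum_toFinset _ hp.isTrail.edges_nodup]
    exact abs_sub_le_sum_edges p x
  have h2 : (∑ e ∈ p.edges.toFinset, Real.sqrt (x ⬝ᵥ (edgeLap e *ᵥ x))) ^ 2 ≤
      (∑ e ∈ p.edges.toFinset, 1 / w e) *
        ∑ e ∈ p.edges.toFinset, w e * (x ⬝ᵥ (edgeLap e *ᵥ x)) := by
    refine Finset.sum_sq_le_sum_mul_sum_of_sq_le_mul _ (fun e he => ?_) (fun e he => ?_)
      fun e he => ?_
    · exact (one_div_pos.2 (hpw e he)).le
    · exact mul_nonneg (hpw e he).le (dotProduct_edgeLap_nonneg e x)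
    · refine le_of_eq ?_
      rw [Real.sq_sqrt (dotProduct_edgeLap_nonneg e x), ← mul_assoc,
        one_div_mul_cancel (hpw e he).ne', one_mul]
  have h3 : ∑ e ∈ p.edges.toFinset, 1 / w e ≤ ∑ f : Sym2 V with OnPath T s(u, v) f, 1 / w f := by
    refine Finset.sum_le_sum_of_subset_of_nonneg (fun e he => ?_) fun f hf _ => ?_
    · simp only [Finset.mem_filter, Finset.mem_univ, true_and]
      exact ⟨u, v, p, rfl, hp, List.mem_toFinset.1 he⟩
    · simp only [Finset.mem_filter, Finset.mem_univ, true_and] at hf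
      obtain ⟨a, b, q, -, -, hfq⟩ := hf
      exact (one_div_pos.2 (hw f (q.edges_subset_edgeSet hfq))).le
  have h4 : ∑ e ∈ p.edges.toFinset, w e * (x ⬝ᵥ (edgeLap e *ᵥ x)) ≤ x ⬝ᵥ (lap T w *ᵥ x) := by
    rw [dotProduct_lap_mulVec]
    refine Finset.sum_le_sum_of_subset_of_nonneg (fun e he => ?_) fun e he _ => ?_
    · simpa using p.edges_subset_edgeSet (List.mem_toFinset.1 he)
    · exact mul_nonneg (hw e (by simpa using he)).le (dotProduct_edgeLap_nonneg e x)
  rw [← sq_abs]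
  calc |x u - x v| ^ 2 ≤ _ := pow_le_pow_left₀ (abs_nonneg _) h1 2
    _ ≤ _ := h2
    _ ≤ _ := mul_le_mul h3 h4
      (Finset.sum_nonneg fun e he => mul_nonneg (hpw e he).le (dotProduct_edgeLap_nonneg e x))
      ((Finset.sum_nonneg fun e he => (one_div_pos.2 (hpw e he)).le).trans h3)

theorem trace_mul_edgeLap (P : Matrix V V ℝ) (u v : V) :
    (P * edgeLap s(u, v)).trace = ((Pi.single u 1 : V → ℝ) - Pi.single v 1) ⬝ᵥ
      (P *ᵥ ((Pi.single u 1 : V → ℝ) - Pi.single v 1)) := by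
  have : edgeLap s(u, v) = Matrix.vecMulVec
      ((Pi.single u 1 : V → ℝ) - Pi.single v 1) ((Pi.single u 1 : V → ℝ) - Pi.single v 1) := rfl
  rw [this, Matrix.mul_vecMulVec, Matrix.trace_vecMulVec, dotProduct_comm]

/-- The trace of `L_T⁺ L_G` is at most the stretch. -/
theorem trace_le_stretch (hle : T ≤ G) (hT : T.Connected) (hw : ∀ e ∈ G.edgeSet, 0 < w e) :
    (pinv (lap T w) * lap G w).trace ≤ stretch G T w := by
  classical
  have hwT : ∀ e ∈ T.edgeSet, 0 < w e := fun e he => hw e (SimpleGraph.edgeSet_mono hle he)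
  have h1 : (pinv (lap T w) * lap G w).trace =
      ∑ e : Sym2 V with e ∈ G.edgeSet, w e * (pinv (lap T w) * edgeLap e).trace := by
    simp only [lap, Matrix.mul_sum, Matrix.trace_sum, Matrix.mul_smul, Matrix.trace_smul,
      smul_eq_mul]
  rw [h1, stretch]
  refine Finset.sum_le_sum fun e he => ?_
  have hwe := hw e (by simpa using he)
  rw [edgeStretch]
  refine mul_le_mul_of_nonneg_left ?_ hwe.le
  clear he hwe
  induction e with
  | _ u v =>
    rw [trace_mul_edgeLap]
    set χ := (Pi.single u 1 : V → ℝ) - Pi.single v 1 with hχ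
    have hχ0 : ∑ i, χ i = 0 := by simp [hχ]
    set y := pinv (lap T w) *ᵥ χ with hy
    have hLy : lap T w *ᵥ y = χ := lap_mulVec_pinv_mulVec hT hwT hχ0
    have hyχ : χ ⬝ᵥ y = y u - y v := by
      rw [hχ, sub_dotProduct, single_one_dotProduct, single_one_dotProduct]
    obtain ⟨p, hp⟩ := (hT.preconnected u v).exists_isPath
    -- With `y = L_T⁺ χ`, both the energy `yᵀ L_T y` and `χᵀ L_T⁺ χ` equal `y u - y v`, so the
    -- squared bound can be divided by this number unless it is 0.
    have h2 := sq_sub_le hwT p hp y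
    rw [hLy, dotProduct_comm, hyχ] at h2
    rw [hyχ]
    have h3 : 0 ≤ y u - y v := by
      rw [← hyχ, ← hLy, dotProduct_comm]
      exact dotProduct_lap_nonneg hwT y
    rcases h3.eq_or_lt with h4 | h4
    · rw [← h4]
      refine Finset.sum_nonneg fun f hf => ?_
      simp only [Finset.mem_filter, Finset.mem_univ, true_and] at hf
      obtain ⟨a, b, q, -, -, hfq⟩ := hf
      exact (one_div_pos.2 (hwT f (q.edges_subset_edgeSet hfq))).le
    · rw [sq] at h2
      exact le_of_mul_le_mul_right h2 h4

end Laplacian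

/-- A single tree edge, being its own tree path, already contributes `w * (1 / w) = 1`. -/
theorem one_le_stretch {V : Type*} [Fintype V] [Nontrivial V] {G T : SimpleGraph V}
    {w : Sym2 V → ℝ} (hle : T ≤ G) (hT : T.Connected)
    (hw : ∀ e ∈ G.edgeSet, 0 < w e) : 1 ≤ stretch G T w := by
  classical
  have hwT : ∀ e ∈ T.edgeSet, 0 < w e := fun e he => hw e (SimpleGraph.edgeSet_mono hle he)
  have hnn : ∀ e, ∀ f ∈ Finset.univ.filter (fun f => OnPath T e f), 0 ≤ 1 / w f := by
    intro e f hf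
    simp only [Finset.mem_filter, Finset.mem_univ, true_and] at hf
    obtain ⟨a, b, q, -, -, hfq⟩ := hf
    exact (one_div_pos.2 (hwT f (q.edges_subset_edgeSet hfq))).le
  obtain ⟨u, v, huv⟩ : ∃ u v, T.Adj u v := by
    obtain ⟨a, b, hab⟩ := exists_pair_ne V
    obtain ⟨p⟩ := hT.preconnected a b
    cases p with
    | nil => exact absurd rfl hab
    | cons h _ => exact ⟨_, _, h⟩
  have hwe := hwT s(u, v) huv
  have h1 : 1 ≤ edgeStretch T w s(u, v) := by
    rw [edgeStretch]
    have h2 : 1 / w s(u, v) ≤ ∑ f : Sym2 V with OnPath T s(u, v) f, 1 / w f := by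
      refine Finset.single_le_sum (f := fun f => 1 / w f) (hnn _) ?_
      simp only [Finset.mem_filter, Finset.mem_univ, true_and]
      exact ⟨u, v, huv.toWalk, rfl, by simpa using huv.ne, by simp⟩
    calc (1 : ℝ) = w s(u, v) * (1 / w s(u, v)) := by rw [mul_one_div_cancel hwe.ne']
      _ ≤ _ := mul_le_mul_of_nonneg_left h2 hwe.le
  refine h1.trans (Finset.single_le_sum (f := fun e => edgeStretch T w e) (fun e he => ?_) ?_)
  · exact mul_nonneg (hw e (by simpa using he)).le (Finset.sum_nonneg (hnn e))
  · simpa using hle huv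

/-! ### The number of iterations -/

namespace System

variable {n : ℕ} (Q : System n)

theorem w_pos_tree (e : Sym2 (Fin n)) (he : e ∈ Q.T.edgeSet) : 0 < Q.w e :=
  Q.w_pos e (SimpleGraph.edgeSet_mono Q.le he)

theorem precond : Precond (lap Q.G Q.w) (lap Q.T Q.w) :=
  precond_lap Q.le Q.isTree.connected Q.w_pos

theorem pos {n : ℕ} (Q : System n) : 0 < n := Fin.pos_iff_nonempty.2 Q.connected.nonempty

theorem one_le_st (hn : 2 ≤ n) : 1 ≤ Q.st := by
  have : Nontrivial (Fin n) := Fin.nontrivial_iff_two_le.2 hn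
  exact one_le_stretch Q.le Q.isTree.connected Q.w_pos

theorem accurate_of_subsingleton (hn : ¬ 2 ≤ n) (ε : ℝ) (x : Fin n → ℝ) : Q.Accurate ε x := by
  have : Subsingleton (Fin n) := Fin.subsingleton_iff_le_one.2 (by omega)
  have h0 : ∀ y, normA (lap Q.G Q.w) y = 0 := fun y => by
    rw [normA, lap_mulVec_eq_zero_of_const _ _ fun i j => congrArg y (Subsingleton.elim i j)]
    simp
  rw [System.Accurate, TreePCG.Accurate, h0, h0, mul_zero]

/-- As `ρ + 1 ≤ 2 ρ`, the hypothesis on `k` makes the exponent at least `1 + ln(1/ε)`. The extra 1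
absorbs the factor 2 of the Chebyshev bound, because `2 / e ≤ 1`. -/
theorem accurate_of_le {ε : ℝ} (hε : 0 < ε) {k : ℕ} {ρ : ℝ} (hρ : 1 ≤ ρ) (hst : Q.st ≤ ρ ^ 3)
    (hk : ρ + 2 * ρ * (1 + Real.log (1 / ε)) ≤ k) (hε1 : ε ≤ 1) : Q.Accurate ε (Q.iterate k) := by
  have hL : 0 ≤ Real.log (1 / ε) := Real.log_nonneg (by rw [le_div_iff₀ hε]; linarith)
  have hρk : ρ ≤ k := le_trans (by nlinarith) hk
  refine (Q.precond.normA_pcg_sub_le Q.b_mem (by linarith)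
    ((trace_le_stretch Q.le Q.isTree.connected Q.w_pos).trans hst) hρk).trans ?_
  refine mul_le_mul_of_nonneg_right ?_ (Real.sqrt_nonneg _)
  have h1 : 1 + Real.log (1 / ε) ≤ (k - ρ) / (ρ + 1) := by
    rw [le_div_iff₀ (by linarith)]
    nlinarith
  have h2 : Real.exp (-((k - ρ) / (ρ + 1))) ≤ Real.exp (-1) * ε := by
    calc _ ≤ Real.exp (-(1 + Real.log (1 / ε))) := Real.exp_le_exp.2 (by linarith)
      _ = Real.exp (-1) * ε := by
        rw [neg_add, Real.exp_add, one_div, Real.log_inv, neg_neg, Real.exp_log hε]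
  have h3 : Real.exp (-1) ≤ 1 / 2 := by
    rw [Real.exp_neg, one_div]
    refine inv_anti₀ (by norm_num) ?_
    have := Real.add_one_le_exp (1 : ℝ); linarith
  nlinarith [Real.exp_pos (-1)]

end System

theorem iteration_bound {ε₀ : ℝ} (hε₀ : 0 < ε₀) (hε₁ : ε₀ < 1) : ∃ C : ℝ, 0 < C ∧
    ∀ (n : ℕ) (Q : System n) (ε : ℝ), 0 < ε → ε ≤ ε₀ →
      ∀ k : ℕ, ⌊C * Q.st ^ (1 / 3 : ℝ) * Real.log (1 / ε)⌋₊ ≤ k →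
        Q.Accurate ε (Q.iterate k) := by
  have hL₀ : 0 < Real.log (1 / ε₀) := Real.log_pos (by rw [lt_div_iff₀ hε₀]; linarith)
  -- `accurate_of_le` asks for `3 ρ + 2 ρ ln(1/ε)`, and the floor loses at most `1 ≤ ρ`; the
  -- resulting `4 ρ` is at most `4 / ln(1/ε₀)` times `ρ ln(1/ε)`.
  refine ⟨4 / Real.log (1 / ε₀) + 2, by positivity, fun n Q ε hε hεε k hk => ?_⟩
  by_cases hn : 2 ≤ n
  swap
  · exact Q.accurate_of_subsingleton hn _ _
  have hst := Q.one_le_st hn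
  set ρ := Q.st ^ (1 / 3 : ℝ) with hρ
  have hρ1 : 1 ≤ ρ := Real.one_le_rpow hst (by norm_num)
  have hρ3 : ρ ^ 3 = Q.st := by
    rw [hρ, ← Real.rpow_natCast, ← Real.rpow_mul (by linarith)]
    norm_num
  have hL : Real.log (1 / ε₀) ≤ Real.log (1 / ε) :=
    Real.log_le_log (by positivity) (one_div_le_one_div_of_le hε hεε)
  refine Q.accurate_of_le hε hρ1 hρ3.ge ?_ (by linarith)
  have h1 := Nat.lt_of_floor_lt (Nat.lt_succ_of_le hk)
  push_cast at h1
  have h2 : 4 ≤ 4 / Real.log (1 / ε₀) * Real.log (1 / ε) := by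
    rw [div_mul_eq_mul_div, le_div_iff₀ hL₀]; linarith
  have h3 : 4 * ρ ≤ 4 / Real.log (1 / ε₀) * Real.log (1 / ε) * ρ :=
    mul_le_mul_of_nonneg_right h2 (by linarith)
  nlinarith

/-! ### A program logic with running times -/

/-- From memory `s` the program `p` halts within `τ` steps in a memory that satisfies `Q`. -/
def Wp (p : Prog) (τ : ℕ) (Q : Mem → Prop) (s : Mem) : Prop :=
  ∃ (s' : Mem) (t : ℕ), Exec p s s' t ∧ t ≤ τ ∧ Q s'

/-- The arrays of naturals that a program may change. -/
def Prog.natMods : Prog → List ℕ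
  | .skip => []
  | .setNat a _ _ => [a]
  | .setReal _ _ _ => []
  | .seq p q => p.natMods ++ q.natMods
  | .ite _ p q => p.natMods ++ q.natMods
  | .loop _ p => p.natMods

/-- The arrays of reals that a program may change. -/
def Prog.realMods : Prog → List ℕ
  | .skip => []
  | .setNat _ _ _ => []
  | .setReal a _ _ => [a]
  | .seq p q => p.realMods ++ q.realMods
  | .ite _ p q => p.realMods ++ q.realMods
  | .loop _ p => p.realMods

/-- `s'` agrees with `s` on all arrays that `p` does not change. -/
structure Frame (p : Prog) (s s' : Mem) : Prop where
  nat : ∀ a, a ∉ p.natMods → s'.nat a = s.nat a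
  real : ∀ a, a ∉ p.realMods → s'.real a = s.real a

theorem Frame.refl (p : Prog) (s : Mem) : Frame p s s := ⟨fun _ _ => rfl, fun _ _ => rfl⟩

theorem Frame.trans {p : Prog} {s s' s'' : Mem} (h : Frame p s s') (h' : Frame p s' s'') :
    Frame p s s'' :=
  ⟨fun a ha => (h'.nat a ha).trans (h.nat a ha), fun a ha => (h'.real a ha).trans (h.real a ha)⟩

theorem Frame.mono {p q : Prog} {s s' : Mem} (h : Frame p s s')
    (hn : p.natMods ⊆ q.natMods) (hr : p.realMods ⊆ q.realMods) : Frame q s s' :=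
  ⟨fun a ha => h.nat a fun h' => ha (hn h'), fun a ha => h.real a fun h' => ha (hr h')⟩

theorem Exec.frame {p : Prog} {s s' : Mem} {t : ℕ} (h : Exec p s s' t) : Frame p s s' := by
  induction h with
  | skip s => exact Frame.refl _ _
  | setNat a i e s =>
    refine ⟨fun b hb => ?_, fun _ _ => rfl⟩
    exact Function.update_of_ne (by simpa [Prog.natMods] using hb) _ _
  | setReal a i e s =>
    refine ⟨fun _ _ => rfl, fun b hb => ?_⟩
    exact Function.update_of_ne (by simpa [Prog.realMods] using hb) _ _
  | seq _ _ ih₁ ih₂ =>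
    exact (ih₁.mono (List.subset_append_left _ _) (List.subset_append_left _ _)).trans
      (ih₂.mono (List.subset_append_right _ _) (List.subset_append_right _ _))
  | iteTrue _ _ ih => exact ih.mono (List.subset_append_left _ _) (List.subset_append_left _ _)
  | iteFalse _ _ ih => exact ih.mono (List.subset_append_right _ _) (List.subset_append_right _ _)
  | loopTrue _ _ _ ih₁ ih₂ => exact (ih₁.mono (q := .loop _ _) (fun _ h => h) (fun _ h => h)).trans ih₂
  | loopFalse _ => exact Frame.refl _ _

theorem Wp.mono {p : Prog} {τ τ' : ℕ} {Q Q' : Mem → Prop} {s : Mem} (h : Wp p τ Q s)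
    (hτ : τ ≤ τ') (hQ : ∀ s', Frame p s s' → Q s' → Q' s') : Wp p τ' Q' s := by
  obtain ⟨s', t, he, ht, hs⟩ := h
  exact ⟨s', t, he, ht.trans hτ, hQ s' he.frame hs⟩

/-- Run `p` and then, from every memory that the first part may reach, `q`. -/
theorem Wp.seq {p q : Prog} {τ₁ τ₂ : ℕ} {Q Q' : Mem → Prop} {s : Mem} (h : Wp p τ₁ Q s)
    (h' : ∀ s', Frame p s s' → Q s' → Wp q τ₂ Q' s') : Wp (.seq p q) (τ₁ + τ₂) Q' s := by
  obtain ⟨s₁, t₁, he₁, ht₁, hs₁⟩ := h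
  obtain ⟨s₂, t₂, he₂, ht₂, hs₂⟩ := h' s₁ he₁.frame hs₁
  exact ⟨s₂, t₁ + t₂, .seq he₁ he₂, add_le_add ht₁ ht₂, hs₂⟩

open Classical in
/-- The effect of a program without loops. -/
noncomputable def Prog.run : Prog → Mem → Mem
  | .skip, s => s
  | .setNat a i e, s => s.setNat a (i.eval s) (e.eval s)
  | .setReal a i e, s => s.setReal a (i.eval s) (e.eval s)
  | .seq p q, s => q.run (p.run s)
  | .ite c p q, s => if c.eval s then p.run s else q.run s
  | .loop _ _, s => s

/-- The program has no loops. -/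
def Prog.flat : Prog → Bool
  | .skip => true
  | .setNat _ _ _ => true
  | .setReal _ _ _ => true
  | .seq p q => p.flat && q.flat
  | .ite _ p q => p.flat && q.flat
  | .loop _ _ => false

/-- A bound for the running time of a program without loops. -/
def Prog.flatCost : Prog → ℕ
  | .skip => 1
  | .setNat _ i e => i.cost + e.cost + 1
  | .setReal _ i e => i.cost + e.cost + 1
  | .seq p q => p.flatCost + q.flatCost
  | .ite c p q => c.cost + (p.flatCost + q.flatCost) + 1
  | .loop _ _ => 0

/-- Loop bodies are verified by simplifying `Prog.run`, with no derivation of `Exec`. The cost bound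
charges both branches of a conditional, so it does not depend on the memory. -/
theorem wp_flat {p : Prog} (hp : p.flat = true) {Q : Mem → Prop} {s : Mem} (h : Q (p.run s)) :
    Wp p p.flatCost Q s := by
  have key : ∀ (p : Prog) (s : Mem), p.flat = true → ∃ t, Exec p s (p.run s) t ∧ t ≤ p.flatCost := by
    intro p
    induction p with
    | skip => exact fun s _ => ⟨_, .skip s, le_rfl⟩
    | setNat a i e => exact fun s _ => ⟨_, .setNat a i e s, le_rfl⟩
    | setReal a i e => exact fun s _ => ⟨_, .setReal a i e s, le_rfl⟩
    | seq p q ihp ihq =>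
      intro s hf
      rw [Prog.flat, Bool.and_eq_true] at hf
      obtain ⟨t₁, h₁, ht₁⟩ := ihp s hf.1
      obtain ⟨t₂, h₂, ht₂⟩ := ihq (p.run s) hf.2
      exact ⟨_, .seq h₁ h₂, add_le_add ht₁ ht₂⟩
    | ite c p q ihp ihq =>
      intro s hf
      rw [Prog.flat, Bool.and_eq_true] at hf
      by_cases hc : c.eval s
      · obtain ⟨t, h, ht⟩ := ihp s hf.1
        rw [Prog.run, if_pos hc, Prog.flatCost]
        exact ⟨_, .iteTrue hc h, by omega⟩
      · obtain ⟨t, h, ht⟩ := ihq s hf.2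
        rw [Prog.run, if_neg hc, Prog.flatCost]
        exact ⟨_, .iteFalse hc h, by omega⟩
    | loop c p => exact fun s hf => absurd hf (by simp [Prog.flat])
  obtain ⟨t, he, ht⟩ := key p s hp
  exact ⟨_, t, he, ht, h⟩

/-- Cell `0` of array `a`, as an expression. -/
abbrev nv (a : ℕ) : NExp := .get a (.lit 0)

/-- For each value of the counter in cell `0` of array `c`, from `0` to `B - 1`, run `p`. -/
def forLoop (c : ℕ) (B : NExp) (p : Prog) : Prog :=
  .seq (.setNat c (.lit 0) (.lit 0))
    (.loop (.natLt (nv c) B) (.seq p (.setNat c (.lit 0) (.add (nv c) (.lit 1)))))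

@[simp] theorem Mem.setNat_nat (s : Mem) (a i v b : ℕ) : (s.setNat a i v).nat b =
    if b = a then Function.update (s.nat a) i v else s.nat b := by
  simp only [Mem.setNat, Function.update_apply]

@[simp] theorem Mem.setNat_real (s : Mem) (a i v : ℕ) : (s.setNat a i v).real = s.real := rfl

@[simp] theorem Mem.setReal_real (s : Mem) (a i b : ℕ) (v : ℝ) : (s.setReal a i v).real b =
    if b = a then Function.update (s.real a) i v else s.real b := by
  simp only [Mem.setReal, Function.update_apply]

@[simp] theorem Mem.setReal_nat (s : Mem) (a i : ℕ) (v : ℝ) : (s.setReal a i v).nat = s.nat := rfl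

/-- The rule for counting loops, with an invariant `I`. -/
theorem wp_forLoop {c N τ : ℕ} {B : NExp} {p : Prog} {s₀ : Mem} {Q : Mem → Prop}
    (I : ℕ → Mem → Prop) (hc : c ∉ p.natMods)
    (hB : ∀ s, Frame (forLoop c B p) s₀ s → B.eval s = N)
    (h0 : I 0 (s₀.setNat c 0 0))
    (hstep : ∀ i s, i < N → Frame (forLoop c B p) s₀ s → s.nat c 0 = i → I i s →
      Wp p τ (fun s' => I (i + 1) (s'.setNat c 0 (i + 1))) s)
    (hQ : ∀ s, Frame (forLoop c B p) s₀ s → I N s → Q s) :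
    Wp (forLoop c B p) ((N + 1) * (τ + B.cost + 10)) Q s₀ := by
  -- Induction on the number `d` of rounds left. A round costs, besides the body and the evaluation
  -- of `B`, 3 steps for the comparison, 6 for the increment and 1 for the loop.
  have key : ∀ d i s, i + d = N → Frame (forLoop c B p) s₀ s → s.nat c 0 = i → I i s →
      Wp (.loop (.natLt (nv c) B) (.seq p (.setNat c (.lit 0) (.add (nv c) (.lit 1)))))
        (d * (τ + B.cost + 10) + B.cost + 4) Q s := by
    intro d
    induction d with
    | zero =>
      intro i s hi hF hci hI
      obtain rfl : i = N := by omega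
      refine ⟨s, _, .loopFalse ?_, ?_, hQ s hF hI⟩
      · simp only [Test.eval, NExp.eval, hB s hF, hci, lt_irrefl, not_false_eq_true]
      · simp only [Test.cost, NExp.cost]; omega
    | succ d ih =>
      intro i s hi hF hci hI
      obtain ⟨s₁, t₁, he₁, ht₁, hI₁⟩ := hstep i s (by omega) hF hci hI
      have hci₁ : s₁.nat c 0 = i := by rw [he₁.frame.nat c hc, hci]
      have hx : Exec (.seq p (.setNat c (.lit 0) (.add (nv c) (.lit 1)))) s
          (s₁.setNat c 0 (i + 1)) (t₁ + 6) := by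
        have h2 := Exec.setNat c (.lit 0) (.add (nv c) (.lit 1)) s₁
        simp only [NExp.eval, hci₁] at h2
        exact Exec.seq he₁ h2
      have hF₁ : Frame (forLoop c B p) s₀ (s₁.setNat c 0 (i + 1)) :=
        hF.trans (hx.frame.mono (by simp [forLoop, Prog.natMods])
          (by simp [forLoop, Prog.realMods]))
      obtain ⟨s₂, t₂, he₂, ht₂, hQ₂⟩ := ih (i + 1) _ (by omega) hF₁ (by simp) hI₁
      refine ⟨s₂, _, .loopTrue ?_ hx he₂, ?_, hQ₂⟩
      · simp only [Test.eval, NExp.eval, hB s hF, hci]; omega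
      · simp only [Test.cost, NExp.cost]
        have : (d + 1) * (τ + B.cost + 10) = d * (τ + B.cost + 10) + (τ + B.cost + 10) := by ring
        omega
  have h1 : Exec (.setNat c (.lit 0) (.lit 0)) s₀ (s₀.setNat c 0 0) 3 :=
    Exec.setNat c (.lit 0) (.lit 0) s₀
  obtain ⟨s', t, he, ht, hs⟩ := key N 0 (s₀.setNat c 0 0) (by omega)
    (h1.frame.mono (by simp [forLoop, Prog.natMods]) (by simp [Prog.realMods])) (by simp) h0
  refine ⟨s', _, .seq h1 he, ?_, hs⟩
  have : (N + 1) * (τ + B.cost + 10) = N * (τ + B.cost + 10) + (τ + B.cost + 10) := by ring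
  omega

/-- The rule for counting loops whose body has no loops. -/
theorem wp_forLoop_flat {c N S K : ℕ} {B : NExp} {p : Prog} {s₀ : Mem} {Q : Mem → Prop}
    (I : ℕ → Mem → Prop) (hc : c ∉ p.natMods) (hp : p.flat = true)
    (hK : p.flatCost + B.cost + 10 ≤ K) (hS : N + 1 ≤ S)
    (hB : ∀ s, Frame (forLoop c B p) s₀ s → B.eval s = N)
    (h0 : I 0 (s₀.setNat c 0 0))
    (hstep : ∀ i s, i < N → Frame (forLoop c B p) s₀ s → s.nat c 0 = i → I i s →
      I (i + 1) ((p.run s).setNat c 0 (i + 1)))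
    (hQ : ∀ s, Frame (forLoop c B p) s₀ s → I N s → Q s) :
    Wp (forLoop c B p) (S * K) Q s₀ :=
  (wp_forLoop I hc hB h0 (fun i s hi hF hci hI => wp_flat hp (hstep i s hi hF hci hI)) hQ).mono
    (Nat.mul_le_mul hS hK) fun _ _ h => h

/-! ### The method without the test for a vanishing residual -/

section PlainStep

variable {V : Type*} [Fintype V] {A C : Matrix V V ℝ} {b : V → ℝ}

/-- One iteration; division by `0` gives `0`. -/
noncomputable def plainStep (A C : Matrix V V ℝ) (s : CGState V) : CGState V :=
  let z := pinv C *ᵥ s.r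
  let α := (s.r ⬝ᵥ z) / (s.p ⬝ᵥ (A *ᵥ s.p))
  let r' := s.r - α • (A *ᵥ s.p)
  let z' := pinv C *ᵥ r'
  let β := (r' ⬝ᵥ z') / (s.r ⬝ᵥ z)
  { x := s.x + α • s.p
    r := r'
    p := z' + β • s.p }

/-- The state after `k` iterations without the test. -/
noncomputable def plainState (A C : Matrix V V ℝ) (b : V → ℝ) (k : ℕ) : CGState V :=
  (plainStep A C)^[k] (pcgInit C b)

theorem plainState_succ (k : ℕ) :
    plainState A C b (k + 1) = plainStep A C (plainState A C b k) :=
  Function.iterate_succ_apply' _ _ _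

/-- At a zero residual `α` and `β` become 0 under division by 0, so iterate and residual stay put.
Only the direction is reset to 0, which is why the full states agree only before that. The program
may therefore omit the test. -/
theorem plainState_eq (k : ℕ) : (plainState A C b k).x = (pcgState A C b k).x ∧
    (plainState A C b k).r = (pcgState A C b k).r ∧
    ((pcgState A C b k).r = 0 ∨ plainState A C b k = pcgState A C b k) := by
  induction k with
  | zero => exact ⟨rfl, rfl, Or.inr rfl⟩
  | succ k ih =>
    rw [plainState_succ, pcgState_succ]
    obtain ⟨hx, hr, h⟩ := ih
    by_cases h0 : (pcgState A C b k).r = 0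
    · rw [pcgStep, if_pos h0]
      have h1 : (plainState A C b k).r = 0 := hr.trans h0
      simp [plainStep, h1, hx, h0]
    · rw [h.resolve_left h0, pcgStep, if_neg h0]
      exact ⟨rfl, rfl, Or.inr rfl⟩

theorem Precond.plainState_r (h : Precond A C) (hb : ∃ y, A *ᵥ y = b) (k : ℕ) :
    ∃ y, A *ᵥ y = (plainState A C b k).r := by
  obtain ⟨y, rfl⟩ := hb
  obtain ⟨_, hr, -⟩ := plainState_eq (A := A) (C := C) (b := A *ᵥ y) k
  rw [hr, (h.cgInv_or ⟨y, rfl⟩ k).1, ← Matrix.mulVec_sub]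
  exact ⟨_, rfl⟩

end PlainStep

/-! ### Leaf elimination in a tree -/

section Elimination

variable (eu ev : ℕ → ℕ)

/-- The edge `e` is incident to the vertex `x`. -/
def Inc (e x : ℕ) : Prop := eu e = x ∨ ev e = x

instance (e x : ℕ) : Decidable (Inc eu ev e x) := inferInstanceAs (Decidable (_ ∨ _))

/-- The degree of `x` with respect to the edges in `F`. -/
def degree (F : Finset ℕ) (x : ℕ) : ℕ := (F.filter (Inc eu ev · x)).card

/-- The sum of the indices of the edges in `F` that are incident to `x`. -/
def indexSum (F : Finset ℕ) (x : ℕ) : ℕ := ∑ e ∈ F with Inc eu ev e x, e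

theorem degree_insert {F : Finset ℕ} {e : ℕ} (he : e ∉ F) (x : ℕ) :
    degree eu ev (insert e F) x = degree eu ev F x + if Inc eu ev e x then 1 else 0 := by
  rw [degree, Finset.filter_insert]
  split_ifs
  · rw [Finset.card_insert_of_notMem (by simp [he])]; rfl
  · rfl

theorem indexSum_insert {F : Finset ℕ} {e : ℕ} (he : e ∉ F) (x : ℕ) :
    indexSum eu ev (insert e F) x = indexSum eu ev F x + if Inc eu ev e x then e else 0 := by
  rw [indexSum, Finset.filter_insert]
  split_ifs
  · rw [Finset.sum_insert (by simp [he]), add_comm]; rfl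
  · rfl

theorem degree_erase {F : Finset ℕ} {e : ℕ} (he : e ∈ F) (x : ℕ) :
    degree eu ev F x = degree eu ev (F.erase e) x + if Inc eu ev e x then 1 else 0 := by
  conv_lhs => rw [← Finset.insert_erase he]
  exact degree_insert eu ev (Finset.notMem_erase e F) x

theorem indexSum_erase {F : Finset ℕ} {e : ℕ} (he : e ∈ F) (x : ℕ) :
    indexSum eu ev F x = indexSum eu ev (F.erase e) x + if Inc eu ev e x then e else 0 := by
  conv_lhs => rw [← Finset.insert_erase he]
  exact indexSum_insert eu ev (Finset.notMem_erase e F) x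

/-- After the elimination of the leaves `q 0, …, q (i - 1)` of the tree with the edges `F₀`, the
edges `F` and the vertices `A` remain; the leaves among them are in the queue `q i, …`. The leaf
`q j` was attached to `par j` by the edge `pe j`. -/
structure ElimInv (n : ℕ) (F₀ : Finset ℕ) (i cnt : ℕ) (q par pe : ℕ → ℕ) (F A : Finset ℕ) :
    Prop where
  mem_A : ∀ x, x ∈ A ↔ x < n ∧ ∀ j < i, q j ≠ x
  edges : ∀ e ∈ F, eu e ∈ A ∧ ev e ∈ A ∧ eu e ≠ ev e
  cardA : A.card + i = n
  cardF : F.card + i + 1 = n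
  -- Connectedness of the remaining tree, in a form that survives the removal of a leaf without
  -- talking about walks.
  cut : ∀ U : Set ℕ, ∀ x ∈ A, x ∈ U → ∀ y ∈ A, y ∉ U →
    ∃ e ∈ F, (eu e ∈ U ∧ ev e ∉ U) ∨ (eu e ∉ U ∧ ev e ∈ U)
  le_cnt : i ≤ cnt
  q_inj : ∀ j < cnt, ∀ j' < cnt, q j = q j' → j = j'
  -- Not an equality: of the last two vertices both are queued, and the survivor has degree 0.
  q_mem : ∀ j, i ≤ j → j < cnt → q j ∈ A ∧ degree eu ev F (q j) ≤ 1
  leaf : ∀ x ∈ A, degree eu ev F x = 1 → ∃ j, i ≤ j ∧ j < cnt ∧ q j = x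
  sub : F ⊆ F₀
  pe_mem : ∀ j < i, pe j ∈ F₀
  ends : ∀ j < i, (eu (pe j) = q j ∧ ev (pe j) = par j) ∨ (eu (pe j) = par j ∧ ev (pe j) = q j)
  par_lt : ∀ j < i, par j < n ∧ ∀ j' ≤ j, q j' ≠ par j
  sum : ∀ g : ℕ → ℝ, ∑ e ∈ F₀, g e = ∑ e ∈ F, g e + ∑ j ∈ Finset.range i, g (pe j)

variable {eu ev} {n : ℕ} {F₀ : Finset ℕ} {i cnt : ℕ} {q par pe : ℕ → ℕ} {F A : Finset ℕ}

namespace ElimInv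

theorem sum_degree (h : ElimInv eu ev n F₀ i cnt q par pe F A) :
    ∑ x ∈ A, degree eu ev F x = 2 * F.card := by
  have h1 : ∀ x, degree eu ev F x = ∑ e ∈ F, if Inc eu ev e x then 1 else 0 := fun x => by
    rw [degree, Finset.card_filter]
  simp only [h1]
  rw [Finset.sum_comm, mul_comm, ← smul_eq_mul, ← Finset.sum_const]
  refine Finset.sum_congr rfl fun e he => ?_
  obtain ⟨hu, hv, hne⟩ := h.edges e he
  rw [← Finset.card_filter]
  have : A.filter (fun x => Inc eu ev e x) = {eu e, ev e} := by
    ext x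
    rw [Finset.mem_filter, Finset.mem_insert, Finset.mem_singleton]
    constructor
    · rintro ⟨-, h | h⟩
      · exact Or.inl h.symm
      · exact Or.inr h.symm
    · rintro (rfl | rfl)
      · exact ⟨hu, Or.inl rfl⟩
      · exact ⟨hv, Or.inr rfl⟩
  rw [this, Finset.card_pair hne]

theorem one_le_degree (h : ElimInv eu ev n F₀ i cnt q par pe F A) (hi : i + 1 < n) {x : ℕ}
    (hx : x ∈ A) : 1 ≤ degree eu ev F x := by
  obtain ⟨y, hy, hyx⟩ : ∃ y ∈ A, y ≠ x :=
    Finset.exists_mem_ne (by have := h.cardA; omega) x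
  obtain ⟨e, he, hc⟩ := h.cut {x} x hx rfl y hy hyx
  refine Finset.card_pos.2 ⟨e, Finset.mem_filter.2 ⟨he, ?_⟩⟩
  rcases hc with hc | hc
  · exact Or.inl hc.1
  · exact Or.inr hc.2

/-- The queue cannot run dry: by the handshake identity the degrees sum to `2 (|A| - 1)`, so some
vertex has degree below 2, and it is queued. -/
theorem lt_cnt (h : ElimInv eu ev n F₀ i cnt q par pe F A) (hi : i + 1 < n) : i < cnt := by
  obtain ⟨x, hx, hdx⟩ : ∃ x ∈ A, degree eu ev F x < 2 := by
    by_contra! hcon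
    have h1 := Finset.card_nsmul_le_sum A _ 2 hcon
    rw [h.sum_degree, smul_eq_mul] at h1
    have := h.cardA
    have := h.cardF
    omega
  obtain ⟨j, hij, hj, -⟩ := h.leaf x hx (by have := h.one_le_degree hi hx; omega)
  omega

/-- A leaf has one incident edge, so its index sum is the index of that edge, and the other endpoint
is the sum of the endpoints minus the leaf. Thus no adjacency lists are needed. The two final
alternatives are the cases in which the neighbour does or does not become a new leaf. -/
theorem step (h : ElimInv eu ev n F₀ i cnt q par pe F A) (hi : i + 1 < n) :
    ∃ e ∈ F, indexSum eu ev F (q i) = e ∧ ∃ p, eu e + ev e - q i = p ∧ p ≠ q i ∧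
      (∀ x, Inc eu ev e x ↔ x = q i ∨ x = p) ∧
      (degree eu ev (F.erase e) p = 1 → ElimInv eu ev n F₀ (i + 1) (cnt + 1)
        (Function.update q cnt p) (Function.update par i p) (Function.update pe i e)
        (F.erase e) (A.erase (q i))) ∧
      (degree eu ev (F.erase e) p ≠ 1 → ElimInv eu ev n F₀ (i + 1) cnt
        q (Function.update par i p) (Function.update pe i e) (F.erase e) (A.erase (q i))) := by
  have hlt := h.lt_cnt hi
  obtain ⟨hvA, hd1⟩ := h.q_mem i le_rfl hlt
  have hd : degree eu ev F (q i) = 1 := le_antisymm hd1 (h.one_le_degree hi hvA)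
  obtain ⟨e, hFe⟩ := Finset.card_eq_one.1 hd
  have heF : e ∈ F ∧ Inc eu ev e (q i) := by
    have h0 : e ∈ F.filter (Inc eu ev · (q i)) := by
      rw [hFe]; exact Finset.mem_singleton_self e
    exact Finset.mem_filter.1 h0
  obtain ⟨heu, hev, hne⟩ := h.edges e heF.1
  obtain ⟨p, hp, hpv, hends, hpA⟩ : ∃ p, eu e + ev e - q i = p ∧ p ≠ q i ∧
      ((eu e = q i ∧ ev e = p) ∨ (eu e = p ∧ ev e = q i)) ∧ p ∈ A := by
    rcases heF.2 with h1 | h1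
    · exact ⟨ev e, by omega, fun h2 => hne (by omega), Or.inl ⟨h1, rfl⟩, hev⟩
    · exact ⟨eu e, by omega, fun h2 => hne (by omega), Or.inr ⟨rfl, h1⟩, heu⟩
  have hinc : ∀ x, Inc eu ev e x ↔ x = q i ∨ x = p := by
    intro x
    rw [Inc]
    rcases hends with ⟨h1, h2⟩ | ⟨h1, h2⟩ <;> rw [h1, h2] <;> constructor <;> rintro (h3 | h3) <;>
      simp [h3]
  have honly : ∀ e' ∈ F.erase e, ¬ Inc eu ev e' (q i) := by
    intro e' he' hI
    have : e' ∈ F.filter (Inc eu ev · (q i)) :=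
      Finset.mem_filter.2 ⟨Finset.mem_of_mem_erase he', hI⟩
    rw [hFe, Finset.mem_singleton] at this
    exact Finset.ne_of_mem_erase he' this
  -- Everything that does not depend on whether the neighbour is queued.
  have core : ∀ (q' : ℕ → ℕ) (cnt' : ℕ), (∀ j < cnt, q' j = q j) → cnt ≤ cnt' →
      (∀ j < cnt', ∀ j' < cnt', q' j = q' j' → j = j') →
      (∀ j, i + 1 ≤ j → j < cnt' → q' j ∈ A.erase (q i) ∧ degree eu ev (F.erase e) (q' j) ≤ 1) →
      (∀ x ∈ A.erase (q i), degree eu ev (F.erase e) x = 1 →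
        ∃ j, i + 1 ≤ j ∧ j < cnt' ∧ q' j = x) →
      ElimInv eu ev n F₀ (i + 1) cnt' q' (Function.update par i p) (Function.update pe i e)
        (F.erase e) (A.erase (q i)) := by
    intro q' cnt' hq' hcnt' hinj hmem hleaf
    have upd : ∀ (f : ℕ → ℕ) (a j : ℕ), j < i → Function.update f i a j = f j := fun f a j hj =>
      Function.update_of_ne (by omega) _ _
    refine ⟨fun x => ?_, fun e' he' => ?_, ?_, ?_, ?_, by omega, hinj, hmem, hleaf,
      (Finset.erase_subset _ _).trans h.sub, fun j hj => ?_, fun j hj => ?_, fun j hj => ?_,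
      fun g => ?_⟩
    · rw [Finset.mem_erase, h.mem_A]
      constructor
      · rintro ⟨h1, h2, h3⟩
        refine ⟨h2, fun j hj => ?_⟩
        rw [hq' j (by omega)]
        rcases (Nat.lt_succ_iff_lt_or_eq).1 hj with h4 | rfl
        · exact h3 j h4
        · exact h1.symm
      · rintro ⟨h1, h2⟩
        refine ⟨fun h3 => h2 i (by omega) ?_, h1, fun j hj => ?_⟩
        · rw [hq' i hlt, h3]
        · rw [← hq' j (by omega)]; exact h2 j (by omega)
    · have h1 := honly e' he'
      rw [Inc, not_or] at h1
      obtain ⟨h2, h3, h4⟩ := h.edges e' (Finset.mem_of_mem_erase he')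
      exact ⟨Finset.mem_erase.2 ⟨h1.1, h2⟩, Finset.mem_erase.2 ⟨h1.2, h3⟩, h4⟩
    · have := h.cardA
      rw [Finset.card_erase_of_mem hvA]
      omega
    · have := h.cardF
      rw [Finset.card_erase_of_mem heF.1]
      omega
    · intro U x hx hxU y hy hyU
      obtain ⟨hxv, hxA⟩ := Finset.mem_erase.1 hx
      obtain ⟨hyv, hyA⟩ := Finset.mem_erase.1 hy
      -- The removed leaf is placed on the side of its neighbour, so that the old crossing edge
      -- cannot be `e`.
      by_cases hpU : p ∈ U
      · obtain ⟨e', he', hc⟩ := h.cut (insert (q i) U) x hxA (Set.mem_insert_of_mem _ hxU) y hyA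
          (by simp [hyv, hyU])
        have hee : e' ≠ e := by
          rintro rfl
          rcases hends with ⟨h1, h2⟩ | ⟨h1, h2⟩ <;> rw [h1, h2] at hc <;> simp [hpU] at hc
        have hmem' := Finset.mem_erase.2 ⟨hee, he'⟩
        have h1 := honly e' hmem'
        rw [Inc, not_or] at h1
        exact ⟨e', hmem', by simpa [h1.1, h1.2] using hc⟩
      · obtain ⟨e', he', hc⟩ := h.cut (U \ {q i}) x hxA ⟨hxU, hxv⟩ y hyA (fun h1 => hyU h1.1)
        have hee : e' ≠ e := by
          rintro rfl
          rcases hends with ⟨h1, h2⟩ | ⟨h1, h2⟩ <;> rw [h1, h2] at hc <;> simp [hpU] at hc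
        have hmem' := Finset.mem_erase.2 ⟨hee, he'⟩
        have h1 := honly e' hmem'
        rw [Inc, not_or] at h1
        exact ⟨e', hmem', by simpa [h1.1, h1.2] using hc⟩
    · rcases (Nat.lt_succ_iff_lt_or_eq).1 hj with h1 | rfl
      · rw [upd _ _ _ h1]; exact h.pe_mem j h1
      · rw [Function.update_self]; exact h.sub heF.1
    · rcases (Nat.lt_succ_iff_lt_or_eq).1 hj with h1 | rfl
      · rw [upd _ _ _ h1, upd _ _ _ h1, hq' j (by omega)]; exact h.ends j h1
      · rw [Function.update_self, Function.update_self, hq' j hlt]; exact hends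
    · rcases (Nat.lt_succ_iff_lt_or_eq).1 hj with h1 | rfl
      · rw [upd _ _ _ h1]
        refine ⟨(h.par_lt j h1).1, fun j' hj' => ?_⟩
        rw [hq' j' (by omega)]
        exact (h.par_lt j h1).2 j' hj'
      · rw [Function.update_self]
        obtain ⟨h2, h3⟩ := (h.mem_A p).1 hpA
        refine ⟨h2, fun j' hj' => ?_⟩
        rw [hq' j' (by omega)]
        rcases hj'.lt_or_eq with h4 | rfl
        · exact h3 j' h4
        · exact hpv.symm
    · rw [h.sum g, Finset.sum_range_succ, Function.update_self,
        ← Finset.sum_erase_add _ _ heF.1, add_assoc, add_comm (g e)]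
      congr 2
      exact Finset.sum_congr rfl fun j hj => by rw [upd _ _ _ (Finset.mem_range.1 hj)]
  have hdeg := degree_erase eu ev heF.1
  have hold : ∀ j, i + 1 ≤ j → j < cnt →
      q j ∈ A.erase (q i) ∧ degree eu ev (F.erase e) (q j) ≤ 1 := by
    intro j hij hj
    obtain ⟨h1, h2⟩ := h.q_mem j (by omega) hj
    refine ⟨Finset.mem_erase.2 ⟨fun h3 => ?_, h1⟩, ?_⟩
    · have := h.q_inj j hj i hlt h3
      omega
    · have := hdeg (q j)
      omega
  have hleaf : ∀ x ∈ A.erase (q i), x ≠ p → degree eu ev (F.erase e) x = 1 →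
        ∃ j, i + 1 ≤ j ∧ j < cnt ∧ q j = x := by
    intro x hx hxp hdx
    obtain ⟨hxv, hxA⟩ := Finset.mem_erase.1 hx
    have h1 := hdeg x
    rw [if_neg (by rw [hinc]; tauto), hdx] at h1
    obtain ⟨j, hij, hj, rfl⟩ := h.leaf x hxA h1
    refine ⟨j, ?_, hj, rfl⟩
    rcases hij.lt_or_eq with h2 | rfl
    · exact h2
    · exact absurd rfl hxv
  refine ⟨e, heF.1, ?_, p, hp, hpv, hinc, fun hdp => ?_, fun hdp => ?_⟩
  · rw [indexSum, hFe, Finset.sum_singleton]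
  · have hupd : ∀ j < cnt, Function.update q cnt p j = q j := fun j hj =>
      Function.update_of_ne (by omega) _ _
    -- Before the removal `p` had degree 2 and so was not waiting in the queue; being in `A`, it was
    -- not eliminated either.
    have hnew : ∀ j < cnt, q j ≠ p := by
      rintro j hj rfl
      have h1 := hdeg (q j)
      rw [if_pos ((hinc _).2 (Or.inr rfl)), hdp] at h1
      rcases Nat.lt_or_ge j i with h2 | h2
      · exact ((h.mem_A _).1 hpA).2 j h2 rfl
      · have := (h.q_mem j h2 hj).2
        omega
    refine core _ _ hupd (Nat.le_succ _) ?_ ?_ ?_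
    · intro j hj j' hj' hjj
      rcases (Nat.lt_succ_iff_lt_or_eq).1 hj with h1 | rfl <;>
        rcases (Nat.lt_succ_iff_lt_or_eq).1 hj' with h2 | rfl
      · rw [hupd _ h1, hupd _ h2] at hjj
        exact h.q_inj j h1 j' h2 hjj
      · rw [hupd _ h1, Function.update_self] at hjj
        exact absurd hjj (hnew j h1)
      · rw [hupd _ h2, Function.update_self] at hjj
        exact absurd hjj.symm (hnew j' h2)
      · rfl
    · intro j hij hj
      rcases (Nat.lt_succ_iff_lt_or_eq).1 hj with h1 | rfl
      · rw [hupd _ h1]; exact hold j hij h1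
      · rw [Function.update_self]
        exact ⟨Finset.mem_erase.2 ⟨hpv, hpA⟩, hdp.le⟩
    · intro x hx hdx
      by_cases hxp : x = p
      · exact ⟨cnt, hlt, Nat.lt_succ_self _, by rw [Function.update_self, hxp]⟩
      · obtain ⟨j, h1, h2, h3⟩ := hleaf x hx hxp hdx
        exact ⟨j, h1, by omega, by rw [hupd _ h2, h3]⟩
  · refine core _ _ (fun _ _ => rfl) le_rfl h.q_inj hold fun x hx hdx => hleaf x hx ?_ hdx
    rintro rfl
    exact hdp hdx

end ElimInv

variable (eu ev n F₀ q par pe) in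
/-- The order `q 0, …, q (n - 2)` eliminates the tree with the edges `F₀`: the vertex `q j` is
attached to `par j`, which is not eliminated before, by the edge `pe j`. -/
structure Elim : Prop where
  q_lt : ∀ j, j + 1 < n → q j < n
  par_lt : ∀ j, j + 1 < n → par j < n
  q_inj : ∀ j j', j + 1 < n → j' + 1 < n → q j = q j' → j = j'
  q_ne_par : ∀ j' j, j' ≤ j → j + 1 < n → q j' ≠ par j
  ends : ∀ j, j + 1 < n →
    (eu (pe j) = q j ∧ ev (pe j) = par j) ∨ (eu (pe j) = par j ∧ ev (pe j) = q j)
  pe_mem : ∀ j, j + 1 < n → pe j ∈ F₀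
  sum : ∀ g : ℕ → ℝ, ∑ e ∈ F₀, g e = ∑ j ∈ Finset.range (n - 1), g (pe j)

theorem ElimInv.elim (h : ElimInv eu ev n F₀ (n - 1) cnt q par pe F A)
    (hF₀ : ∀ e ∈ F₀, eu e < n ∧ ev e < n) : Elim eu ev n F₀ q par pe where
  q_lt j hj := by
    obtain ⟨h1, h2⟩ := hF₀ _ (h.pe_mem j (by omega))
    rcases h.ends j (by omega) with ⟨h3, h4⟩ | ⟨h3, h4⟩ <;> omega
  par_lt j hj := (h.par_lt j (by omega)).1
  q_inj j j' hj hj' hjj := h.q_inj j (by have := h.le_cnt; omega) j' (by have := h.le_cnt; omega) hjj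
  q_ne_par j' j hj' hj := (h.par_lt j (by omega)).2 j' hj'
  ends j hj := h.ends j (by omega)
  pe_mem j hj := h.pe_mem j (by omega)
  sum g := by
    have h1 : F = ∅ := Finset.card_eq_zero.1 (by have := h.cardF; omega)
    rw [h.sum g, h1, Finset.sum_empty, zero_add]

/-- The unit vector of `x`, at `k`. -/
def unit (x k : ℕ) : ℝ := if k = x then 1 else 0

theorem sum_unit {n x : ℕ} (hx : x < n) : ∑ k ∈ Finset.range n, unit x k = 1 := by
  simp [unit, hx]

/-- A vector with sum `0` that vanishes at all eliminated vertices vanishes. -/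
theorem Elim.eq_zero (h : Elim eu ev n F₀ q par pe) {y : ℕ → ℝ}
    (hy : ∀ j, j + 1 < n → y (q j) = 0) (hs : ∑ k ∈ Finset.range n, y k = 0) :
    ∀ k < n, y k = 0 := by
  set S := (Finset.range (n - 1)).image q with hS
  have hSn : S ⊆ Finset.range n := by
    intro x hx
    obtain ⟨j, hj, rfl⟩ := Finset.mem_image.1 hx
    exact Finset.mem_range.2 (h.q_lt j (by have := Finset.mem_range.1 hj; omega))
  have hcard : S.card = n - 1 := by
    rw [hS, Finset.card_image_of_injOn, Finset.card_range]
    intro j hj j' hj' hjj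
    have h1 := Finset.mem_range.1 hj
    have h2 := Finset.mem_range.1 hj'
    exact h.q_inj j j' (by omega) (by omega) hjj
  have hS0 : ∀ x ∈ S, y x = 0 := by
    intro x hx
    obtain ⟨j, hj, rfl⟩ := Finset.mem_image.1 hx
    exact hy j (by have := Finset.mem_range.1 hj; omega)
  intro k hk
  by_cases hkS : k ∈ S
  · exact hS0 k hkS
  -- The `n - 1` eliminated vertices are distinct, so `k` is the only other vertex and carries the
  -- whole sum.
  have h1 : insert k S = Finset.range n := by
    refine Finset.eq_of_subset_of_card_le (Finset.insert_subset (Finset.mem_range.2 hk) hSn) ?_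
    rw [Finset.card_insert_of_notMem hkS, hcard, Finset.card_range]
    omega
  rw [← h1, Finset.sum_insert hkS, Finset.sum_eq_zero hS0, add_zero] at hs
  exact hs

end Elimination

/-! ### Edge lists -/

section EdgeList

variable {n : ℕ}

/-- The first endpoint of the `i`-th edge. -/
def fstEnd (es : List (Fin n × Fin n)) (i : ℕ) : ℕ :=
  if h : i < es.length then ((es[i]'h).1 : ℕ) else 0

/-- The second endpoint of the `i`-th edge. -/
def sndEnd (es : List (Fin n × Fin n)) (i : ℕ) : ℕ :=
  if h : i < es.length then ((es[i]'h).2 : ℕ) else 0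

/-- The weight of the `i`-th edge. -/
noncomputable def System.wt (Q : System n) (es : List (Fin n × Fin n)) (i : ℕ) : ℝ :=
  if h : i < es.length then Q.w s((es[i]'h).1, (es[i]'h).2) else 0

open Classical in
/-- The indices of the tree edges. -/
noncomputable def System.treeIdx (Q : System n) (es : List (Fin n × Fin n)) : Finset ℕ :=
  (Finset.range es.length).filter fun i =>
    ∃ h : i < es.length, s((es[i]'h).1, (es[i]'h).2) ∈ Q.T.edgeSet

open Classical in
theorem sum_edgeSet {G : SimpleGraph (Fin n)} {es : List (Fin n × Fin n)} (hes : ListsEdges G es)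
    (f : Sym2 (Fin n) → ℝ) (g : ℕ → ℝ)
    (hg : ∀ i (hi : i < es.length), g i = f s((es[i]'hi).1, (es[i]'hi).2)) :
    ∑ e : Sym2 (Fin n) with e ∈ G.edgeSet, f e = ∑ i ∈ Finset.range es.length, g i := by
  have h1 : (Finset.univ.filter (· ∈ G.edgeSet)) =
      (es.map fun e => s(e.1, e.2)).toFinset := by
    ext f
    rw [Finset.mem_filter, List.mem_toFinset, hes.2 f]
    simp
  rw [h1, List.sum_toFinset _ hes.1, List.map_map, Finset.sum_range,
    ← Fin.sum_univ_getElem]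
  refine Fintype.sum_equiv (finCongr (by simp)) _ _ fun i => ?_
  have hi : (i : ℕ) < es.length := by simpa using i.2
  simp [hg i hi]

variable (Q : System n) {es : List (Fin n × Fin n)}

theorem System.mem_treeIdx {i : ℕ} (hi : i < es.length) :
    i ∈ Q.treeIdx es ↔ s((es[i]'hi).1, (es[i]'hi).2) ∈ Q.T.edgeSet := by
  simp [System.treeIdx, hi]

theorem System.lt_of_mem_treeIdx {i : ℕ} (hi : i ∈ Q.treeIdx es) : i < es.length := by
  simp only [System.treeIdx, Finset.mem_filter, Finset.mem_range] at hi
  exact hi.1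

open Classical in
theorem System.sum_tree (hes : ListsEdges Q.G es) (f : Sym2 (Fin n) → ℝ) (g : ℕ → ℝ)
    (hg : ∀ i (hi : i < es.length), g i = f s((es[i]'hi).1, (es[i]'hi).2)) :
    ∑ e : Sym2 (Fin n) with e ∈ Q.T.edgeSet, f e = ∑ i ∈ Q.treeIdx es, g i := by
  have h1 : (Finset.univ.filter (· ∈ Q.T.edgeSet)) =
      (Finset.univ.filter (· ∈ Q.G.edgeSet)).filter (· ∈ Q.T.edgeSet) := by
    ext e
    simp only [Finset.mem_filter, Finset.mem_univ, true_and]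
    exact ⟨fun h => ⟨SimpleGraph.edgeSet_mono Q.le h, h⟩, fun h => h.2⟩
  rw [h1, Finset.sum_filter, sum_edgeSet hes _ (fun i => if i ∈ Q.treeIdx es then g i else 0),
    ← Finset.sum_filter]
  · refine Finset.sum_congr ?_ fun _ _ => rfl
    ext i
    simp only [Finset.mem_filter, Finset.mem_range]
    exact ⟨fun h => h.2, fun h => ⟨Q.lt_of_mem_treeIdx h, h⟩⟩
  · intro i hi
    simp only [Q.mem_treeIdx hi, hg i hi]

theorem System.ends_lt (hes : ListsEdges Q.G es) {i : ℕ} (hi : i < es.length) :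
    fstEnd es i < n ∧ sndEnd es i < n ∧ fstEnd es i ≠ sndEnd es i := by
  have h1 : s((es[i]'hi).1, (es[i]'hi).2) ∈ Q.G.edgeSet :=
    (hes.2 _).1 (List.mem_map.2 ⟨es[i], List.getElem_mem hi, rfl⟩)
  have h2 : (es[i]'hi).1 ≠ (es[i]'hi).2 := Q.G.ne_of_adj h1
  simp only [fstEnd, sndEnd, hi, dif_pos]
  exact ⟨Fin.is_lt _, Fin.is_lt _, fun h3 => h2 (Fin.ext h3)⟩

theorem System.card_treeIdx (hes : ListsEdges Q.G es) : (Q.treeIdx es).card + 1 = n := by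
  classical
  have h1 := Q.sum_tree hes (fun _ => 1) (fun _ => 1) (fun _ _ => rfl)
  have h2 := Q.isTree.card_edgeFinset
  rw [Fintype.card_fin] at h2
  simp only [Finset.sum_const, nsmul_eq_mul, mul_one] at h1
  have h3 : Finset.univ.filter (· ∈ Q.T.edgeSet) = Q.T.edgeFinset := by
    ext e; simp
  rw [h3] at h1
  have h4 : Q.T.edgeFinset.card = (Q.treeIdx es).card := by exact_mod_cast h1
  omega

/-- A tree walk from `x` to `y` has to leave `U` along some edge. -/
theorem System.cut_treeIdx (hes : ListsEdges Q.G es) (U : Set ℕ) {x y : ℕ} (hx : x < n)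
    (hxU : x ∈ U) (hy : y < n) (hyU : y ∉ U) : ∃ e ∈ Q.treeIdx es,
      (fstEnd es e ∈ U ∧ sndEnd es e ∉ U) ∨ (fstEnd es e ∉ U ∧ sndEnd es e ∈ U) := by
  obtain ⟨a, b, hab, ha, hb⟩ : ∃ a b : Fin n, Q.T.Adj a b ∧ (a : ℕ) ∈ U ∧ (b : ℕ) ∉ U := by
    obtain ⟨p⟩ := Q.isTree.connected.preconnected ⟨x, hx⟩ ⟨y, hy⟩
    obtain ⟨d, -, h1, h2⟩ := p.exists_boundary_dart {z : Fin n | (z : ℕ) ∈ U} hxU hyU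
    exact ⟨d.fst, d.snd, d.adj, h1, h2⟩
  have h1 : s(a, b) ∈ Q.G.edgeSet := Q.le hab
  obtain ⟨e, he, hab'⟩ := List.mem_map.1 ((hes.2 _).2 h1)
  obtain ⟨i, hi, rfl⟩ := List.getElem_of_mem he
  refine ⟨i, (Q.mem_treeIdx hi).2 (by rw [hab']; exact hab), ?_⟩
  simp only [fstEnd, sndEnd, hi, dif_pos]
  rcases Sym2.eq_iff.1 hab' with ⟨h2, h3⟩ | ⟨h2, h3⟩ <;> rw [h2, h3]
  · exact Or.inl ⟨ha, hb⟩
  · exact Or.inr ⟨hb, ha⟩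

/-- The contribution of an edge with weight `c` and endpoints `u`, `v` to entry `k` of the product
of the Laplacian with `x`. -/
noncomputable def edgeTerm (c : ℝ) (u v : ℕ) (x : ℕ → ℝ) (k : ℕ) : ℝ :=
  c * (x u - x v) * (unit u k - unit v k)

theorem edgeTerm_comm (c : ℝ) (u v : ℕ) (x : ℕ → ℝ) (k : ℕ) :
    edgeTerm c u v x k = edgeTerm c v u x k := by
  simp only [edgeTerm]; ring

theorem edgeTerm_eq (c : ℝ) (a b : Fin n) (x : ℕ → ℝ) (k : Fin n) :
    edgeTerm c a b x k = c * (edgeLap s(a, b) *ᵥ fun j : Fin n => x j) k := by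
  rw [edgeLap_mulVec]
  simp only [edgeTerm, unit, Pi.smul_apply, Pi.sub_apply, Pi.single_apply, smul_eq_mul, Fin.ext_iff]
  ring

theorem System.lapG_mulVec_apply (hes : ListsEdges Q.G es) (x : ℕ → ℝ) (k : Fin n) :
    (lap Q.G Q.w *ᵥ fun j : Fin n => x j) k =
      ∑ e ∈ Finset.range es.length, edgeTerm (Q.wt es e) (fstEnd es e) (sndEnd es e) x k := by
  classical
  rw [lap_mulVec, Finset.sum_apply]
  refine sum_edgeSet hes _ _ fun i hi => ?_
  simp only [fstEnd, sndEnd, System.wt, hi, dif_pos, edgeTerm_eq, Pi.smul_apply, smul_eq_mul]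

theorem System.lapT_mulVec_apply (hes : ListsEdges Q.G es) (x : ℕ → ℝ) (k : Fin n) :
    (lap Q.T Q.w *ᵥ fun j : Fin n => x j) k =
      ∑ e ∈ Q.treeIdx es, edgeTerm (Q.wt es e) (fstEnd es e) (sndEnd es e) x k := by
  classical
  rw [lap_mulVec, Finset.sum_apply]
  refine Q.sum_tree hes _ _ fun i hi => ?_
  simp only [fstEnd, sndEnd, System.wt, hi, dif_pos, edgeTerm_eq, Pi.smul_apply, smul_eq_mul]

theorem System.wt_pos (hes : ListsEdges Q.G es) {i : ℕ} (hi : i < es.length) : 0 < Q.wt es i := by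
  rw [System.wt, dif_pos hi]
  exact Q.w_pos _ ((hes.2 _).1 (List.mem_map.2 ⟨es[i], List.getElem_mem hi, rfl⟩))

/-- The initial state of the elimination. -/
theorem System.elimInv_init (hes : ListsEdges Q.G es) {cnt : ℕ} {q par pe : ℕ → ℕ}
    (hq : ∀ j < cnt, q j < n ∧ degree (fstEnd es) (sndEnd es) (Q.treeIdx es) (q j) = 1)
    (hinj : ∀ j < cnt, ∀ j' < cnt, q j = q j' → j = j')
    (hleaf : ∀ x < n, degree (fstEnd es) (sndEnd es) (Q.treeIdx es) x = 1 →
      ∃ j < cnt, q j = x) :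
    ElimInv (fstEnd es) (sndEnd es) n (Q.treeIdx es) 0 cnt q par pe (Q.treeIdx es)
      (Finset.range n) where
  mem_A x := by simp
  edges e he := by
    have := Q.ends_lt hes (Q.lt_of_mem_treeIdx he)
    simpa using this
  cardA := by simp
  cardF := by have := Q.card_treeIdx hes; omega
  cut U x hx hxU y hy hyU := Q.cut_treeIdx hes U (Finset.mem_range.1 hx) hxU
    (Finset.mem_range.1 hy) hyU
  le_cnt := Nat.zero_le _
  q_inj := hinj
  q_mem j _ hj := ⟨Finset.mem_range.2 (hq j hj).1, (hq j hj).2.le⟩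
  leaf x hx hdx := by
    obtain ⟨j, hj, h⟩ := hleaf x (Finset.mem_range.1 hx) hdx
    exact ⟨j, Nat.zero_le _, hj, h⟩
  sub := subset_rfl
  pe_mem j hj := absurd hj (Nat.not_lt_zero _)
  ends j hj := absurd hj (Nat.not_lt_zero _)
  par_lt j hj := absurd hj (Nat.not_lt_zero _)
  sum g := by simp

/-- A vector that is obtained from the flows `f` along the tree edges solves the tree system. -/
theorem System.pinv_lapT_mulVec (hes : ListsEdges Q.G es) {q par pe : ℕ → ℕ}
    (h : Elim (fstEnd es) (sndEnd es) n (Q.treeIdx es) q par pe) {r y f z : ℕ → ℝ}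
    (hr : ∀ k < n, r k = y k +
      ∑ j ∈ Finset.range (n - 1), f j * (unit (q j) k - unit (par j) k))
    (hy : ∀ j, j + 1 < n → y (q j) = 0) (hs : ∑ k : Fin n, r k = 0)
    (hz : ∀ j, j + 1 < n → z (q j) - z (par j) = f j / Q.wt es (pe j)) (k : Fin n) :
    (pinv (lap Q.T Q.w) *ᵥ fun j : Fin n => r j) k =
      z k - (∑ j ∈ Finset.range n, z j) / n := by
  -- A flow along edges has total divergence 0, so the remaining load `y` sums to 0; vanishing at
  -- all eliminated vertices, it is 0.
  have hs' : ∑ k ∈ Finset.range n, y k = 0 := by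
    rw [Fin.sum_univ_eq_sum_range] at hs
    rw [Finset.sum_congr rfl fun k hk => hr k (Finset.mem_range.1 hk), Finset.sum_add_distrib,
      Finset.sum_comm] at hs
    have h0 : ∑ j ∈ Finset.range (n - 1), ∑ k ∈ Finset.range n,
        f j * (unit (q j) k - unit (par j) k) = 0 := by
      refine Finset.sum_eq_zero fun j hj => ?_
      have hj' : j + 1 < n := by have := Finset.mem_range.1 hj; omega
      rw [← Finset.mul_sum, Finset.sum_sub_distrib, sum_unit (h.q_lt j hj'),
        sum_unit (h.par_lt j hj'), sub_self, mul_zero]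
    rwa [h0, add_zero] at hs
  have hy0 := h.eq_zero hy hs'
  -- By Ohm's law, potential difference times weight is the flow, so `L_T z` is the divergence of
  -- `f`, that is `r`. Then `z` differs from `L_T⁺ r` by its mean.
  have hL : lap Q.T Q.w *ᵥ (fun j : Fin n => z j) = fun j : Fin n => r j := by
    ext k
    rw [Q.lapT_mulVec_apply hes, h.sum, hr k k.2, hy0 k k.2, zero_add]
    refine Finset.sum_congr rfl fun j hj => ?_
    have hj' : j + 1 < n := by have := Finset.mem_range.1 hj; omega
    have hw := (Q.wt_pos hes (Q.lt_of_mem_treeIdx (h.pe_mem j hj'))).ne'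
    have hzj : Q.wt es (pe j) * (z (q j) - z (par j)) = f j := by
      rw [hz j hj', mul_div_cancel₀ _ hw]
    have key : edgeTerm (Q.wt es (pe j)) (fstEnd es (pe j)) (sndEnd es (pe j)) z k =
        edgeTerm (Q.wt es (pe j)) (q j) (par j) z k := by
      rcases h.ends j hj' with ⟨h1, h2⟩ | ⟨h1, h2⟩
      · rw [h1, h2]
      · rw [h1, h2, edgeTerm_comm]
    rw [key, edgeTerm, hzj]
  rw [← hL, pinv_lap_mulVec_lap_mulVec Q.isTree.connected Q.w_pos_tree, Fintype.card_fin,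
    Fin.sum_univ_eq_sum_range]

end EdgeList

/-! ### The program: elimination order of the tree

Arrays of naturals: `4` degrees, `6` index sums, `7` the queue, `8` and `9` the vertices and the
edges to which the eliminated vertices are attached, `10` the counter, `11` the length of the
queue, `12`, `13`, `14` a leaf, its edge and its neighbour. -/

/-- The memory holds the input. -/
structure Loaded {n : ℕ} (Q : System n) (es : List (Fin n × Fin n)) (k : ℕ) (s : Mem) : Prop where
  nat_n : s.nat 0 0 = n
  nat_m : s.nat 0 1 = es.length
  nat_k : s.nat 0 2 = k
  fst : s.nat 1 = fstEnd es
  snd : s.nat 2 = sndEnd es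
  mark : ∀ i < es.length, s.nat 3 i = 1 ↔ i ∈ Q.treeIdx es
  wt : s.real 0 = Q.wt es
  rhs : ∀ j : Fin n, s.real 1 j = Q.b j

variable {n : ℕ} {Q : System n} {es : List (Fin n × Fin n)} {k : ℕ}

theorem Loaded.frame {p : Prog} {s s' : Mem} (h : Loaded Q es k s) (hF : Frame p s s')
    (hn : ∀ a ∈ [0, 1, 2, 3], a ∉ p.natMods) (hr : ∀ a ∈ [0, 1], a ∉ p.realMods) :
    Loaded Q es k s' where
  nat_n := by rw [hF.nat 0 (hn 0 (by simp)), h.nat_n]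
  nat_m := by rw [hF.nat 0 (hn 0 (by simp)), h.nat_m]
  nat_k := by rw [hF.nat 0 (hn 0 (by simp)), h.nat_k]
  fst := by rw [hF.nat 1 (hn 1 (by simp)), h.fst]
  snd := by rw [hF.nat 2 (hn 2 (by simp)), h.snd]
  mark := by rw [hF.nat 3 (hn 3 (by simp))]; exact h.mark
  wt := by rw [hF.real 0 (hr 0 (by simp)), h.wt]
  rhs := by rw [hF.real 1 (hr 1 (by simp))]; exact h.rhs

theorem loaded_input : Loaded Q es k (Q.input es k) where
  nat_n := by simp [System.input]
  nat_m := by simp [System.input]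
  nat_k := by simp [System.input]
  fst := by ext i; simp [System.input, fstEnd]
  snd := by ext i; simp [System.input, sndEnd]
  mark i hi := by
    rw [Q.mem_treeIdx hi]
    simp [System.input, hi]
  wt := by ext i; simp [System.input, System.wt]
  rhs j := by simp [System.input]

/-- The number of vertices. -/
abbrev nE : NExp := .get 0 (.lit 0)

/-- The number of edges. -/
abbrev mE : NExp := .get 0 (.lit 1)

/-- Add `e` to cell `i` of array `a`. -/
abbrev incNat (a : ℕ) (i e : NExp) : Prog := .setNat a i (.add (.get a i) e)

/-- Subtract `e` from cell `i` of array `a`. -/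
abbrev decNat (a : ℕ) (i e : NExp) : Prog := .setNat a i (.sub (.get a i) e)

/-- Count an edge if it belongs to the tree. -/
def countBody : Prog :=
  .ite (.natEq (.get 3 (nv 10)) (.lit 1))
    (.seq (incNat 4 (.get 1 (nv 10)) (.lit 1)) (.seq (incNat 4 (.get 2 (nv 10)) (.lit 1))
      (.seq (incNat 6 (.get 1 (nv 10)) (nv 10)) (incNat 6 (.get 2 (nv 10)) (nv 10))))) .skip

/-- The memory holds degrees and index sums with respect to the edges in `F`. -/
def Counts (es : List (Fin n × Fin n)) (F : Finset ℕ) (s : Mem) : Prop :=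
  ∀ x, s.nat 4 x = degree (fstEnd es) (sndEnd es) F x ∧
    s.nat 6 x = indexSum (fstEnd es) (sndEnd es) F x

theorem wp_count (hes : ListsEdges Q.G es) {s : Mem} (hs : Loaded Q es k s)
    (h4 : s.nat 4 = 0) (h6 : s.nat 6 = 0) {S : ℕ} (hS : es.length + 1 ≤ S) :
    Wp (forLoop 10 mE countBody) (S * 100) (Counts es (Q.treeIdx es)) s := by
  have hL : ∀ s', Frame (forLoop 10 mE countBody) s s' → Loaded Q es k s' := fun s' hF =>
    hs.frame hF (by decide) (by decide)
  refine wp_forLoop_flat (N := es.length)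
    (fun i => Counts es ((Q.treeIdx es).filter (· < i)))
    (by decide) (by decide) (by decide) hS (fun s' hF => (hL s' hF).nat_m) ?_ ?_ ?_
  · intro x
    simp [h4, h6, degree, indexSum]
  · intro i s' hi hF hci hI x
    have hl := hL s' hF
    obtain ⟨hu, hv, hne⟩ := Q.ends_lt hes hi
    by_cases hm : i ∈ Q.treeIdx es
    · have h1 : (Q.treeIdx es).filter (· < i + 1) = insert i ((Q.treeIdx es).filter (· < i)) := by
        ext j
        simp only [Finset.mem_filter, Finset.mem_insert]
        constructor
        · rintro ⟨h1, h2⟩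
          by_cases h3 : j = i
          · exact Or.inl h3
          · exact Or.inr ⟨h1, by omega⟩
        · rintro (rfl | ⟨h1, h2⟩)
          · exact ⟨hm, by omega⟩
          · exact ⟨h1, by omega⟩
      have h2 : i ∉ (Q.treeIdx es).filter (· < i) := by simp
      rw [h1, degree_insert _ _ h2, indexSum_insert _ _ h2, ← (hI x).1, ← (hI x).2]
      simp only [countBody, Prog.run, Test.eval, NExp.eval, hci, (hl.mark i hi).2 hm, if_true,
        Mem.setNat_nat, hl.fst, hl.snd, Inc]
      rcases eq_or_ne x (fstEnd es i) with rfl | h3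
      · simp [hci, Function.update_apply, hne]
      · rcases eq_or_ne x (sndEnd es i) with rfl | h4
        · simp [hci, hne.symm]
        · simp [hci, Function.update_apply, h3, h4, h3.symm, h4.symm]
    · have h1 : (Q.treeIdx es).filter (· < i + 1) = (Q.treeIdx es).filter (· < i) := by
        ext j
        simp only [Finset.mem_filter]
        refine and_congr_right fun hj => ?_
        have : j ≠ i := fun h => hm (h ▸ hj)
        omega
      have h2 : s'.nat 3 i ≠ 1 := fun h => hm ((hl.mark i hi).1 h)
      rw [h1, ← (hI x).1, ← (hI x).2]
      simp [countBody, Prog.run, Test.eval, NExp.eval, hci, h2]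
  · intro s' hF hI
    have h1 : (Q.treeIdx es).filter (· < es.length) = Q.treeIdx es :=
      Finset.filter_true_of_mem fun i hi => Q.lt_of_mem_treeIdx hi
    rwa [h1] at hI

/-- Append a vertex to the queue if it is a leaf. -/
def pushBody : Prog :=
  .ite (.natEq (.get 4 (nv 10)) (.lit 1))
    (.seq (.setNat 7 (nv 11) (nv 10)) (incNat 11 (.lit 0) (.lit 1))) .skip

/-- The memory holds the state of the elimination after `i` steps. -/
def Eliminated (Q : System n) (es : List (Fin n × Fin n)) (i : ℕ) (s : Mem) : Prop :=
  ∃ F A, Counts es F s ∧ ElimInv (fstEnd es) (sndEnd es) n (Q.treeIdx es) i (s.nat 11 0)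
    (s.nat 7) (s.nat 8) (s.nat 9) F A

/-- Before round `i` all queued vertices are below `i`, which keeps the queue free of repetitions.
-/
theorem wp_push (hes : ListsEdges Q.G es) {s : Mem} (hs : Loaded Q es k s)
    (hc : Counts es (Q.treeIdx es) s) (h11 : s.nat 11 = 0) {S : ℕ} (hS : n + 1 ≤ S) :
    Wp (forLoop 10 nE pushBody) (S * 100) (Eliminated Q es 0) s := by
  have hL : ∀ s', Frame (forLoop 10 nE pushBody) s s' → Loaded Q es k s' := fun s' hF =>
    hs.frame hF (by decide) (by decide)
  have hC : ∀ s', Frame (forLoop 10 nE pushBody) s s' → Counts es (Q.treeIdx es) s' :=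
    fun s' hF x => by rw [hF.nat 4 (by decide), hF.nat 6 (by decide)]; exact hc x
  refine wp_forLoop_flat (N := n) (fun i s =>
    (∀ j < s.nat 11 0, s.nat 7 j < i ∧
      degree (fstEnd es) (sndEnd es) (Q.treeIdx es) (s.nat 7 j) = 1) ∧
    (∀ j < s.nat 11 0, ∀ j' < s.nat 11 0, s.nat 7 j = s.nat 7 j' → j = j') ∧
    (∀ x < i, degree (fstEnd es) (sndEnd es) (Q.treeIdx es) x = 1 →
      ∃ j < s.nat 11 0, s.nat 7 j = x))
    (by decide) (by decide) (by decide) hS (fun s' hF => (hL s' hF).nat_n) ?_ ?_ ?_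
  · simp [h11]
  · rintro i s' hi hF hci ⟨h1, h2, h3⟩
    have hd := (hC s' hF i).1
    by_cases hdi : degree (fstEnd es) (sndEnd es) (Q.treeIdx es) i = 1
    · have hupd : ∀ j < s'.nat 11 0, Function.update (s'.nat 7) (s'.nat 11 0) i j = s'.nat 7 j :=
        fun j hj => Function.update_of_ne (by omega) _ _
      simp only [pushBody, Prog.run, Test.eval, NExp.eval, hci, hd, hdi, if_true, Mem.setNat_nat]
      simp only [show (7 : ℕ) ≠ 10 by decide, show (11 : ℕ) ≠ 10 by decide,
        show (7 : ℕ) ≠ 11 by decide, show (11 : ℕ) ≠ 7 by decide,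
        if_false, Function.update_self]
      refine ⟨fun j hj => ?_, fun j hj j' hj' hjj => ?_, fun x hx hdx => ?_⟩
      · rcases (Nat.lt_succ_iff_lt_or_eq).1 hj with h4 | rfl
        · rw [hupd j h4]
          exact ⟨(h1 j h4).1.trans (Nat.lt_succ_self _), (h1 j h4).2⟩
        · rw [Function.update_self]
          exact ⟨Nat.lt_succ_self _, hdi⟩
      · rcases (Nat.lt_succ_iff_lt_or_eq).1 hj with h4 | rfl <;>
          rcases (Nat.lt_succ_iff_lt_or_eq).1 hj' with h5 | rfl
        · rw [hupd _ h4, hupd _ h5] at hjj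
          exact h2 j h4 j' h5 hjj
        · rw [hupd _ h4, Function.update_self] at hjj
          have := (h1 j h4).1
          omega
        · rw [hupd _ h5, Function.update_self] at hjj
          have := (h1 j' h5).1
          omega
        · rfl
      · rcases (Nat.lt_succ_iff_lt_or_eq).1 hx with h4 | rfl
        · obtain ⟨j, h5, h6⟩ := h3 x h4 hdx
          exact ⟨j, by omega, by rw [hupd j h5, h6]⟩
        · exact ⟨_, Nat.lt_succ_self _, Function.update_self ..⟩
    · have hne : ¬ (s'.nat 4 i = 1) := by rw [hd]; exact hdi
      simp only [pushBody, Prog.run, Test.eval, NExp.eval, hci, hne, if_false, Mem.setNat_nat]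
      simp only [show (7 : ℕ) ≠ 10 by decide, show (11 : ℕ) ≠ 10 by decide, if_false]
      refine ⟨fun j hj => ⟨(h1 j hj).1.trans (Nat.lt_succ_self _), (h1 j hj).2⟩, h2,
        fun x hx hdx => h3 x ?_ hdx⟩
      rcases (Nat.lt_succ_iff_lt_or_eq).1 hx with h4 | rfl
      · exact h4
      · exact absurd hdx hdi
  · rintro s' hF ⟨h1, h2, h3⟩
    exact ⟨_, _, hC s' hF, Q.elimInv_init hes h1 h2 h3⟩

/-- Eliminate the next leaf from the queue. -/
def elimBody : Prog :=
  .seq (.setNat 12 (.lit 0) (.get 7 (nv 10)))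
  (.seq (.setNat 13 (.lit 0) (.get 6 (nv 12)))
  (.seq (.setNat 14 (.lit 0) (.sub (.add (.get 1 (nv 13)) (.get 2 (nv 13))) (nv 12)))
  (.seq (.setNat 8 (nv 10) (nv 14))
  (.seq (.setNat 9 (nv 10) (nv 13))
  (.seq (decNat 4 (nv 12) (.lit 1))
  (.seq (decNat 4 (nv 14) (.lit 1))
  (.seq (decNat 6 (nv 12) (nv 13))
  (.seq (decNat 6 (nv 14) (nv 13))
  (.ite (.natEq (.get 4 (nv 14)) (.lit 1))
    (.seq (.setNat 7 (nv 11) (nv 14)) (incNat 11 (.lit 0) (.lit 1))) .skip)))))))))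

theorem wp_elim (hes : ListsEdges Q.G es) {s : Mem} (hs : Loaded Q es k s)
    (h0 : Eliminated Q es 0 s) {S : ℕ} (hS : n + 1 ≤ S) :
    Wp (forLoop 10 (.sub nE (.lit 1)) elimBody) (S * 200)
      (fun s' => Elim (fstEnd es) (sndEnd es) n (Q.treeIdx es) (s'.nat 7) (s'.nat 8) (s'.nat 9))
      s := by
  have hL : ∀ s', Frame (forLoop 10 (.sub nE (.lit 1)) elimBody) s s' → Loaded Q es k s' :=
    fun s' hF => hs.frame hF (by decide) (by decide)
  refine wp_forLoop_flat (N := n - 1) (Eliminated Q es)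
    (by decide) (by decide) (by decide) (by omega) (fun s' hF => ?_) ?_ ?_ ?_
  · simp only [NExp.eval, (hL s' hF).nat_n]
  · obtain ⟨F, A, h1, h2⟩ := h0
    exact ⟨F, A, fun x => by simpa using h1 x, by simpa using h2⟩
  · rintro i s' hi hF hci ⟨F, A, hC, hI⟩
    have hl := hL s' hF
    obtain ⟨e, heF, hsum, p, hp, hpv, hinc, hyes, hno⟩ := hI.step (by omega)
    have hd := fun x => degree_erase (fstEnd es) (sndEnd es) heF x
    have hx := fun x => indexSum_erase (fstEnd es) (sndEnd es) heF x
    have e1 : s'.nat 6 (s'.nat 7 i) = e := by rw [(hC _).2, hsum]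
    -- The truncated subtractions are exact, because `e` is counted at both of its ends, and they do
    -- not interfere, because these ends differ.
    have key : ∀ x, Function.update (Function.update (s'.nat 4) (s'.nat 7 i)
          (s'.nat 4 (s'.nat 7 i) - 1)) p (s'.nat 4 p - 1) x =
        degree (fstEnd es) (sndEnd es) (F.erase e) x := by
      intro x
      have h1 := hd x
      have h2 := (hC x).1
      rcases eq_or_ne x p with rfl | h3
      · rw [if_pos ((hinc _).2 (Or.inr rfl))] at h1
        rw [Function.update_self]; omega
      · rw [Function.update_of_ne h3]
        rcases eq_or_ne x (s'.nat 7 i) with h4 | h4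
        · rw [if_pos ((hinc _).2 (Or.inl h4))] at h1
          rw [h4, Function.update_self, ← h4]; omega
        · rw [if_neg (by rw [hinc]; tauto)] at h1
          rw [Function.update_of_ne h4]; omega
    have key' : ∀ x, Function.update (Function.update (s'.nat 6) (s'.nat 7 i)
          (s'.nat 6 (s'.nat 7 i) - e)) p (s'.nat 6 p - e) x =
        indexSum (fstEnd es) (sndEnd es) (F.erase e) x := by
      intro x
      have h1 := hx x
      have h2 := (hC x).2
      rcases eq_or_ne x p with rfl | h3
      · rw [if_pos ((hinc _).2 (Or.inr rfl))] at h1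
        rw [Function.update_self]; omega
      · rw [Function.update_of_ne h3]
        rcases eq_or_ne x (s'.nat 7 i) with h4 | h4
        · rw [if_pos ((hinc _).2 (Or.inl h4))] at h1
          rw [h4, Function.update_self, ← h4]; omega
        · rw [if_neg (by rw [hinc]; tauto)] at h1
          rw [Function.update_of_ne h4]; omega
    have hdp := key p
    rw [Function.update_self] at hdp
    by_cases h1 : degree (fstEnd es) (sndEnd es) (F.erase e) p = 1
    · refine ⟨F.erase e, A.erase (s'.nat 7 i), fun x => ?_, ?_⟩
      · rw [← key x, ← key' x]
        simp [elimBody, Prog.run, Test.eval, NExp.eval, hci, hl.fst, hl.snd, e1, hp,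
          Function.update_of_ne hpv, hdp, h1]
      · have := hyes h1
        simpa [elimBody, Prog.run, Test.eval, NExp.eval, hci, hl.fst, hl.snd, e1, hp,
          Function.update_of_ne hpv, hdp, h1] using this
    · refine ⟨F.erase e, A.erase (s'.nat 7 i), fun x => ?_, ?_⟩
      · rw [← key x, ← key' x]
        simp [elimBody, Prog.run, Test.eval, NExp.eval, hci, hl.fst, hl.snd, e1, hp,
          Function.update_of_ne hpv, hdp, h1]
      · have := hno h1
        simpa [elimBody, Prog.run, Test.eval, NExp.eval, hci, hl.fst, hl.snd, e1, hp,
          Function.update_of_ne hpv, hdp, h1] using this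
  · rintro s' hF ⟨F, A, -, hI⟩
    exact hI.elim fun e he => ⟨(Q.ends_lt hes (Q.lt_of_mem_treeIdx he)).1,
      (Q.ends_lt hes (Q.lt_of_mem_treeIdx he)).2.1⟩

/-- The memory holds the input and an elimination order of the tree. -/
structure Ready (Q : System n) (es : List (Fin n × Fin n)) (k : ℕ) (s : Mem) : Prop
    extends Loaded Q es k s where
  elim : Elim (fstEnd es) (sndEnd es) n (Q.treeIdx es) (s.nat 7) (s.nat 8) (s.nat 9)

theorem Ready.frame {p : Prog} {s s' : Mem} (h : Ready Q es k s) (hF : Frame p s s')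
    (hn : ∀ a ∈ [0, 1, 2, 3, 7, 8, 9], a ∉ p.natMods) (hr : ∀ a ∈ [0, 1], a ∉ p.realMods) :
    Ready Q es k s' where
  toLoaded := h.toLoaded.frame hF (fun a ha => hn a (by revert a; decide)) hr
  elim := by
    rw [hF.nat 7 (hn 7 (by simp)), hF.nat 8 (hn 8 (by simp)), hF.nat 9 (hn 9 (by simp))]
    exact h.elim

/-- Find an elimination order of the tree. -/
def orderProg : Prog :=
  .seq (forLoop 10 mE countBody)
    (.seq (forLoop 10 nE pushBody) (forLoop 10 (.sub nE (.lit 1)) elimBody))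

theorem wp_order (hes : ListsEdges Q.G es) {S : ℕ} (hn : n + 1 ≤ S) (hm : es.length + 1 ≤ S) :
    Wp orderProg (S * 400) (Ready Q es k) (Q.input es k) := by
  have h0 : Loaded Q es k (Q.input es k) := loaded_input
  have hz : ∀ a, 4 ≤ a → (Q.input es k).nat a = 0 := by
    intro a ha
    ext i
    simp [System.input, show a ≠ 0 by omega, show a ≠ 1 by omega, show a ≠ 2 by omega,
      show a ≠ 3 by omega]
  refine ((wp_count hes h0 (hz 4 (by omega)) (hz 6 (by omega)) hm).seq fun s₁ hF₁ h₁ => ?_).mono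
    (τ := S * 100 + (S * 100 + S * 200)) (by omega) fun s' hF h => h
  have hl₁ := h0.frame hF₁ (by decide) (by decide)
  refine (wp_push hes hl₁ h₁ (by rw [hF₁.nat 11 (by decide), hz 11 (by omega)]) hn).seq
    fun s₂ hF₂ h₂ => ?_
  have hl₂ := hl₁.frame hF₂ (by decide) (by decide)
  exact (wp_elim hes hl₂ h₂ hn).mono le_rfl fun s₃ hF₃ h₃ =>
    ⟨hl₂.frame hF₃ (by decide) (by decide), h₃⟩

/-! ### The program: vector operations and the tree solver

Arrays of reals: `2`, `3`, `4` iterate, residual and direction, `5` the preconditioned residual, `6`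
the product of the Laplacian with the direction, `7`, `8` work space of the tree solver, and scalars
in cell `0` of the arrays from `10` on. -/

section Vectors

variable {n : ℕ}

/-- Array `a` holds the vector `x`. -/
def Holds (s : Mem) (a : ℕ) (x : Fin n → ℝ) : Prop := ∀ j : Fin n, s.real a j = x j

theorem Holds.frame {p : Prog} {s s' : Mem} {a : ℕ} {x : Fin n → ℝ} (h : Holds s a x)
    (hF : Frame p s s') (ha : a ∉ p.realMods) : Holds s' a x := fun j => by
  rw [hF.real a ha]; exact h j

theorem Holds.eq {s : Mem} {a : ℕ} {x : Fin n → ℝ} (h : Holds s a x) :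
    (fun j : Fin n => s.real a j) = x := funext h

/-- The current cell of array `a`. -/
abbrev cur (a : ℕ) : RExp := .get a (nv 10)

/-- Cell `0` of array `a`. -/
abbrev rv (a : ℕ) : RExp := .get a (.lit 0)

/-- Set all entries of the vector in array `a`. -/
def mapLoop (a : ℕ) (e : RExp) : Prog := forLoop 10 nE (.setReal a (nv 10) e)

/-- The invariant also records that later cells are untouched, so `e` may read the old value of the
cell being written, as in `x := x + α p`. -/
theorem wp_mapLoop {a : ℕ} {e : RExp} {s : Mem} (hn : s.nat 0 0 = n) (f : Fin n → ℝ) {S : ℕ}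
    (hS : n + 1 ≤ S) (he : e.cost ≤ 50)
    (hf : ∀ (i : Fin n) s', Frame (mapLoop a e) s s' → s'.nat 10 0 = i →
      s'.real a i = s.real a i → e.eval s' = f i) :
    Wp (mapLoop a e) (S * 100) (fun s' => Holds s' a f) s := by
  refine wp_forLoop_flat (N := n) (fun i s' => (∀ j : Fin n, (j : ℕ) < i → s'.real a j = f j) ∧
      ∀ j, i ≤ j → s'.real a j = s.real a j)
    (by simp [Prog.natMods]) rfl ?_ hS (fun s' hF => ?_) ?_ ?_ ?_
  · simp only [Prog.flatCost, NExp.cost]; omega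
  · simp only [NExp.eval]
    rw [hF.nat 0 (by simp [forLoop, Prog.natMods]), hn]
  · exact ⟨fun j hj => absurd hj (Nat.not_lt_zero _), fun j _ => rfl⟩
  · rintro i s' hi hF hci ⟨h1, h2⟩
    have he' := hf ⟨i, hi⟩ s' hF hci (h2 i le_rfl)
    simp only [Prog.run, NExp.eval, hci, he', Mem.setNat_real, Mem.setReal_real, if_true]
    refine ⟨fun j hj => ?_, fun j hj => ?_⟩
    · rcases (Nat.lt_succ_iff_lt_or_eq).1 hj with h3 | h3
      · rw [Function.update_of_ne (by omega)]; exact h1 j h3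
      · rw [h3, Function.update_self]
        congr 1
        exact Fin.ext h3.symm
    · rw [Function.update_of_ne (by omega)]; exact h2 j (by omega)
  · exact fun s' _ h j => h.1 j j.2

/-- Put the dot product of the vectors in the arrays `a` and `b` into array `d`. -/
def dotLoop (d a b : ℕ) : Prog :=
  .seq (.setReal d (.lit 0) (.lit 0))
    (forLoop 10 nE (.setReal d (.lit 0) (.add (rv d) (.mul (cur a) (cur b)))))

theorem wp_dotLoop {d a b : ℕ} {s : Mem} (hn : s.nat 0 0 = n) {x y : Fin n → ℝ}
    (hx : Holds s a x) (hy : Holds s b y) (ha : a ≠ d) (hb : b ≠ d) {S : ℕ} (hS : n + 1 ≤ S) :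
    Wp (dotLoop d a b) (S * 103) (fun s' => s'.real d 0 = x ⬝ᵥ y) s := by
  refine (Wp.seq (Q := fun s' => s'.real d 0 = 0) (τ₂ := S * 100) (wp_flat rfl ?_)
    fun s₁ hF₁ h₁ => ?_).mono (τ' := S * 103) ?_ fun _ _ h => h
  · simp [Prog.run, RExp.eval, NExp.eval]
  · refine wp_forLoop_flat (N := n) (fun i s' => s'.real d 0 =
        ∑ j ∈ Finset.range i, s.real a j * s.real b j)
      (by simp [Prog.natMods]) rfl ?_ hS (fun s' hF => ?_) ?_ ?_ ?_
    · simp only [Prog.flatCost, NExp.cost, RExp.cost]; omega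
    · simp only [NExp.eval]
      rw [hF.nat 0 (by simp [forLoop, Prog.natMods]), hF₁.nat 0 (by simp [Prog.natMods]), hn]
    · simpa using h₁
    · intro i s' hi hF hci h
      have ha' : s'.real a = s.real a := by
        rw [hF.real a (by simpa [forLoop, Prog.realMods] using ha),
          hF₁.real a (by simpa [Prog.realMods] using ha)]
      have hb' : s'.real b = s.real b := by
        rw [hF.real b (by simpa [forLoop, Prog.realMods] using hb),
          hF₁.real b (by simpa [Prog.realMods] using hb)]
      simp [Prog.run, NExp.eval, RExp.eval, hci, ha', hb', h, Finset.sum_range_succ]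
    · intro s' _ h
      rw [h, dotProduct, Finset.sum_range]
      exact Finset.sum_congr rfl fun j _ => by rw [hx j, hy j]
  · simp only [Prog.flatCost, NExp.cost, RExp.cost]; omega

end Vectors

section Solver

variable {n : ℕ} {Q : System n} {es : List (Fin n × Fin n)} {k : ℕ}

/-- Push the load of an eliminated vertex to its neighbour. -/
def pushLoad : Prog :=
  .seq (.setReal 8 (nv 10) (.get 7 (.get 7 (nv 10))))
  (.seq (.setReal 7 (.get 8 (nv 10)) (.add (.get 7 (.get 8 (nv 10))) (cur 8)))
    (.setReal 7 (.get 7 (nv 10)) (.lit 0)))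

/-- Invariant: the original load is the current load plus the divergence of the flows stored so far.
An emptied vertex stays empty since no later load is pushed to an eliminated vertex. -/
theorem wp_pushLoad {s : Mem} (hs : Ready Q es k s) {r : ℕ → ℝ}
    (hr : ∀ j < n, s.real 7 j = r j) {S : ℕ} (hS : n + 1 ≤ S) :
    Wp (forLoop 10 (.sub nE (.lit 1)) pushLoad) (S * 100) (fun s' =>
      (∀ x < n, r x = s'.real 7 x + ∑ j ∈ Finset.range (n - 1),
        s'.real 8 j * (unit (s.nat 7 j) x - unit (s.nat 8 j) x)) ∧
      ∀ j, j + 1 < n → s'.real 7 (s.nat 7 j) = 0) s := by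
  refine wp_forLoop_flat (N := n - 1) (fun i s' =>
      (∀ x < n, r x = s'.real 7 x + ∑ j ∈ Finset.range i,
        s'.real 8 j * (unit (s.nat 7 j) x - unit (s.nat 8 j) x)) ∧
      ∀ j < i, s'.real 7 (s.nat 7 j) = 0)
    (by decide) (by decide) (by decide) (by omega) (fun s' hF => ?_) ?_ ?_ ?_
  · simp only [NExp.eval]
    rw [hF.nat 0 (by decide), hs.nat_n]
  · exact ⟨fun x hx => by simp [hr x hx], fun j hj => absurd hj (Nat.not_lt_zero _)⟩
  · rintro i s' hi hF hci ⟨h1, h2⟩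
    have h7 : s'.nat 7 = s.nat 7 := hF.nat 7 (by decide)
    have h8 : s'.nat 8 = s.nat 8 := hF.nat 8 (by decide)
    have hne : s.nat 7 i ≠ s.nat 8 i := hs.elim.q_ne_par i i le_rfl (by omega)
    simp only [pushLoad, Prog.run, NExp.eval, RExp.eval, hci, h7, h8, Mem.setNat_real,
      Mem.setReal_real, Mem.setReal_nat, if_true, show (7 : ℕ) ≠ 8 by decide,
      show (8 : ℕ) ≠ 7 by decide, if_false, Function.update_self]
    refine ⟨fun x hx => ?_, fun j hj => ?_⟩
    · rw [h1 x hx, Finset.sum_range_succ, Function.update_self]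
      have : ∑ j ∈ Finset.range i, Function.update (s'.real 8) i (s'.real 7 (s.nat 7 i)) j *
          (unit (s.nat 7 j) x - unit (s.nat 8 j) x) =
          ∑ j ∈ Finset.range i, s'.real 8 j * (unit (s.nat 7 j) x - unit (s.nat 8 j) x) := by
        refine Finset.sum_congr rfl fun j hj => ?_
        rw [Function.update_of_ne (Finset.mem_range.1 hj).ne]
      rw [this]
      rcases eq_or_ne x (s.nat 7 i) with rfl | hx1
      · simp [unit, hne]
        ring
      · rcases eq_or_ne x (s.nat 8 i) with rfl | hx2
        · simp [unit, hne.symm]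
          ring
        · simp [unit, hx1, hx2]
    · rcases eq_or_ne (s.nat 7 j) (s.nat 7 i) with h3 | h3
      · rw [h3, Function.update_self, Int.cast_zero]
      · have hji : j < i := by
          rcases (Nat.lt_succ_iff_lt_or_eq).1 hj with h4 | rfl
          · exact h4
          · exact absurd rfl h3
        rw [Function.update_of_ne h3, Function.update_of_ne
          (hs.elim.q_ne_par j i hji.le (by omega))]
        exact h2 j hji
  · exact fun s' _ h => ⟨h.1, fun j hj => h.2 j (by omega)⟩

/-- Set the potential of an eliminated vertex, in the reverse order. -/
def setPot : Prog :=
  .seq (.setNat 12 (.lit 0) (.sub (.sub nE (.lit 2)) (nv 10)))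
    (.setReal 5 (.get 7 (nv 12)) (.add (.get 5 (.get 8 (nv 12)))
      (.div (.get 8 (nv 12)) (.get 0 (.get 9 (nv 12))))))

/-- Backwards along the order, each neighbour `par j` has its final potential before `q j` is set,
and later writes hit neither of the two. -/
theorem wp_setPot {s : Mem} (hs : Ready Q es k s) {S : ℕ} (hS : n + 1 ≤ S) :
    Wp (forLoop 10 (.sub nE (.lit 1)) setPot) (S * 100) (fun s' =>
      ∀ j, j + 1 < n → s'.real 5 (s.nat 7 j) - s'.real 5 (s.nat 8 j) =
        s.real 8 j / Q.wt es (s.nat 9 j)) s := by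
  refine wp_forLoop_flat (N := n - 1) (fun i s' => ∀ j, n - 1 - i ≤ j → j + 1 < n →
      s'.real 5 (s.nat 7 j) - s'.real 5 (s.nat 8 j) = s.real 8 j / Q.wt es (s.nat 9 j))
    (by decide) (by decide) (by decide) (by omega) (fun s' hF => ?_) ?_ ?_ ?_
  · simp only [NExp.eval]
    rw [hF.nat 0 (by decide), hs.nat_n]
  · intro j h1 h2
    omega
  · intro i s' hi hF hci h j hj1 hj2
    have h0 : s'.nat 0 0 = n := by rw [hF.nat 0 (by decide), hs.nat_n]
    have h7 : s'.nat 7 = s.nat 7 := hF.nat 7 (by decide)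
    have h8 : s'.nat 8 = s.nat 8 := hF.nat 8 (by decide)
    have h9 : s'.nat 9 = s.nat 9 := hF.nat 9 (by decide)
    have hr8 : s'.real 8 = s.real 8 := hF.real 8 (by decide)
    have hr0 : s'.real 0 = Q.wt es := by rw [hF.real 0 (by decide), hs.wt]
    simp only [setPot, Prog.run, NExp.eval, RExp.eval, hci, Mem.setNat_real,
      Mem.setReal_real, Mem.setNat_nat, if_true, show (7 : ℕ) ≠ 12 by decide,
      show (8 : ℕ) ≠ 12 by decide, show (9 : ℕ) ≠ 12 by decide, if_false, Function.update_self,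
      h7, h8, h9, hr8, hr0, h0]
    -- Elimination steps are numbered `0, …, n - 2`, so round `i` of the reverse sweep treats `n - 2
    -- - i`.
    obtain ⟨J, hJ⟩ : ∃ J, n - 2 - i = J := ⟨_, rfl⟩
    rw [hJ]
    rcases eq_or_ne j J with rfl | hne
    · rw [Function.update_self, Function.update_of_ne
        (hs.elim.q_ne_par j j le_rfl hj2).symm]
      ring
    · rw [Function.update_of_ne fun h3 => hne (hs.elim.q_inj _ _ hj2 (by omega) h3),
        Function.update_of_ne (hs.elim.q_ne_par J j (by omega) hj2).symm]
      exact h j (by omega) hj2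
  · exact fun s' _ h j hj => h j (by omega) hj

/-- Apply the pseudo-inverse of the tree Laplacian to the residual. -/
def solveProg : Prog :=
  .seq (mapLoop 7 (cur 3))
  (.seq (forLoop 10 (.sub nE (.lit 1)) pushLoad)
  (.seq (mapLoop 5 (.lit 0))
  (.seq (forLoop 10 (.sub nE (.lit 1)) setPot)
  (.seq (mapLoop 7 (.lit 1))
  (.seq (dotLoop 13 5 7)
  (.seq (dotLoop 14 7 7)
    (mapLoop 5 (.sub (cur 5) (.div (rv 13) (rv 14))))))))))

theorem wp_solve (hes : ListsEdges Q.G es) {s : Mem} (hs : Ready Q es k s) {r : Fin n → ℝ}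
    (hr : Holds s 3 r) (hsum : ∑ j, r j = 0) {S : ℕ} (hS : n + 1 ≤ S) :
    Wp solveProg (S * 1000) (fun s' => Holds s' 5 (pinv (lap Q.T Q.w) *ᵥ r)) s := by
  refine ((wp_mapLoop (a := 7) (e := cur 3) hs.nat_n r hS (by decide) ?_).seq
    (τ₂ := S * 100 + (S * 100 + (S * 100 + (S * 100 + (S * 103 + (S * 103 + S * 100))))))
    fun s₁ hF₁ h₁ => ?_).mono (by omega) fun _ _ h => h
  · intro i s' hF hci _
    simp only [RExp.eval, NExp.eval, hci]
    rw [hF.real 3 (by decide), hr i]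
  have hs₁ := hs.frame hF₁ (by decide) (by decide)
  have hr₁ := hr.frame hF₁ (by decide)
  refine (wp_pushLoad hs₁ (r := s₁.real 3)
    (fun j hj => (h₁ ⟨j, hj⟩).trans (hr₁ ⟨j, hj⟩).symm) hS).seq fun s₂ hF₂ ⟨h₂, h₂'⟩ => ?_
  have hs₂ := hs₁.frame hF₂ (by decide) (by decide)
  -- The value left at the root is irrelevant, since the mean is subtracted at the end; nothing
  -- about it is kept.
  refine (wp_mapLoop hs₂.nat_n (fun _ => 0) hS (by decide) fun i s' hF hci _ => ?_).seq
    fun s₃ hF₃ _ => ?_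
  · simp [RExp.eval]
  have hs₃ := hs₂.frame hF₃ (by decide) (by decide)
  refine (wp_setPot hs₃ hS).seq fun s₄ hF₄ h₄ => ?_
  have hs₄ := hs₃.frame hF₄ (by decide) (by decide)
  refine (wp_mapLoop hs₄.nat_n (fun _ => 1) hS (by decide) fun i s' hF hci _ => ?_).seq
    fun s₅ hF₅ h₅ => ?_
  · simp [RExp.eval]
  have hs₅ := hs₄.frame hF₅ (by decide) (by decide)
  have hz₅ : Holds s₅ 5 (fun j : Fin n => s₄.real 5 j) := fun j => by rw [hF₅.real 5 (by decide)]
  refine (wp_dotLoop hs₅.nat_n hz₅ h₅ (by decide) (by decide) hS).seq fun s₆ hF₆ h₆ => ?_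
  have hs₆ := hs₅.frame hF₆ (by decide) (by decide)
  have ho₆ := h₅.frame hF₆ (by decide)
  have hz₆ := hz₅.frame hF₆ (by decide)
  refine (wp_dotLoop hs₆.nat_n ho₆ ho₆ (by decide) (by decide) hS).seq fun s₇ hF₇ h₇ => ?_
  have hs₇ := hs₆.frame hF₇ (by decide) (by decide)
  have hz₇ := hz₆.frame hF₇ (by decide)
  refine wp_mapLoop hs₇.nat_n _ hS (by decide) fun i s' hF hci hcur => ?_
  have e1 : s'.real 13 0 = ∑ j ∈ Finset.range n, s₄.real 5 j := by
    rw [hF.real 13 (by decide), hF₇.real 13 (by decide), h₆]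
    simp [dotProduct, Finset.sum_range]
  -- The machine cannot convert a natural number into a real one, so `n` is obtained as the dot
  -- product of the all-ones vector with itself.
  have e2 : s'.real 14 0 = n := by
    rw [hF.real 14 (by decide), h₇]
    simp [dotProduct]
  have e3 : s'.real 5 i = s₄.real 5 i := by rw [hcur, hz₇ i]
  simp only [RExp.eval, NExp.eval, hci, e1, e2, e3]
  rw [← hr₁.eq]
  have q7 : s₃.nat 7 = s₁.nat 7 := by rw [hF₃.nat 7 (by decide), hF₂.nat 7 (by decide)]
  have q8 : s₃.nat 8 = s₁.nat 8 := by rw [hF₃.nat 8 (by decide), hF₂.nat 8 (by decide)]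
  have q9 : s₃.nat 9 = s₁.nat 9 := by rw [hF₃.nat 9 (by decide), hF₂.nat 9 (by decide)]
  rw [q7, q8, q9, hF₃.real 8 (by decide)] at h₄
  refine (Q.pinv_lapT_mulVec hes hs₁.elim h₂ h₂' ?_ h₄ i).symm
  rw [← hsum]
  exact Finset.sum_congr rfl fun j _ => hr₁ j

/-- Add the contribution of an edge to the product of the Laplacian with the direction. -/
def edgeBody : Prog :=
  .seq (.setReal 15 (.lit 0) (.mul (cur 0)
    (.sub (.get 4 (.get 1 (nv 10))) (.get 4 (.get 2 (nv 10))))))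
  (.seq (.setReal 6 (.get 1 (nv 10)) (.add (.get 6 (.get 1 (nv 10))) (rv 15)))
    (.setReal 6 (.get 2 (nv 10)) (.sub (.get 6 (.get 2 (nv 10))) (rv 15))))

/-- Multiply the direction by the Laplacian of the graph. -/
def matvecProg : Prog := .seq (mapLoop 6 (.lit 0)) (forLoop 10 mE edgeBody)

theorem wp_matvec (hes : ListsEdges Q.G es) {s : Mem} (hs : Ready Q es k s) {p : Fin n → ℝ}
    (hp : Holds s 4 p) {S : ℕ} (hn : n + 1 ≤ S) (hm : es.length + 1 ≤ S) :
    Wp matvecProg (S * 200) (fun s' => Holds s' 6 (lap Q.G Q.w *ᵥ p)) s := by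
  refine ((wp_mapLoop hs.nat_n (fun _ => 0) hn (by decide) fun i s' hF hci _ => ?_).seq
    (τ₂ := S * 100) fun s₁ hF₁ h₁ => ?_).mono (by omega) fun _ _ h => h
  · simp [RExp.eval]
  have hs₁ := hs.frame hF₁ (by decide) (by decide)
  have hp₁ := hp.frame hF₁ (by decide)
  refine wp_forLoop_flat (N := es.length) (fun i s' => ∀ x : Fin n, s'.real 6 x =
      ∑ e ∈ Finset.range i, edgeTerm (Q.wt es e) (fstEnd es e) (sndEnd es e) (s₁.real 4) x)
    (by decide) (by decide) (by decide) hm (fun s' hF => ?_) ?_ ?_ ?_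
  · simp only [NExp.eval]
    rw [hF.nat 0 (by decide), hs₁.nat_m]
  · intro x
    simpa using h₁ x
  · intro i s' hi hF hci h x
    have hs' := hs₁.frame hF (by decide) (by decide)
    obtain ⟨-, -, hne⟩ := Q.ends_lt hes hi
    have h4 : s'.real 4 = s₁.real 4 := hF.real 4 (by decide)
    rw [Finset.sum_range_succ, ← h x]
    simp only [edgeBody, Prog.run, NExp.eval, RExp.eval, hci, Mem.setNat_real,
      Mem.setReal_real, Mem.setReal_nat, if_true, show (6 : ℕ) ≠ 15 by decide,
      show (15 : ℕ) ≠ 6 by decide, if_false, Function.update_self,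
      hs'.fst, hs'.snd, hs'.wt, h4, edgeTerm, unit]
    rcases eq_or_ne (x : ℕ) (fstEnd es i) with hx1 | hx1
    · rw [hx1]
      simp [hne]
    · rcases eq_or_ne (x : ℕ) (sndEnd es i) with hx2 | hx2
      · rw [hx2]
        simp [hne.symm]
        ring
      · simp [hx1, hx2]
  · intro s' _ h x
    rw [h x, ← hp₁.eq, Q.lapG_mulVec_apply hes]

end Solver

/-! ### The program: the iteration -/

section Iteration

variable {n : ℕ} {Q : System n} {es : List (Fin n × Fin n)} {k : ℕ}

/-- The memory holds the state `σ` of the method, and in real array `10` the product of the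
residual with the preconditioned residual. -/
structure HoldsState (Q : System n) (σ : CGState (Fin n)) (s : Mem) : Prop where
  x : Holds s 2 σ.x
  r : Holds s 3 σ.r
  p : Holds s 4 σ.p
  rz : s.real 10 0 = σ.r ⬝ᵥ (pinv (lap Q.T Q.w) *ᵥ σ.r)

/-- Set up the initial state. -/
def initProg : Prog :=
  .seq (mapLoop 3 (cur 1)) (.seq (mapLoop 2 (.lit 0)) (.seq solveProg
    (.seq (mapLoop 4 (cur 5)) (dotLoop 10 3 5))))

theorem sum_eq_zero_of_range {r : Fin n → ℝ} (hr : ∃ y, lap Q.G Q.w *ᵥ y = r) :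
    ∑ j, r j = 0 := by
  obtain ⟨y, rfl⟩ := hr
  exact sum_lap_mulVec y

theorem wp_init (hes : ListsEdges Q.G es) {s : Mem} (hs : Ready Q es k s) {S : ℕ}
    (hn : n + 1 ≤ S) :
    Wp initProg (S * 2000) (HoldsState Q (pcgInit (lap Q.T Q.w) Q.b)) s := by
  refine ((wp_mapLoop hs.nat_n Q.b hn (by decide) fun i s' hF hci _ => ?_).seq
    (τ₂ := S * 100 + (S * 1000 + (S * 100 + S * 103)))
    fun s₁ hF₁ h₁ => ?_).mono (by omega) fun _ _ h => h
  · simp only [RExp.eval, NExp.eval, hci]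
    rw [hF.real 1 (by decide), hs.rhs]
  have hs₁ := hs.frame hF₁ (by decide) (by decide)
  refine (wp_mapLoop hs₁.nat_n (fun _ => 0) hn (by decide) fun i s' hF hci _ => ?_).seq
    fun s₂ hF₂ h₂ => ?_
  · simp [RExp.eval]
  have hs₂ := hs₁.frame hF₂ (by decide) (by decide)
  have hr₂ := h₁.frame hF₂ (by decide)
  refine (wp_solve hes hs₂ hr₂ (sum_eq_zero_of_range Q.b_mem) hn).seq fun s₃ hF₃ h₃ => ?_
  have hs₃ := hs₂.frame hF₃ (by decide) (by decide)
  have hr₃ := hr₂.frame hF₃ (by decide)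
  have hx₃ := h₂.frame hF₃ (by decide)
  refine (wp_mapLoop hs₃.nat_n (pinv (lap Q.T Q.w) *ᵥ Q.b) hn (by decide)
    fun i s' hF hci _ => ?_).seq fun s₄ hF₄ h₄ => ?_
  · simp only [RExp.eval, NExp.eval, hci]
    rw [hF.real 5 (by decide), h₃]
  have hs₄ := hs₃.frame hF₄ (by decide) (by decide)
  have hr₄ := hr₃.frame hF₄ (by decide)
  have hx₄ := hx₃.frame hF₄ (by decide)
  have hz₄ := h₃.frame hF₄ (by decide)
  exact (wp_dotLoop hs₄.nat_n hr₄ hz₄ (by decide) (by decide) hn).mono le_rfl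
    fun s₅ hF₅ h₅ => ⟨hx₄.frame hF₅ (by decide), hr₄.frame hF₅ (by decide),
      h₄.frame hF₅ (by decide), h₅⟩

/-- One iteration. -/
def stepProg : Prog :=
  .seq matvecProg (.seq (dotLoop 11 4 6)
  (.seq (.setReal 11 (.lit 0) (.div (rv 10) (rv 11)))
  (.seq (mapLoop 2 (.add (cur 2) (.mul (rv 11) (cur 4))))
  (.seq (mapLoop 3 (.sub (cur 3) (.mul (rv 11) (cur 6))))
  (.seq solveProg (.seq (dotLoop 12 3 5)
  (.seq (.setReal 11 (.lit 0) (.div (rv 12) (rv 10)))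
  (.seq (mapLoop 4 (.add (cur 5) (.mul (rv 11) (cur 4))))
    (.setReal 10 (.lit 0) (rv 12))))))))))

/-- Real array `11` holds the denominator of `α`, then `α`, then `β`; array `10` keeps the old
product of residual and preconditioned residual until `β` has been formed. -/
theorem wp_step (hes : ListsEdges Q.G es) {s : Mem} (hs : Ready Q es k s) {σ : CGState (Fin n)}
    (hσ : HoldsState Q σ s) (hr : ∃ y, lap Q.G Q.w *ᵥ y = σ.r) {S : ℕ} (hn : n + 1 ≤ S)
    (hm : es.length + 1 ≤ S) :
    Wp stepProg (S * 3000) (HoldsState Q (plainStep (lap Q.G Q.w) (lap Q.T Q.w) σ)) s := by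
  obtain ⟨x, r, p⟩ := σ
  obtain ⟨hx, hr₀, hp, hrz⟩ := hσ
  simp only at hx hr₀ hp hrz hr
  simp only [plainStep]
  set A := lap Q.G Q.w with hA
  set P := pinv (lap Q.T Q.w) with hP
  set α := (r ⬝ᵥ (P *ᵥ r)) / (p ⬝ᵥ (A *ᵥ p)) with hα
  set r' := r - α • (A *ᵥ p) with hr'
  set β := (r' ⬝ᵥ (P *ᵥ r')) / (r ⬝ᵥ (P *ᵥ r)) with hβ
  -- The tree solver is correct only for vectors with sum 0; the new residual is one because it
  -- stays in the range of `L_G`.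
  have hsum : ∑ j, r' j = 0 := by
    obtain ⟨y, rfl⟩ := hr
    refine sum_eq_zero_of_range (Q := Q) ⟨y - α • p, ?_⟩
    rw [Matrix.mulVec_sub, Matrix.mulVec_smul]
  refine ((wp_matvec hes hs hp hn hm).seq (τ₂ := S * 103 + (7 + (S * 100 + (S * 100 +
    (S * 1000 + (S * 103 + (7 + (S * 100 + 4)))))))) fun s₁ hF₁ h₁ => ?_).mono (by omega)
    fun _ _ h => h
  have hs₁ := hs.frame hF₁ (by decide) (by decide)
  have hx₁ := hx.frame hF₁ (by decide)
  have hr₁ := hr₀.frame hF₁ (by decide)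
  have hp₁ := hp.frame hF₁ (by decide)
  have hrz₁ : s₁.real 10 0 = r ⬝ᵥ (P *ᵥ r) := by rw [hF₁.real 10 (by decide), hrz]
  refine (wp_dotLoop hs₁.nat_n hp₁ h₁ (by decide) (by decide) hn).seq fun s₂ hF₂ h₂ => ?_
  have hs₂ := hs₁.frame hF₂ (by decide) (by decide)
  have hx₂ := hx₁.frame hF₂ (by decide)
  have hr₂ := hr₁.frame hF₂ (by decide)
  have hp₂ := hp₁.frame hF₂ (by decide)
  have ha₂ := h₁.frame hF₂ (by decide)
  have hrz₂ : s₂.real 10 0 = r ⬝ᵥ (P *ᵥ r) := by rw [hF₂.real 10 (by decide), hrz₁]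
  refine ((wp_flat rfl (Q := fun s' => s'.real 11 0 = α) ?_).mono (τ' := 7) (by decide)
    fun _ _ h => h).seq fun s₃ hF₃ h₃ => ?_
  · simp [Prog.run, RExp.eval, NExp.eval, hrz₂, h₂, hα, hA]
  have hs₃ := hs₂.frame hF₃ (by decide) (by decide)
  have hx₃ := hx₂.frame hF₃ (by decide)
  have hr₃ := hr₂.frame hF₃ (by decide)
  have hp₃ := hp₂.frame hF₃ (by decide)
  have ha₃ := ha₂.frame hF₃ (by decide)
  have hrz₃ : s₃.real 10 0 = r ⬝ᵥ (P *ᵥ r) := by rw [hF₃.real 10 (by decide), hrz₂]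
  refine (wp_mapLoop hs₃.nat_n (x + α • p) hn (by decide) fun i s' hF hci hcur => ?_).seq
    fun s₄ hF₄ hx₄ => ?_
  · simp only [RExp.eval, NExp.eval, hci, hcur, hx₃ i]
    rw [hF.real 11 (by decide), hF.real 4 (by decide), h₃, hp₃ i]
    rfl
  have hs₄ := hs₃.frame hF₄ (by decide) (by decide)
  have hr₄ := hr₃.frame hF₄ (by decide)
  have hp₄ := hp₃.frame hF₄ (by decide)
  have ha₄ := ha₃.frame hF₄ (by decide)
  have hrz₄ : s₄.real 10 0 = r ⬝ᵥ (P *ᵥ r) := by rw [hF₄.real 10 (by decide), hrz₃]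
  have hα₄ : s₄.real 11 0 = α := by rw [hF₄.real 11 (by decide), h₃]
  refine (wp_mapLoop hs₄.nat_n r' hn (by decide) fun i s' hF hci hcur => ?_).seq
    fun s₅ hF₅ hr₅ => ?_
  · simp only [RExp.eval, NExp.eval, hci, hcur, hr₄ i]
    rw [hF.real 11 (by decide), hF.real 6 (by decide), hα₄, ha₄ i]
    rfl
  have hs₅ := hs₄.frame hF₅ (by decide) (by decide)
  have hx₅ := hx₄.frame hF₅ (by decide)
  have hp₅ := hp₄.frame hF₅ (by decide)
  have hrz₅ : s₅.real 10 0 = r ⬝ᵥ (P *ᵥ r) := by rw [hF₅.real 10 (by decide), hrz₄]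
  refine (wp_solve hes hs₅ hr₅ hsum hn).seq fun s₆ hF₆ hz₆ => ?_
  have hs₆ := hs₅.frame hF₆ (by decide) (by decide)
  have hx₆ := hx₅.frame hF₆ (by decide)
  have hr₆ := hr₅.frame hF₆ (by decide)
  have hp₆ := hp₅.frame hF₆ (by decide)
  have hrz₆ : s₆.real 10 0 = r ⬝ᵥ (P *ᵥ r) := by rw [hF₆.real 10 (by decide), hrz₅]
  refine (wp_dotLoop hs₆.nat_n hr₆ hz₆ (by decide) (by decide) hn).seq fun s₇ hF₇ h₇ => ?_
  have hs₇ := hs₆.frame hF₇ (by decide) (by decide)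
  have hx₇ := hx₆.frame hF₇ (by decide)
  have hr₇ := hr₆.frame hF₇ (by decide)
  have hp₇ := hp₆.frame hF₇ (by decide)
  have hz₇ := hz₆.frame hF₇ (by decide)
  have hrz₇ : s₇.real 10 0 = r ⬝ᵥ (P *ᵥ r) := by rw [hF₇.real 10 (by decide), hrz₆]
  refine ((wp_flat rfl (Q := fun s' => s'.real 11 0 = β) ?_).mono (τ' := 7) (by decide)
    fun _ _ h => h).seq fun s₈ hF₈ h₈ => ?_
  · simp [Prog.run, RExp.eval, NExp.eval, hrz₇, h₇, hβ, hP]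
  have hs₈ := hs₇.frame hF₈ (by decide) (by decide)
  have hx₈ := hx₇.frame hF₈ (by decide)
  have hr₈ := hr₇.frame hF₈ (by decide)
  have hp₈ := hp₇.frame hF₈ (by decide)
  have hz₈ := hz₇.frame hF₈ (by decide)
  have hrz₈ : s₈.real 12 0 = r' ⬝ᵥ (P *ᵥ r') := by rw [hF₈.real 12 (by decide), h₇]
  refine (wp_mapLoop hs₈.nat_n (P *ᵥ r' + β • p) hn (by decide) fun i s' hF hci hcur => ?_).seq
    fun s₉ hF₉ hp₉ => ?_
  · simp only [RExp.eval, NExp.eval, hci, hcur, hp₈ i]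
    rw [hF.real 11 (by decide), hF.real 5 (by decide), h₈, hz₈ i]
    rfl
  have hx₉ := hx₈.frame hF₉ (by decide)
  have hr₉ := hr₈.frame hF₉ (by decide)
  have hrz₉ : s₉.real 12 0 = r' ⬝ᵥ (P *ᵥ r') := by rw [hF₉.real 12 (by decide), hrz₈]
  refine ((wp_flat rfl (Q := fun s' => s'.real 10 0 = r' ⬝ᵥ (P *ᵥ r')) ?_).mono (by decide)
    fun s' hF h => ⟨hx₉.frame hF (by decide), hr₉.frame hF (by decide),
      hp₉.frame hF (by decide), h⟩)
  simp [Prog.run, RExp.eval, NExp.eval, hrz₉]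

/-- The preconditioned conjugate gradient method with a tree as preconditioner. -/
def pcgProg : Prog :=
  .seq orderProg (.seq initProg (forLoop 15 (.get 0 (.lit 2)) stepProg))

theorem wp_pcg (hes : ListsEdges Q.G es) {S : ℕ} (hn : n + 1 ≤ S) (hm : es.length + 1 ≤ S) :
    Wp pcgProg (S * (k + 1) * 6000) (fun s => Holds s 2 (Q.iterate k)) (Q.input es k) := by
  refine ((wp_order (k := k) hes hn hm).seq
    (τ₂ := S * 2000 + (k + 1) * (S * 3000 + NExp.cost (.get 0 (.lit 2)) + 10))
    fun s₁ hF₁ hs₁ => ?_).mono ?_ fun _ _ h => h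
  · refine (wp_init hes hs₁ hn).seq fun s₂ hF₂ h₂ => ?_
    have hs₂ := hs₁.frame hF₂ (by decide) (by decide)
    have hL : ∀ s', Frame (forLoop 15 (.get 0 (.lit 2)) stepProg) s₂ s' → Ready Q es k s' :=
      fun s' hF => hs₂.frame hF (by decide) (by decide)
    -- The outer counter uses natural array `15`, as the inner loops overwrite array `10`; the state
    -- involves only reals and ignores it.
    have hset : ∀ (i v : ℕ) (σ : CGState (Fin n)) (s : Mem), HoldsState Q σ s →
        HoldsState Q σ (s.setNat 15 i v) := fun i v σ s h => ⟨h.x, h.r, h.p, h.rz⟩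
    refine wp_forLoop (N := k)
      (fun i => HoldsState Q (plainState (lap Q.G Q.w) (lap Q.T Q.w) Q.b i))
      (by decide) (fun s' hF => (hL s' hF).nat_k) (hset _ _ _ _ h₂) ?_ ?_
    · intro i s' hi hF hci h
      refine (wp_step hes (hL s' hF) h (Q.precond.plainState_r Q.b_mem i) hn hm).mono le_rfl
        fun s'' _ h' => hset _ _ _ _ ?_
      rw [plainState_succ]
      exact h'
    · intro s' hF h j
      rw [h.x j, (plainState_eq k).1]
      rfl
  · simp only [NExp.cost]
    have h1 : 1 ≤ S := by omega
    have h2 : 12 * (k + 1) ≤ S * (k + 1) * 12 := by nlinarith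
    have h3 : S ≤ S * (k + 1) := Nat.le_mul_of_pos_right _ (by omega)
    have h4 : (k + 1) * (S * 3000 + (1 + 1) + 10) = S * (k + 1) * 3000 + 12 * (k + 1) := by ring
    omega

theorem outputs_pcg (hes : ListsEdges Q.G es) (k : ℕ) :
    Outputs pcgProg (Q.input es k) (Q.iterate k) (12000 * (n + es.length) * (k + 1)) := by
  have hpos := Q.pos
  obtain ⟨s', t, he, ht, h⟩ := wp_pcg (k := k) hes (S := n + es.length + 1) (by omega) (by omega)
  refine ⟨s', t, he, ?_, h⟩
  have h1 : (n + es.length + 1) * (k + 1) * 6000 ≤ 12000 * (n + es.length) * (k + 1) := by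
    have : n + es.length + 1 ≤ 2 * (n + es.length) := by omega
    calc (n + es.length + 1) * (k + 1) * 6000 ≤ 2 * (n + es.length) * (k + 1) * 6000 := by gcongr
      _ = _ := by ring
  exact_mod_cast ht.trans h1

end Iteration

/-! ### The running time -/

theorem Outputs.mono {n : ℕ} {P : Prog} {s : Mem} {x : Fin n → ℝ} {τ τ' : ℝ}
    (h : Outputs P s x τ) (hτ : τ ≤ τ') : Outputs P s x τ' := by
  obtain ⟨s', t, he, ht, hx⟩ := h
  exact ⟨s', t, he, ht.trans hτ, hx⟩

section RunningTime

variable {n : ℕ} {Q : System n} {es : List (Fin n × Fin n)}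

theorem System.card_le_length_add_one (hes : ListsEdges Q.G es) : n ≤ es.length + 1 := by
  have h1 := Q.card_treeIdx hes
  have h2 : (Q.treeIdx es).card ≤ es.length := by
    refine (Finset.card_le_card fun i hi => ?_).trans (Finset.card_range _).le
    exact Finset.mem_range.2 (Q.lt_of_mem_treeIdx hi)
  omega

/-- For `n ≥ 2`, `n ≤ 2 m` gives `n + m ≤ 3 m`, hence `36000 = 3 * 12000`. The additive 1 in `k + 1`
is absorbed by `1 ≤ ρ L / L₀`, so `ε` must stay away from 1. -/
theorem outputs_floor (hn : 2 ≤ n) (hes : ListsEdges Q.G es) {C ρ L L₀ : ℝ} (hC : 0 < C)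
    (hρ : 1 ≤ ρ) (hL₀ : 0 < L₀) (hL : L₀ ≤ L) :
    Outputs pcgProg (Q.input es ⌊C * ρ * L⌋₊) (Q.iterate ⌊C * ρ * L⌋₊)
      (36000 * (C + 1 / L₀) * (es.length * (ρ * L))) := by
  have hm : (n : ℝ) ≤ 2 * es.length := by
    have := System.card_le_length_add_one hes
    exact_mod_cast (by omega : n ≤ 2 * es.length)
  refine (outputs_pcg hes _).mono ?_
  have hL0 : 0 < L := hL₀.trans_le hL
  have h1 : (⌊C * ρ * L⌋₊ : ℝ) ≤ C * ρ * L := Nat.floor_le (by positivity)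
  have h2 : 1 ≤ 1 / L₀ * (ρ * L) := by
    rw [one_div_mul_eq_div, le_div_iff₀ hL₀]
    nlinarith
  calc 12000 * ((n : ℝ) + es.length) * (⌊C * ρ * L⌋₊ + 1)
      ≤ 12000 * (2 * es.length + es.length) * (C * ρ * L + 1 / L₀ * (ρ * L)) := by gcongr
    _ = _ := by ring

end RunningTime

/-- The order of the stretch of the trees of Abraham, Bartal and Neiman, up to a constant. -/
theorem stretch_order_le {x : ℝ} (hx : 16 ≤ x) : 1 ≤ Real.log x ∧ 1 ≤ Real.log (Real.log x) ∧
    Real.log x * Real.log (Real.log x) * Real.log (Real.log (Real.log x)) ^ 3 ≤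
      27 * (Real.log x * Real.log (Real.log x) ^ 2) := by
  -- This is where 16 enters: `ln 16 = 4 ln 2` exceeds `e`, so the iterated logarithm is at least 1.
  have h1 : Real.exp 1 ≤ Real.log x := by
    have h2 : Real.log 16 = 4 * Real.log 2 := by
      rw [show (16 : ℝ) = 2 ^ 4 by norm_num, Real.log_pow]; norm_num
    have h3 := Real.log_le_log (by norm_num) hx
    have h4 := Real.log_two_gt_d9
    have h5 := Real.exp_one_lt_d9
    linarith
  have h2 : 1 ≤ Real.log x := by
    have := Real.add_one_le_exp (1 : ℝ)
    linarith
  have h3 : 1 ≤ Real.log (Real.log x) := by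
    rwa [Real.le_log_iff_exp_le (by linarith)]
  refine ⟨h2, h3, ?_⟩
  set y := Real.log (Real.log x) with hy
  -- `ln y ≤ 3 y^(1/3)`: the cubed triple logarithm costs at most one more factor `log log`, whose
  -- cube root gives the exponent 2/3.
  have h4 : Real.log y ^ 3 ≤ 27 * y := by
    have h5 := Real.log_le_rpow_div (x := y) (by linarith) (show (0 : ℝ) < 1 / 3 by norm_num)
    calc Real.log y ^ 3 ≤ (y ^ (1 / 3 : ℝ) / (1 / 3)) ^ 3 :=
          pow_le_pow_left₀ (Real.log_nonneg h3) h5 3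
      _ = 27 * (y ^ (1 / 3 : ℝ)) ^ (3 : ℕ) := by ring
      _ = 27 * y := by
        rw [← Real.rpow_natCast, ← Real.rpow_mul (by linarith)]
        norm_num
  calc Real.log x * y * Real.log y ^ 3 ≤ Real.log x * y * (27 * y) := by gcongr
    _ = _ := by ring

end TreePCG

/-! ### Assembly: iteration count, linear time per iteration, and low-stretch trees. -/

theorem theorem3 :
    -- the number of iterations
    (∀ ε₀ : ℝ, 0 < ε₀ → ε₀ < 1 → ∃ C : ℝ, 0 < C ∧
      ∀ (n : ℕ) (Q : TreePCG.System n) (ε : ℝ), 0 < ε → ε ≤ ε₀ →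
        ∀ k : ℕ, ⌊C * Q.st ^ (1 / 3 : ℝ) * Real.log (1 / ε)⌋₊ ≤ k →
          Q.Accurate ε (Q.iterate k)) ∧
    -- the running time
    ∃ P : TreePCG.Prog,
      (∃ c : ℝ, ∀ (n : ℕ) (Q : TreePCG.System n) (es : List (Fin n × Fin n)) (k : ℕ),
        TreePCG.ListsEdges Q.G es →
          TreePCG.Outputs P (Q.input es k) (Q.iterate k) (c * (n + es.length) * (k + 1))) ∧
      (∀ ε₀ : ℝ, 0 < ε₀ → ε₀ < 1 → ∃ C c : ℝ, 0 < C ∧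
        ∀ (n : ℕ) (Q : TreePCG.System n) (es : List (Fin n × Fin n)) (ε : ℝ),
          2 ≤ n → TreePCG.ListsEdges Q.G es → 0 < ε → ε ≤ ε₀ →
          ∃ k : ℕ, k = ⌊C * Q.st ^ (1 / 3 : ℝ) * Real.log (1 / ε)⌋₊ ∧
            Q.Accurate ε (Q.iterate k) ∧
            TreePCG.Outputs P (Q.input es k) (Q.iterate k)
              (c * es.length * Q.st ^ (1 / 3 : ℝ) * Real.log (1 / ε))) ∧
      (∀ ε₀ K : ℝ, 0 < ε₀ → ε₀ < 1 → 0 < K → ∃ C c : ℝ, 0 < C ∧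
        ∀ (n : ℕ) (Q : TreePCG.System n) (es : List (Fin n × Fin n)) (ε : ℝ),
          16 ≤ n → TreePCG.ListsEdges Q.G es → 0 < ε → ε ≤ ε₀ →
          Q.st ≤ K * (es.length * Real.log n * Real.log (Real.log n) *
            Real.log (Real.log (Real.log n)) ^ 3) →
          ∃ k : ℕ, k = ⌊C * (es.length : ℝ) ^ (1 / 3 : ℝ) * Real.log n ^ (1 / 3 : ℝ) *
              Real.log (Real.log n) ^ (2 / 3 : ℝ) * Real.log (1 / ε)⌋₊ ∧
            Q.Accurate ε (Q.iterate k) ∧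
            TreePCG.Outputs P (Q.input es k) (Q.iterate k)
              (c * (es.length : ℝ) ^ (4 / 3 : ℝ) * Real.log n ^ (1 / 3 : ℝ) *
                Real.log (Real.log n) ^ (2 / 3 : ℝ) * Real.log (1 / ε))) := by
  have hlog : ∀ {ε₀ ε : ℝ}, 0 < ε₀ → ε₀ < 1 → 0 < ε → ε ≤ ε₀ →
      0 < Real.log (1 / ε₀) ∧ Real.log (1 / ε₀) ≤ Real.log (1 / ε) := by
    intro ε₀ ε h0 h1 hε hεε
    exact ⟨Real.log_pos (by rw [lt_div_iff₀ h0]; linarith),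
      Real.log_le_log (by positivity) (one_div_le_one_div_of_le hε hεε)⟩
  refine ⟨fun ε₀ h0 h1 => TreePCG.iteration_bound h0 h1, TreePCG.pcgProg,
    ⟨12000, fun n Q es k hes => TreePCG.outputs_pcg hes k⟩, ?_, ?_⟩
  · intro ε₀ h0 h1
    obtain ⟨C, hC, hacc⟩ := TreePCG.iteration_bound h0 h1
    refine ⟨C, 36000 * (C + 1 / Real.log (1 / ε₀)), hC, fun n Q es ε hn hes hε hεε =>
      ⟨_, rfl, hacc n Q ε hε hεε _ le_rfl, ?_⟩⟩
    obtain ⟨hL₀, hL⟩ := hlog h0 h1 hε hεε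
    refine (TreePCG.outputs_floor hn hes hC
      (Real.one_le_rpow (Q.one_le_st hn) (by norm_num)) hL₀ hL).mono (le_of_eq ?_)
    ring
  · intro ε₀ K h0 h1 hK
    obtain ⟨C, hC, hacc⟩ := TreePCG.iteration_bound h0 h1
    -- The factor `(27 K)^(1/3)` comes from the cube root of the stretch bound after
    -- `stretch_order_le`. A larger `k` than the stretch itself would require is harmless, since
    -- accuracy holds for all later iterates.
    refine ⟨C * (27 * K) ^ (1 / 3 : ℝ),
      36000 * (C * (27 * K) ^ (1 / 3 : ℝ) + 1 / Real.log (1 / ε₀)), by positivity,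
      fun n Q es ε hn hes hε hεε hst => ⟨_, rfl, ?_⟩⟩
    obtain ⟨hL₀, hL⟩ := hlog h0 h1 hε hεε
    obtain ⟨hl1, hl2, hl3⟩ := TreePCG.stretch_order_le (x := n) (by exact_mod_cast hn)
    have hm : (1 : ℝ) ≤ es.length := by
      have := TreePCG.System.card_le_length_add_one hes
      exact_mod_cast (by omega : 1 ≤ es.length)
    set m : ℝ := (es.length : ℝ)
    set l := Real.log n
    set l' := Real.log l
    set L := Real.log (1 / ε)
    set ρ := m ^ (1 / 3 : ℝ) * l ^ (1 / 3 : ℝ) * l' ^ (2 / 3 : ℝ) with hρ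
    have hρ1 : 1 ≤ ρ := by
      have e1 := Real.one_le_rpow hm (show (0 : ℝ) ≤ 1 / 3 by norm_num)
      have e2 := Real.one_le_rpow hl1 (show (0 : ℝ) ≤ 1 / 3 by norm_num)
      have e3 := Real.one_le_rpow hl2 (show (0 : ℝ) ≤ 2 / 3 by norm_num)
      exact one_le_mul_of_one_le_of_one_le (one_le_mul_of_one_le_of_one_le e1 e2) e3
    have hst1 : Q.st ^ (1 / 3 : ℝ) ≤ (27 * K) ^ (1 / 3 : ℝ) * ρ := by
      have e1 : Q.st ≤ 27 * K * (m * l * l' ^ 2) := by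
        calc Q.st ≤ K * m * (l * l' * Real.log l' ^ 3) := hst.trans_eq (by ring)
          _ ≤ K * m * (27 * (l * l' ^ 2)) := by gcongr
          _ = _ := by ring
      have e2 : ρ = (m * l * l' ^ 2) ^ (1 / 3 : ℝ) := by
        rw [Real.mul_rpow (by positivity) (by positivity),
          Real.mul_rpow (by positivity) (by positivity), ← Real.rpow_natCast l',
          ← Real.rpow_mul (by positivity), hρ]
        norm_num
      rw [e2, ← Real.mul_rpow (by positivity) (by positivity)]
      exact Real.rpow_le_rpow (by have := Q.one_le_st (by omega); linarith) e1 (by norm_num)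
    have hk : C * (27 * K) ^ (1 / 3 : ℝ) * m ^ (1 / 3 : ℝ) * l ^ (1 / 3 : ℝ) * l' ^ (2 / 3 : ℝ) * L
        = C * (27 * K) ^ (1 / 3 : ℝ) * ρ * L := by rw [hρ]; ring
    rw [hk]
    refine ⟨hacc n Q ε hε hεε _ (Nat.floor_le_floor ?_), ?_⟩
    · have hL0 : 0 ≤ L := hL₀.le.trans hL
      calc C * Q.st ^ (1 / 3 : ℝ) * L ≤ C * ((27 * K) ^ (1 / 3 : ℝ) * ρ) * L := by gcongr
        _ = _ := by ring
    · refine (TreePCG.outputs_floor (by omega) hes (by positivity) hρ1 hL₀ hL).mono (le_of_eq ?_)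
      have e1 : m ^ (4 / 3 : ℝ) = m * m ^ (1 / 3 : ℝ) := by
        rw [show (4 / 3 : ℝ) = 1 + 1 / 3 by norm_num, Real.rpow_add (by positivity), Real.rpow_one]
      rw [e1, hρ]
      ring
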